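/- Let $L\ge 1$, and fix description weights $\mu_0,\mu_1>0$ and distortion weights $\gamma_0,\gamma_1>0$. All distortions are mean squared errors per dimension, i.e. $\|x\|^2$ below means $\frac1L x^{t}x$. The source $X$ is a random vector in $\mathbb R^L$ with a density $f_X$, finite differential entropy $h(X)=-\int f_X\log_2 f_X$ and $\mathbb E\|X\|^2<\infty$. *Schemes.* A two-description lattice scheme consists of full-rank lattices $\Lambda_c,\Lambda_0,\Lambda_1,\Lambda_\pi\subset\mathbb R^L$ with cell volumes $\nu_c,\nu_0,\nu_1,\nu_\pi$. Write $N_i=\nu_i/\nu_c$ for the index values, and let $\tilde\Lambda_i=\mu_i^{1/L}\Lambda_i$ be the weighted side lattice, whose cell volume is $\mu_iN_i\nu_c$. It is required that $\Lambda_\pi\subset\Lambda_c\cap\tilde\Lambda_0\cap\tilde\Lambda_1$ (the side lattices may, but need not, be sublattices of $\Lambda_c$). Let $Q$ be a nearest-neighbour quantizer of $\Lambda_c$. A labeling function is an injective map $\alpha=(\alpha_0,\alpha_1):\Lambda_c\to\Lambda_0\times\Lambda_1$ such that $\tilde\alpha_i:=\mu_i^{1/L}\alpha_i$ satisfies $\tilde\alpha_i(\lambda_c+\lambda_\pi)=\tilde\alpha_i(\lambda_c)+\lambda_\pi$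 for all $\lambda_c\in\Lambda_c$, $\lambda_\pi\in\Lambda_\pi$, $i=0,1$. It is optimal if it minimizes, among all labeling functions, the cost $\mathbb E\big[\sum_{i=0}^{1}\gamma_i\|Q(X)-\tilde\alpha_i(Q(X))\|^2\big]$. If only description $i$ is received, the reconstruction is $\hat X_i=\tilde\alpha_i(Q(X))$, with expected distortion $\bar D_i=\mathbb E\|X-\hat X_i\|^2$. The rates are the entropies, in bits per dimension, $R_c=\frac1L H(Q(X))$ and $R_i=\frac1L H(\alpha_i(Q(X)))$. *Normalized second moments.* For a lattice $\Lambda$ with cell volume $\nu$ and Voronoi cell $V(0)$ at the origin, $G(\Lambda)=\nu^{-1-2/L}\int_{V(0)}\|x\|^2dx$; for the $L$-dimensional ball, $G(S_L)=\frac{1}{(L+2)\pi}\Gamma\!\left(\frac L2+1\right)^{2/L}$. *Theorem.* Consider a sequence of schemes with optimal labeling functions such that the covering radii of $\Lambda_c,\Lambda_0,\Lambda_1$ are at most $C\nu_c^{1/L},C\nu_0^{1/L},C\nu_1^{1/L}$, with $C$ the same for the whole sequence, and such that $N_i\to\infty$, $\nu_i\to0$ $(i=0,1)$, $\nu_cN_0N_1\to0$,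 and the covering radius of $\Lambda_\pi$ tends to $0$. Then for $\{i,j\}=\{0,1\}$ $$\bar D_i\sim\frac{\gamma_j^2}{(\gamma_0+\gamma_1)^2}\,G(S_L)\,\nu_c^{2/L}(N_0N_1)^{2/L}(\mu_0\mu_1)^{2/L}$$ and $$\bar D_i\sim\frac{\gamma_j^2}{(\gamma_0+\gamma_1)^2}\,G(S_L)\,2^{\frac2Lh(X)}\,2^{2(R_c-(R_0+R_1))},$$ where $a\sim b$ means $a/b\to1$ along the sequence. Moreover, $G(S_L)\le G(\Lambda)$ for every full-rank lattice $\Lambda\subset\mathbb R^L$, with strict inequality if $L\ge2$; hence the constant improves on the one in which $G(S_L)$ is replaced by the normalized second moment $G(\Lambda_\pi)$ of a product lattice (the side distortions of the design of Diggavi et al.). -/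

import Mathlib

open MeasureTheory Filter Topology Asymptotics

noncomputable section

namespace MDC

/-- The space `ℝ^L` with its Euclidean norm. -/
abbrev E (L : ℕ) : Type := EuclideanSpace ℝ (Fin L)

/-- The per-dimension squared error `‖x - y‖² / L`. -/
def sqErr {L : ℕ} (x y : E L) : ℝ := ‖x - y‖ ^ 2 / (L : ℝ)

/-- A (full-rank) lattice of `ℝ^L`. -/
def IsLattice {L : ℕ} (Λ : Submodule ℤ (E L)) : Prop :=
  DiscreteTopology Λ ∧ Submodule.span ℝ (Λ : Set (E L)) = ⊤

/-- The volume of a fundamental region (equivalently, of a Voronoi cell) of the lattice. -/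
def cellVol {L : ℕ} (Λ : Submodule ℤ (E L)) : ℝ := ZLattice.covolume Λ volume

/-- The (closed) Voronoi cell of the lattice point `l`. -/
def voronoi {L : ℕ} (Λ : Submodule ℤ (E L)) (l : E L) : Set (E L) :=
  {x | ∀ l' ∈ Λ, ‖x - l‖ ≤ ‖x - l'‖}

/-- The covering radius of the lattice is at most `ρ`. -/
def CoveringRadiusLE {L : ℕ} (Λ : Submodule ℤ (E L)) (ρ : ℝ) : Prop :=
  ∀ x : E L, ∃ l ∈ Λ, ‖x - l‖ ≤ ρ

/-- The dimensionless normalized second moment `G(Λ)` of a lattice. -/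
def latticeG {L : ℕ} (Λ : Submodule ℤ (E L)) : ℝ :=
  (∫ x in voronoi Λ 0, sqErr x 0) / cellVol Λ ^ (1 + 2 / (L : ℝ))

/-- The dimensionless normalized second moment `G(S_L)` of the `L`-dimensional ball. -/
def sphereG (L : ℕ) : ℝ :=
  1 / (((L : ℝ) + 2) * Real.pi) * Real.Gamma ((L : ℝ) / 2 + 1) ^ (2 / (L : ℝ))

/-- The linear factor that multiplies volumes in `ℝ^L` by `m`. -/
def linScale (L : ℕ) (m : ℝ) : ℝ := m ^ (1 / (L : ℝ))

/-- The lattices of a two-description scheme with description weights `μ 0, μ 1`: a central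
lattice, two side lattices, and a product lattice contained in the central lattice and in both
weighted side lattices (the weight `μ i` multiplies the cell volume of the `i`-th side lattice).
That the side lattices are contained in the central one is allowed but not demanded. -/
structure LatticeSystem (L : ℕ) (μ : Fin 2 → ℝ) where
  central : Submodule ℤ (E L)
  side : Fin 2 → Submodule ℤ (E L)
  prod : Submodule ℤ (E L)
  isLattice_central : IsLattice central
  isLattice_side : ∀ i, IsLattice (side i)
  isLattice_prod : IsLattice prod
  prod_le_central : prod ≤ central
  prod_le_side : ∀ i, ∀ x ∈ prod, ∃ y ∈ side i, linScale L (μ i) • y = x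

namespace LatticeSystem

variable {L : ℕ} {μ : Fin 2 → ℝ} (S : LatticeSystem L μ)

/-- Functions from the central lattice to the product of the side lattices. -/
abbrev Label : Type := S.central → (i : Fin 2) → S.side i

/-- The index value `N_i = ν_i / ν_c` of the `i`-th side lattice. -/
def index (i : Fin 2) : ℝ := cellVol (S.side i) / cellVol S.central

/-- The reconstruction from description `i` alone when the central point is `l`. -/
def recon (α : S.Label) (i : Fin 2) (l : S.central) : E L :=
  linScale L (μ i) • (α l i : E L)

/-- Labeling functions: every pair is used at most once, and the (weighted) labels are
invariant under shifts by the product lattice. -/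
structure IsLabeling (α : S.Label) : Prop where
  injective : Function.Injective α
  shift : ∀ l l' : S.central, (l' : E L) - (l : E L) ∈ S.prod →
    ∀ i, S.recon α i l' = S.recon α i l + ((l' : E L) - (l : E L))

/-- Nearest-neighbour quantizers of the central lattice (ties are broken arbitrarily, but
measurably). -/
structure IsQuantizer (Q : E L → S.central) : Prop where
  measurable : Measurable Q
  nearest : ∀ x, x ∈ voronoi S.central (Q x : E L)

variable {Ω : Type*} [MeasurableSpace Ω] (P : Measure Ω) (X : Ω → E L) (Q : E L → S.central)

/-- The cost of a labeling function: the `γ`-weighted expected squared error between the central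
reconstruction and the two side reconstructions. -/
def cost (γ : Fin 2 → ℝ) (α : S.Label) : ℝ :=
  ∫ ω, ∑ i, γ i * sqErr (Q (X ω) : E L) (S.recon α i (Q (X ω))) ∂P

/-- Optimal labeling functions: those of least cost. -/
def IsOptimal (γ : Fin 2 → ℝ) (α : S.Label) : Prop :=
  S.IsLabeling α ∧ ∀ β : S.Label, S.IsLabeling β → S.cost P X Q γ α ≤ S.cost P X Q γ β

/-- The expected side distortion from description `i` alone. -/
def sideDist (α : S.Label) (i : Fin 2) : ℝ :=
  ∫ ω, sqErr (X ω) (S.recon α i (Q (X ω))) ∂P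

end LatticeSystem

/-- The Shannon entropy, in bits, of a discrete random variable. -/
def entropyBits {Ω T : Type*} [MeasurableSpace Ω] (P : Measure Ω) (Y : Ω → T) : ℝ :=
  ∑' y : T, Real.negMulLog (P.real (Y ⁻¹' {y})) / Real.log 2

/-- The differential entropy, in bits, of a random vector with density `f`. -/
def diffEntropyBits {L : ℕ} (f : E L → ℝ) : ℝ :=
  ∫ x, Real.negMulLog (f x) / Real.log 2

namespace LatticeSystem

variable {L : ℕ} {μ : Fin 2 → ℝ} (S : LatticeSystem L μ)
variable {Ω : Type*} [MeasurableSpace Ω] (P : Measure Ω) (X : Ω → E L) (Q : E L → S.central)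

/-- The central rate `R_c` in bits per dimension: entropy of the quantized source vector. -/
def centralRate : ℝ := entropyBits P (fun ω => Q (X ω)) / (L : ℝ)

/-- The description rate `R_i` in bits per dimension: entropy of the `i`-th description. -/
def sideRate (α : S.Label) (i : Fin 2) : ℝ :=
  entropyBits P (fun ω => α (Q (X ω)) i) / (L : ℝ)

end LatticeSystem

end MDC

end

/-! ### Voronoi cells, and sums over lattice points compared with integrals -/

noncomputable section

namespace MDC

open scoped ENNReal Pointwise

section Lattice

variable {L : ℕ} {Λ : Submodule ℤ (E L)}

/-! Notation: Γ is the product lattice, ν_c the central cell volume, ν̃_i the cell volume of the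
i-th weighted side lattice, and r the radius of the ball B_r of volume ν̃_0ν̃_1/ν_c. Put θ =
γ_1/(γ_0+γ_1) and κ = γ_0γ_1/(γ_0+γ_1). If a central point c has reconstructions a and b, let d = b
− a and m = a + θd. In the cost the cross terms cancel, leaving (γ_0+γ_1)‖c−m‖² + κ‖d‖²
(`sum_cost_eq`). A good labeling therefore has m near c and uses differences as short as possible.

Lower bound. Every pair is used at most once. Per unit volume there are about vol(D)/(ν̃_0ν̃_1)
pairs with difference in a region D, against 1/ν_c central points. So the law of d has,
asymptotically, density at most 1/vol(B_r) (`label_tsum_le`, `exists_lintegral_diff_le`), and E‖d‖²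
is asymptotically at least its value r²L/(L+2) for the uniform law on B_r. The source enters only
through means of Γ-periodic functions of Q(X). As Γ becomes fine these approach averages over a
period, by continuity of translations in L¹ (`exists_lintegral_le_mean`), so the density needs no
regularity.

Upper bound. Join c to the pairs with ‖d‖ ≤ (1+ε)r and ‖m−c‖ ≤ εr. Modulo Γ this is a bipartite
graph in which no pair has a larger degree than any central point, so Hall's theorem gives a
labeling (`exists_label`) of normalized cost at most κL/(L+2) + o(1). An optimal labeling is
squeezed between the bounds: E‖c−m‖² = o(r²), E‖d‖² ~ r²L/(L+2) and E(‖d‖²−r²)₊ = o(r²)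
(`tendsto_of_isOptimal`). Since reconstruction i differs from m by a vector of length
γ_j/(γ_0+γ_1)·‖d‖, the first asymptotic formula follows.

Rates. The second formula amounts to h + H(Q) − H(α_0) − H(α_1) − log(ν̃_0ν̃_1/ν_c) → 0
(`tendsto_entropy`). Three inequalities give it: H(α_i) ≤ h − log ν̃_i + o(1), h ≤ H(Q) + log ν_c,
and H(Q) ≤ H(α_i) + log(ν̃_i/ν_c) + o(1). The last holds because, given one side point, the other
lies essentially in a ball of radius r around it. All three are instances of Gibbs' inequality.

Ball. Among sets of given volume a centred ball has the least second moment. Equality for a lattice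
would make the Voronoi cell a ball; then 2x is a lattice point for every x on its boundary sphere,
which for L ≥ 2 gives infinitely many lattice points in a bounded set. -/

theorem IsLattice.isZLattice (hΛ : IsLattice Λ) :
    haveI := hΛ.1; IsZLattice ℝ Λ := by
  have := hΛ.1
  exact ⟨hΛ.2⟩

theorem IsLattice.countable (hΛ : IsLattice Λ) : Countable Λ := by
  have := hΛ.1
  have := hΛ.isZLattice
  infer_instance

theorem IsLattice.finite_inter_closedBall (hΛ : IsLattice Λ) (x : E L) (R : ℝ) :
    (Metric.closedBall x R ∩ (Λ : Set (E L))).Finite := by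
  have := hΛ.1
  have H : IsClosed (Λ : Set (E L)) := @AddSubgroup.isClosed_of_discrete _ _ _ _ _
    Λ.toAddSubgroup (inferInstanceAs (DiscreteTopology Λ))
  exact Metric.finite_isBounded_inter_isClosed DiscreteTopology.isDiscrete
    Metric.isBounded_closedBall H

/-- The ball about `x` of radius `‖x‖` contains the origin and only finitely many lattice points,
and every lattice point outside it is further from `x` than the origin. -/
theorem IsLattice.exists_mem_voronoi (hΛ : IsLattice Λ) (x : E L) :
    ∃ l ∈ Λ, x ∈ voronoi Λ l := by
  have hne : (Metric.closedBall x ‖x‖ ∩ (Λ : Set (E L))).Nonempty :=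
    ⟨0, by simp, Λ.zero_mem⟩
  obtain ⟨l, hl, hmin⟩ := Set.exists_min_image _ (fun y => ‖x - y‖)
    (hΛ.finite_inter_closedBall x ‖x‖) hne
  refine ⟨l, hl.2, fun l' hl' => ?_⟩
  by_cases h : l' ∈ Metric.closedBall x ‖x‖
  · exact hmin l' ⟨h, hl'⟩
  · have h0 := hmin 0 ⟨by simp, Λ.zero_mem⟩
    rw [Metric.mem_closedBall, dist_comm, dist_eq_norm, not_le] at h
    simp only [sub_zero] at h0
    linarith

theorem isClosed_voronoi (Λ : Submodule ℤ (E L)) (l : E L) : IsClosed (voronoi Λ l) := by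
  have : voronoi Λ l = ⋂ l' ∈ Λ, {x | ‖x - l‖ ≤ ‖x - l'‖} := by
    ext x; simp [voronoi]
  rw [this]
  refine isClosed_biInter fun l' _ => isClosed_le (by fun_prop) (by fun_prop)

theorem vadd_voronoi {l : E L} (hl : l ∈ Λ) (y : E L) :
    l +ᵥ voronoi Λ y = voronoi Λ (l + y) := by
  ext x
  rw [Set.mem_vadd_set_iff_neg_vadd_mem]
  simp only [voronoi, vadd_eq_add, Set.mem_ofPred_eq]
  constructor
  · intro h l' hl'
    have := h (l' - l) (Λ.sub_mem hl' hl)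
    convert this using 2 <;> abel_nf
  · intro h l' hl'
    have := h (l' + l) (Λ.add_mem hl' hl)
    convert this using 2 <;> abel_nf

theorem volume_bisector {a b : E L} (hab : a ≠ b) :
    volume {x : E L | ‖x - a‖ = ‖x - b‖} = 0 := by
  have h := Measure.addHaar_affineSubspace (volume : Measure (E L))
    (AffineSubspace.perpBisector a b) (by simpa using hab)
  convert h using 2
  ext x
  simp [AffineSubspace.mem_perpBisector_iff_dist_eq, dist_eq_norm]

theorem aedisjoint_voronoi {a b : E L} (ha : a ∈ Λ) (hb : b ∈ Λ) (hab : a ≠ b) :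
    AEDisjoint volume (voronoi Λ a) (voronoi Λ b) :=
  measure_mono_null (fun _ hx => le_antisymm (hx.1 b hb) (hx.2 a ha)) (volume_bisector hab)

theorem volume_voronoi_eq {l : E L} (hl : l ∈ Λ) :
    volume (voronoi Λ l) = volume (voronoi Λ 0) := by
  rw [← add_zero l, ← vadd_voronoi hl 0]
  exact measure_vadd volume l _

/-- Distinct cells overlap only inside bisecting hyperplanes, which are null. This identifies the
covolume in `cellVol` with the volume of a Voronoi cell. -/
theorem IsLattice.isAddFundamentalDomain_voronoi (hΛ : IsLattice Λ) :
    IsAddFundamentalDomain Λ (voronoi Λ 0) volume where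
  nullMeasurableSet := (isClosed_voronoi Λ 0).measurableSet.nullMeasurableSet
  ae_covers := by
    refine ae_of_all _ fun x => ?_
    obtain ⟨l, hl, hx⟩ := hΛ.exists_mem_voronoi x
    refine ⟨⟨-l, Λ.neg_mem hl⟩, ?_⟩
    have := vadd_voronoi (Λ := Λ) hl 0
    rw [add_zero] at this
    rw [← this, Set.mem_vadd_set_iff_neg_vadd_mem] at hx
    exact hx
  aedisjoint := by
    intro a b hab
    have h1 : ∀ c : Λ, c +ᵥ voronoi Λ 0 = voronoi Λ (c : E L) := fun c => by
      have := vadd_voronoi (Λ := Λ) c.2 0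
      rw [add_zero] at this
      exact this
    simp only [Function.onFun, h1]
    exact aedisjoint_voronoi a.2 b.2 (fun h => hab (Subtype.ext h))

/-- The volume of the Voronoi cell, as an extended nonnegative real. -/
def cellVolE (Λ : Submodule ℤ (E L)) : ℝ≥0∞ := volume (voronoi Λ 0)

theorem IsLattice.cellVol_eq (hΛ : IsLattice Λ) : cellVol Λ = (cellVolE Λ).toReal := by
  have := hΛ.1
  have := hΛ.isZLattice
  exact ZLattice.covolume_eq_measure_fundamentalDomain Λ volume hΛ.isAddFundamentalDomain_voronoi

theorem IsLattice.cellVol_pos (hΛ : IsLattice Λ) : 0 < cellVol Λ := by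
  have := hΛ.1
  have := hΛ.isZLattice
  exact ZLattice.covolume_pos Λ volume

theorem IsLattice.cellVolE_eq (hΛ : IsLattice Λ) : cellVolE Λ = ENNReal.ofReal (cellVol Λ) := by
  rw [hΛ.cellVol_eq, ENNReal.ofReal_toReal]
  intro h
  have := hΛ.cellVol_pos
  rw [hΛ.cellVol_eq, h] at this
  simp at this

theorem IsLattice.cellVolE_ne_zero (hΛ : IsLattice Λ) : cellVolE Λ ≠ 0 := by
  rw [hΛ.cellVolE_eq]; simpa using hΛ.cellVol_pos

theorem IsLattice.cellVolE_ne_top (hΛ : IsLattice Λ) : cellVolE Λ ≠ ∞ := by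
  rw [hΛ.cellVolE_eq]; simp

theorem IsLattice.iUnion_voronoi (hΛ : IsLattice Λ) :
    ⋃ a : Λ, voronoi Λ (a : E L) = Set.univ := by
  refine Set.eq_univ_of_forall fun x => ?_
  obtain ⟨l, hl, hx⟩ := hΛ.exists_mem_voronoi x
  exact Set.mem_iUnion.2 ⟨⟨l, hl⟩, hx⟩

theorem pairwise_aedisjoint_voronoi (μ : Measure (E L)) (hμ : μ ≪ volume) :
    Pairwise (Function.onFun (AEDisjoint μ) fun a : Λ => voronoi Λ (a : E L)) :=
  fun a b hab => hμ (aedisjoint_voronoi a.2 b.2 (fun h => hab (Subtype.ext h)))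

theorem IsLattice.setLIntegral_eq_tsum (hΛ : IsLattice Λ) (H : E L → ℝ≥0∞) (s : Set (E L)) :
    ∫⁻ x in s, H x = ∑' a : Λ, ∫⁻ x in s ∩ voronoi Λ (a : E L), H x := by
  have := hΛ.countable
  rw [← setLIntegral_univ (μ := volume.restrict s), ← hΛ.iUnion_voronoi,
    lintegral_iUnion₀ (fun a => (isClosed_voronoi Λ _).measurableSet.nullMeasurableSet)
      (pairwise_aedisjoint_voronoi _ Measure.absolutelyContinuous_restrict)]
  refine tsum_congr fun a => ?_
  rw [Measure.restrict_restrict (isClosed_voronoi Λ _).measurableSet, Set.inter_comm]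

theorem IsLattice.lintegral_eq_tsum (hΛ : IsLattice Λ) (H : E L → ℝ≥0∞) :
    ∫⁻ x, H x = ∑' a : Λ, ∫⁻ x in voronoi Λ (a : E L), H x := by
  have := hΛ.setLIntegral_eq_tsum H Set.univ
  simpa using this

theorem IsLattice.measure_eq_tsum (hΛ : IsLattice Λ) (s : Set (E L)) :
    volume s = ∑' a : Λ, volume (s ∩ voronoi Λ (a : E L)) := by
  have := hΛ.setLIntegral_eq_tsum 1 s
  simpa using this

/-- All cells have the same volume, so sum and integral can be compared cell by cell. This and its
mirror image turn every count of lattice points below into a volume. -/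
theorem IsLattice.mul_tsum_le_lintegral (hΛ : IsLattice Λ) {F : Λ → ℝ≥0∞} {H : E L → ℝ≥0∞}
    (h : ∀ a : Λ, ∀ x ∈ voronoi Λ (a : E L), F a ≤ H x) :
    cellVolE Λ * ∑' a, F a ≤ ∫⁻ x, H x := by
  rw [hΛ.lintegral_eq_tsum, ← ENNReal.tsum_mul_left]
  refine ENNReal.tsum_le_tsum fun a => ?_
  rw [cellVolE, ← volume_voronoi_eq a.2, mul_comm, ← setLIntegral_const]
  exact setLIntegral_mono' (isClosed_voronoi Λ _).measurableSet (h a)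

theorem IsLattice.lintegral_le_mul_tsum (hΛ : IsLattice Λ) {F : Λ → ℝ≥0∞} {H : E L → ℝ≥0∞}
    (h : ∀ a : Λ, ∀ x ∈ voronoi Λ (a : E L), H x ≤ F a) :
    ∫⁻ x, H x ≤ cellVolE Λ * ∑' a, F a := by
  rw [hΛ.lintegral_eq_tsum, ← ENNReal.tsum_mul_left]
  refine ENNReal.tsum_le_tsum fun a => ?_
  rw [cellVolE, ← volume_voronoi_eq a.2, mul_comm, ← setLIntegral_const]
  exact setLIntegral_mono' (isClosed_voronoi Λ _).measurableSet (h a)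

theorem CoveringRadiusLE.norm_sub_le {ρ : ℝ} (h : CoveringRadiusLE Λ ρ) {x l : E L}
    (hx : x ∈ voronoi Λ l) : ‖x - l‖ ≤ ρ := by
  obtain ⟨l', hl', h'⟩ := h x
  exact (hx l' hl').trans h'

theorem CoveringRadiusLE.nonneg {ρ : ℝ} (h : CoveringRadiusLE Λ ρ) : 0 ≤ ρ := by
  obtain ⟨l', -, h'⟩ := h 0
  exact (norm_nonneg _).trans h'

/-- The lattice `s Λ`, for `s ≠ 0`. -/
def scaled (s : ℝ) (Λ : Submodule ℤ (E L)) : Submodule ℤ (E L) :=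
  ZLattice.comap ℝ Λ (s⁻¹ • LinearMap.id)

theorem mem_scaled {s : ℝ} {x : E L} : x ∈ scaled s Λ ↔ s⁻¹ • x ∈ Λ := Iff.rfl

theorem smul_mem_scaled {s : ℝ} (hs : s ≠ 0) {x : E L} : s • x ∈ scaled s Λ ↔ x ∈ Λ := by
  rw [mem_scaled, inv_smul_smul₀ hs]

theorem IsLattice.scaled (hΛ : IsLattice Λ) {s : ℝ} (hs : s ≠ 0) : IsLattice (scaled s Λ) := by
  have := hΛ.1
  constructor
  · refine ZLattice.comap_discreteTopology ℝ Λ ?_ ?_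
    · exact continuous_const_smul s⁻¹
    · exact smul_right_injective _ (inv_ne_zero hs)
  · refine ZLattice.comap_span_top ℝ Λ hΛ.2 fun x _ => ⟨s • x, ?_⟩
    simp [hs]

theorem voronoi_scaled {s : ℝ} (hs : s ≠ 0) : voronoi (scaled s Λ) 0 = s • voronoi Λ 0 := by
  ext x
  rw [Set.mem_smul_set_iff_inv_smul_mem₀ hs]
  have key : ∀ y : E L, ‖s⁻¹ • y‖ = |s|⁻¹ * ‖y‖ := fun y => by
    rw [norm_smul, norm_inv, Real.norm_eq_abs]
  have hs' : 0 < |s|⁻¹ := by positivity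
  constructor
  · intro h l hl
    have := h (s • l) ((smul_mem_scaled hs).2 hl)
    have e : s⁻¹ • x - l = s⁻¹ • (x - s • l) := by rw [smul_sub, inv_smul_smul₀ hs]
    rw [e, sub_zero, key, key]
    rw [sub_zero] at this
    gcongr
  · intro h l hl
    have := h (s⁻¹ • l) (mem_scaled.1 hl)
    rw [← smul_sub, sub_zero, key, key] at this
    rw [sub_zero]
    exact le_of_mul_le_mul_left this hs'

theorem IsLattice.cellVol_scaled (hΛ : IsLattice Λ) {s : ℝ} (hs : 0 < s) :
    cellVol (MDC.scaled s Λ) = s ^ L * cellVol Λ := by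
  rw [(hΛ.scaled hs.ne').cellVol_eq, hΛ.cellVol_eq, cellVolE, voronoi_scaled hs.ne',
    Measure.addHaar_smul, ENNReal.toReal_mul, ENNReal.toReal_ofReal (abs_nonneg _)]
  simp [abs_of_pos hs, cellVolE]

theorem CoveringRadiusLE.scaled {ρ s : ℝ} (hs : 0 < s) (h : CoveringRadiusLE Λ ρ) :
    CoveringRadiusLE (MDC.scaled s Λ) (s * ρ) := by
  intro x
  obtain ⟨l, hl, h'⟩ := h (s⁻¹ • x)
  refine ⟨s • l, (smul_mem_scaled hs.ne').2 hl, ?_⟩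
  have e : x - s • l = s • (s⁻¹ • x - l) := by rw [smul_sub, smul_inv_smul₀ hs.ne']
  rw [e, norm_smul, Real.norm_eq_abs, abs_of_pos hs]
  gcongr

end Lattice

end MDC

end

/-! ### Unfolding sums modulo a sublattice -/

noncomputable section

namespace MDC

open scoped ENNReal Pointwise

section Unfolding

/-- Both sides equal the sum of `w' (σ g t) * w t * G t` over all `g` and `t`. With indicators of
transversals as weights, this says that the sum of an invariant function over a transversal does not
depend on the transversal; general weights allow cells to be counted by fractions. No group
structure on `ι` is needed. -/
theorem tsum_unfold {ι T : Type*} (σ : ι → Equiv.Perm T) {G w w' : T → ℝ≥0∞} {K K' : ℝ≥0∞}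
    (hG : ∀ g t, G (σ g t) = G t) (hw : ∀ t, ∑' g, w ((σ g).symm t) = K)
    (hw' : ∀ t, ∑' g, w' (σ g t) = K') :
    K' * ∑' t, w t * G t = K * ∑' t, w' t * G t := by
  calc K' * ∑' t, w t * G t = ∑' t, ∑' g, w' (σ g t) * (w t * G t) := by
        rw [← ENNReal.tsum_mul_left]
        refine tsum_congr fun t => ?_
        rw [ENNReal.tsum_mul_right, hw']
    _ = ∑' g, ∑' t, w' (σ g t) * (w t * G t) := ENNReal.tsum_comm
    _ = ∑' g, ∑' t, w' t * (w ((σ g).symm t) * G t) := by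
        refine tsum_congr fun g => ?_
        rw [← (σ g).tsum_eq fun t => w' t * (w ((σ g).symm t) * G t)]
        refine tsum_congr fun t => ?_
        rw [Equiv.symm_apply_apply, hG]
    _ = ∑' t, ∑' g, w' t * (w ((σ g).symm t) * G t) := ENNReal.tsum_comm
    _ = K * ∑' t, w' t * G t := by
        rw [← ENNReal.tsum_mul_left]
        refine tsum_congr fun t => ?_
        rw [ENNReal.tsum_mul_left, ENNReal.tsum_mul_right, hw]
        ring

variable {L : ℕ}

/-- The chosen representative of `x` modulo the lattice `Γ`. -/
def repr (Γ : Submodule ℤ (E L)) (x : E L) : E L := Quotient.out (Submodule.Quotient.mk (p := Γ) x)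

theorem sub_repr_mem (Γ : Submodule ℤ (E L)) (x : E L) : x - repr Γ x ∈ Γ := by
  rw [← Submodule.Quotient.eq]
  exact (Quotient.out_eq _).symm

theorem repr_sub_mem (Γ : Submodule ℤ (E L)) (x : E L) : repr Γ x - x ∈ Γ := by
  have := Γ.neg_mem (sub_repr_mem Γ x)
  rwa [neg_sub] at this

theorem repr_eq_repr {Γ : Submodule ℤ (E L)} {x y : E L} (h : x - y ∈ Γ) :
    repr Γ x = repr Γ y := by
  rw [repr, repr, (Submodule.Quotient.eq Γ).2 h]

theorem repr_repr (Γ : Submodule ℤ (E L)) (x : E L) : repr Γ (repr Γ x) = repr Γ x :=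
  repr_eq_repr (repr_sub_mem Γ x)

open Classical in
/-- The indicator function of the set of representatives modulo `Γ`. -/
def repInd (Γ : Submodule ℤ (E L)) (x : E L) : ℝ≥0∞ := if repr Γ x = x then 1 else 0

theorem tsum_repInd_add (Γ : Submodule ℤ (E L)) (x : E L) :
    ∑' l : Γ, repInd Γ ((l : E L) + x) = 1 := by
  rw [tsum_eq_single ⟨repr Γ x - x, repr_sub_mem Γ x⟩]
  · simp [repInd, repr_repr]
  · intro l hl
    rw [repInd, if_neg]
    intro h
    apply hl
    ext1
    have : repr Γ ((l : E L) + x) = repr Γ x := repr_eq_repr (by simp)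
    rw [this] at h
    simp [h]

theorem tsum_repInd_sub (Γ : Submodule ℤ (E L)) (x : E L) :
    ∑' l : Γ, repInd Γ (-(l : E L) + x) = 1 := by
  rw [← tsum_repInd_add Γ x, ← (Equiv.neg Γ).tsum_eq]
  simp

/-- Translation of a lattice by an element of a sublattice. -/
def shift {Γ Λ : Submodule ℤ (E L)} (h : Γ ≤ Λ) (l : Γ) : Equiv.Perm Λ :=
  Equiv.addLeft ⟨l, h l.2⟩

@[simp] theorem coe_shift {Γ Λ : Submodule ℤ (E L)} (h : Γ ≤ Λ) (l : Γ) (x : Λ) :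
    (shift h l x : E L) = l + x := rfl

@[simp] theorem coe_shift_symm {Γ Λ : Submodule ℤ (E L)} (h : Γ ≤ Λ) (l : Γ) (x : Λ) :
    ((shift h l).symm x : E L) = -l + x := by
  simp [shift, Equiv.addLeft]

theorem IsLattice.tsum_volume_inter_preimage {Γ : Submodule ℤ (E L)} (hΓ : IsLattice Γ)
    (B : Set (E L)) :
    ∑' l : Γ, volume (voronoi Γ 0 ∩ (fun y => (l : E L) + y) ⁻¹' B) = volume B := by
  rw [hΓ.measure_eq_tsum B]
  refine tsum_congr fun l => ?_
  have h1 := vadd_voronoi l.2 (0 : E L)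
  rw [add_zero] at h1
  rw [← measure_preimage_add volume (l : E L) (B ∩ _)]
  congr 1
  ext y
  have : (l : E L) + y ∈ voronoi Γ (l : E L) ↔ y ∈ voronoi Γ 0 := by
    rw [← h1, Set.mem_vadd_set_iff_neg_vadd_mem]
    simp
  simp only [Set.mem_inter_iff, Set.mem_preimage, this, and_comm]

theorem preimage_add_voronoi {Λ : Submodule ℤ (E L)} {l : E L} (hl : l ∈ Λ) (c : E L) :
    (fun y => l + y) ⁻¹' voronoi Λ c = voronoi Λ (-l + c) := by
  ext x
  rw [← vadd_voronoi (Λ.neg_mem hl), Set.mem_vadd_set_iff_neg_vadd_mem]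
  simp

/-- Counting representatives: `[Λ : Γ] ν_Λ = ν_Γ`. -/
theorem IsLattice.cellVolE_mul_tsum_repInd {Γ Λ : Submodule ℤ (E L)} (hΓ : IsLattice Γ)
    (hΛ : IsLattice Λ) (h : Γ ≤ Λ) :
    cellVolE Λ * ∑' c : Λ, repInd Γ (c : E L) = cellVolE Γ := by
  -- Two weights for the action of `Γ` on `Λ`: the volume of the part of the cell of `c` inside the
  -- period cell, with orbit sum `cellVolE Λ`, and the indicator of representatives, with orbit sum
  -- `1`.
  have := tsum_unfold (shift h) (G := fun _ => 1)
    (w := fun c : Λ => volume (voronoi Γ 0 ∩ voronoi Λ (c : E L)))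
    (w' := fun c : Λ => repInd Γ (c : E L)) (K := cellVolE Λ) (K' := 1)
    (fun _ _ => rfl) (fun t => ?_) (fun t => by simpa using tsum_repInd_add Γ (t : E L))
  · rw [cellVolE, cellVolE, hΛ.measure_eq_tsum (voronoi Γ 0)]
    simpa [cellVolE] using this.symm
  · simp only [coe_shift_symm]
    rw [cellVolE, ← volume_voronoi_eq t.2, ← hΓ.tsum_volume_inter_preimage]
    refine tsum_congr fun l => ?_
    rw [preimage_add_voronoi (h l.2)]

theorem measurable_of_nearest_comp {Λ : Submodule ℤ (E L)} (hΛ : IsLattice Λ) {Q : E L → Λ}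
    (hQ : Measurable Q) {β : Type*} [MeasurableSpace β] (G : Λ → β) :
    Measurable fun x => G (Q x) := by
  have := hΛ.countable
  exact (measurable_of_countable G).comp hQ

/-- Ties occur on countably many null intersections of cells, so the tie-breaking rule of the
quantizer is immaterial. -/
theorem ae_eq_of_mem_voronoi {Λ : Submodule ℤ (E L)} (hΛ : IsLattice Λ) {Q : E L → Λ}
    (hQ : ∀ x, x ∈ voronoi Λ (Q x : E L)) :
    ∀ᵐ x, ∀ c : Λ, x ∈ voronoi Λ (c : E L) → Q x = c := by
  have := hΛ.countable
  rw [ae_all_iff]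
  intro c
  have : ∀ c' : Λ, ∀ᵐ x, c' ≠ c → ¬ (x ∈ voronoi Λ (c' : E L) ∧ x ∈ voronoi Λ (c : E L)) := by
    intro c'
    by_cases h : c' = c
    · simp [h]
    · have := aedisjoint_voronoi c'.2 c.2 (fun h' => h (Subtype.ext h'))
      filter_upwards [measure_eq_zero_iff_ae_notMem.1 this] with x hx _ hx'
      exact hx hx'
  filter_upwards [ae_all_iff.2 this] with x hx hxc
  by_contra h
  exact hx (Q x) h ⟨hQ x, hxc⟩

/-- The mean of a periodic function of the quantized vector over a translate of a period. -/
theorem lintegral_voronoi_comp_quantizer {Γ Λ : Submodule ℤ (E L)} (hΓ : IsLattice Γ)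
    (hΛ : IsLattice Λ) (h : Γ ≤ Λ) {Q : E L → Λ}
    (hQ : ∀ x, x ∈ voronoi Λ (Q x : E L)) {G : Λ → ℝ≥0∞}
    (hG : ∀ l l' : Λ, (l' : E L) - (l : E L) ∈ Γ → G l' = G l) (x : E L) :
    ∫⁻ y in voronoi Γ 0, G (Q (x + y)) = cellVolE Λ * ∑' c : Λ, repInd Γ (c : E L) * G c := by
  have hcount := hΛ.countable
  -- The weight of `c` is the volume of the part of its cell that lies in the period cell moved by
  -- `x`. Its orbit sum is `cellVolE Λ` for every `x`, so the mean does not depend on `x`.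
  have h1 := tsum_unfold (shift h) (G := G)
    (w := fun c : Λ => volume (voronoi Γ 0 ∩ (fun y => x + y) ⁻¹' voronoi Λ (c : E L)))
    (w' := fun c : Λ => repInd Γ (c : E L)) (K := cellVolE Λ) (K' := 1)
    (fun g t => hG _ _ (by simp)) (fun t => ?_)
    (fun t => by simpa using tsum_repInd_add Γ (t : E L))
  · rw [← h1, one_mul]
    have hmeas : ∀ c : Λ, MeasurableSet ((fun y => x + y) ⁻¹' voronoi Λ (c : E L)) := fun c =>
      (isClosed_voronoi Λ _).measurableSet.preimage (measurable_const_add x)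
    have hcov : ⋃ c : Λ, (fun y => x + y) ⁻¹' voronoi Λ (c : E L) = Set.univ := by
      rw [← Set.preimage_iUnion, hΛ.iUnion_voronoi, Set.preimage_univ]
    rw [← setLIntegral_univ (μ := volume.restrict _), ← hcov,
      lintegral_iUnion₀ (fun c => (hmeas c).nullMeasurableSet)]
    · refine tsum_congr fun c => ?_
      rw [Measure.restrict_restrict (hmeas c), Set.inter_comm, mul_comm, ← setLIntegral_const]
      refine setLIntegral_congr_fun_ae
        ((isClosed_voronoi Γ 0).measurableSet.inter (hmeas c)) ?_
      have := (measurePreserving_add_left volume x).quasiMeasurePreserving.ae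
        (ae_eq_of_mem_voronoi hΛ hQ)
      filter_upwards [this] with y hy hyc
      rw [hy c hyc.2]
    · intro a b hab
      refine AEDisjoint.of_le (μ := volume) ?_ Measure.restrict_le_self
      exact (measurePreserving_add_left volume x).quasiMeasurePreserving.preimage_null
        (aedisjoint_voronoi a.2 b.2 (fun h => hab (Subtype.ext h)))
  · simp only [coe_shift_symm]
    rw [cellVolE, ← volume_voronoi_eq t.2, ← measure_preimage_add volume x,
      ← hΓ.tsum_volume_inter_preimage]
    refine tsum_congr fun l => ?_
    rw [← preimage_add_voronoi (h l.2)]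
    congr 2
    ext y
    simp only [Set.mem_preimage]
    rw [add_left_comm]

end Unfolding

/-! ### Averaging a density over a fine lattice -/

section Translation

variable {L : ℕ}

/-- Continuity of translations in L¹: for a continuous compactly supported approximant, uniform
continuity bounds the difference pointwise on a ball slightly larger than the support. -/
theorem exists_lintegral_enorm_sub_translate_le {f : E L → ℝ} (hf : Integrable f) {ε : ℝ≥0∞}
    (hε : ε ≠ 0) :
    ∃ δ : ℝ, 0 < δ ∧ ∀ y : E L, ‖y‖ ≤ δ → ∫⁻ x, ‖f x - f (x - y)‖ₑ ≤ ε := by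
  have hε3 : ε / 3 ≠ 0 := by simp [hε]
  obtain ⟨h, hcs, hle, hcont, hint⟩ := hf.exists_hasCompactSupport_lintegral_sub_le hε3
  obtain ⟨R, hR⟩ := hcs.isCompact.isBounded.subset_closedBall 0
  set V : ℝ≥0∞ := volume (Metric.closedBall (0 : E L) (R + 1)) with hV
  have hVtop : V ≠ ∞ := measure_closedBall_lt_top.ne
  obtain ⟨η, hη0, hη⟩ : ∃ η : ℝ, 0 < η ∧ ENNReal.ofReal η * V ≤ ε / 3 := by
    by_cases hV0 : V = 0
    · exact ⟨1, one_pos, by simp [hV0]⟩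
    by_cases htop : ε / 3 = ∞
    · exact ⟨1, one_pos, by simp [htop]⟩
    refine ⟨(ε / 3 / V).toReal, ENNReal.toReal_pos (by simp [hVtop, hε]) ?_, ?_⟩
    · exact ENNReal.div_ne_top htop hV0
    · rw [ENNReal.ofReal_toReal (ENNReal.div_ne_top htop hV0), ENNReal.div_mul_cancel hV0 hVtop]
  have huc : UniformContinuous h := hcont.uniformContinuous_of_tendsto_cocompact hcs.is_zero_at_infty
  obtain ⟨δ, hδ0, hδ⟩ := Metric.uniformContinuous_iff.1 huc η hη0
  -- The cap `1` keeps `x - y` off the support whenever `x` lies outside the ball of radius `R + 1`.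
  refine ⟨min (δ / 2) 1, by positivity, fun y hy => ?_⟩
  have hyδ : ‖y‖ < δ := by
    have := hy.trans (min_le_left _ _); linarith
  have hy1 : ‖y‖ ≤ 1 := hy.trans (min_le_right _ _)
  have hsub : ∀ x, x ∉ Metric.closedBall (0 : E L) R → h x = 0 := fun x hx => by
    by_contra h0
    exact hx (hR (subset_tsupport _ h0))
  have hmid : ∫⁻ x, ‖h x - h (x - y)‖ₑ ≤ ε / 3 := by
    refine le_trans ?_ hη
    rw [hV, ← setLIntegral_const, ← lintegral_indicator measurableSet_closedBall]
    refine lintegral_mono fun x => ?_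
    by_cases hx : x ∈ Metric.closedBall (0 : E L) (R + 1)
    · simp only [Set.indicator_of_mem hx]
      rw [← ofReal_norm]
      refine ENNReal.ofReal_le_ofReal ?_
      rw [← dist_eq_norm]
      exact (hδ (by simpa [dist_eq_norm] using hyδ)).le
    · rw [hsub x, hsub (x - y)]
      · simp
      · simp only [Metric.mem_closedBall, dist_zero_right, not_le] at hx ⊢
        have := norm_sub_norm_le x y
        linarith
      · simp only [Metric.mem_closedBall, dist_zero_right, not_le] at hx ⊢
        linarith
  have hshift : ∫⁻ x, ‖h (x - y) - f (x - y)‖ₑ ≤ ε / 3 := by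
    rw [lintegral_sub_right_eq_self (fun x => ‖h x - f x‖ₑ) y]
    simpa [enorm_sub_rev] using hle
  calc ∫⁻ x, ‖f x - f (x - y)‖ₑ
      ≤ ∫⁻ x, (‖f x - h x‖ₑ + (‖h x - h (x - y)‖ₑ + ‖h (x - y) - f (x - y)‖ₑ)) := by
        refine lintegral_mono fun x => ?_
        have e : f x - f (x - y)
            = (f x - h x) + ((h x - h (x - y)) + (h (x - y) - f (x - y))) := by ring
        rw [e]
        exact (enorm_add_le _ _).trans (by gcongr; exact enorm_add_le _ _)
    _ = (∫⁻ x, ‖f x - h x‖ₑ) +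
          ((∫⁻ x, ‖h x - h (x - y)‖ₑ) + ∫⁻ x, ‖h (x - y) - f (x - y)‖ₑ) := by
        rw [lintegral_add_left' (f := fun x => ‖f x - h x‖ₑ) (hf.sub hint).1.enorm, lintegral_add_left']
        exact Continuous.aemeasurable (by fun_prop)
    _ ≤ ε / 3 + (ε / 3 + ε / 3) := by gcongr
    _ = ε := by rw [← add_assoc, ENNReal.add_thirds]

/-- A density is nearly uniform modulo a fine lattice: expectations of bounded periodic functions
are close to their means over a period. -/
theorem exists_lintegral_le_mean {f : E L → ℝ} (hf : Integrable f) (hfm : Measurable f)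
    (hf1 : ∫⁻ x, ENNReal.ofReal (f x) = 1) {ε : ℝ≥0∞} (hε : ε ≠ 0) :
    ∃ δ : ℝ, 0 < δ ∧ ∀ (Γ : Submodule ℤ (E L)) (g : E L → ℝ≥0∞) (m M : ℝ≥0∞), IsLattice Γ →
      CoveringRadiusLE Γ δ → Measurable g → (∀ x, g x ≤ M) →
      (∀ x, ∫⁻ y in voronoi Γ 0, g (x + y) = cellVolE Γ * m) →
      ∫⁻ x, ENNReal.ofReal (f x) * g x ≤ m + ε * M := by
  obtain ⟨δ, hδ0, hδ⟩ := exists_lintegral_enorm_sub_translate_le hf hε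
  refine ⟨δ, hδ0, fun Γ g m M hΓ hcov hg hM hmean => ?_⟩
  have hν0 := hΓ.cellVolE_ne_zero
  have hνt := hΓ.cellVolE_ne_top
  -- After multiplication by the cell volume, both sides are integrals over shifts `y` in the cell
  -- of `Γ`. Each such shift is short, so replacing `f x` by `f (x - y)` costs at most `ε * M`;
  -- after moving the shift to `g`, integrating over `y` first leaves only the constant mean of `g`.
  refine (ENNReal.mul_le_mul_iff_right hν0 hνt).1 ?_
  have hF : Measurable fun x => ENNReal.ofReal (f x) := hfm.ennreal_ofReal
  have hpt : ∀ x y, ENNReal.ofReal (f x) ≤ ENNReal.ofReal (f (x - y)) + ‖f x - f (x - y)‖ₑ := by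
    intro x y
    rw [← ofReal_norm, Real.norm_eq_abs]
    refine (ENNReal.ofReal_le_ofReal ?_).trans ENNReal.ofReal_add_le
    linarith [le_abs_self (f x - f (x - y))]
  calc cellVolE Γ * ∫⁻ x, ENNReal.ofReal (f x) * g x
      = ∫⁻ y in voronoi Γ 0, ∫⁻ x, ENNReal.ofReal (f x) * g x := by
        rw [setLIntegral_const, mul_comm, cellVolE]
    _ ≤ ∫⁻ y in voronoi Γ 0,
          ((∫⁻ x, ENNReal.ofReal (f x) * g (x + y)) + ε * M) := by
        refine setLIntegral_mono' (isClosed_voronoi Γ 0).measurableSet fun y hy => ?_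
        have hy' : ‖y‖ ≤ δ := by simpa using hcov.norm_sub_le hy
        calc ∫⁻ x, ENNReal.ofReal (f x) * g x
            ≤ ∫⁻ x, (ENNReal.ofReal (f (x - y)) * g x + ‖f x - f (x - y)‖ₑ * M) := by
              refine lintegral_mono fun x => ?_
              calc ENNReal.ofReal (f x) * g x
                  ≤ (ENNReal.ofReal (f (x - y)) + ‖f x - f (x - y)‖ₑ) * g x := by
                    gcongr; exact hpt x y
                _ = ENNReal.ofReal (f (x - y)) * g x + ‖f x - f (x - y)‖ₑ * g x := add_mul _ _ _
                _ ≤ _ := by gcongr; exact hM x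
          _ = (∫⁻ x, ENNReal.ofReal (f (x - y)) * g x) + (∫⁻ x, ‖f x - f (x - y)‖ₑ) * M := by
              rw [lintegral_add_left, lintegral_mul_const]
              · fun_prop
              · exact (hF.comp (measurable_sub_const y)).mul hg
          _ ≤ _ := by
              refine add_le_add (le_of_eq ?_) (mul_le_mul_left (hδ y hy') M)
              · rw [← lintegral_sub_right_eq_self
                  (fun x => ENNReal.ofReal (f x) * g (x + y)) y]
                simp
    _ = (∫⁻ y in voronoi Γ 0, ∫⁻ x, ENNReal.ofReal (f x) * g (x + y))
          + cellVolE Γ * (ε * M) := by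
        rw [lintegral_add_right _ measurable_const, setLIntegral_const, mul_comm (ε * M), cellVolE]
    _ = (∫⁻ x, ENNReal.ofReal (f x) * ∫⁻ y in voronoi Γ 0, g (x + y))
          + cellVolE Γ * (ε * M) := by
        rw [lintegral_lintegral_swap]
        · congr 1
          refine lintegral_congr fun x => ?_
          rw [lintegral_const_mul]
          exact hg.comp (measurable_const_add x)
        · refine Measurable.aemeasurable ?_
          exact (hF.comp measurable_snd).mul (hg.comp (measurable_snd.add measurable_fst))
    _ = cellVolE Γ * (m + ε * M) := by
        simp_rw [hmean]
        rw [lintegral_mul_const _ hF, hf1, one_mul, mul_add]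

end Translation

end MDC

end

/-! ### Volume and second moment of the ball -/

noncomputable section

namespace MDC

open scoped ENNReal Pointwise

section Ball

/-- The volume of the unit ball of `ℝ^L`. -/
def ballVol (L : ℕ) : ℝ := volume.real (Metric.ball (0 : E L) 1)

variable {L : ℕ}

theorem ballVol_eq (hL : 1 ≤ L) :
    ballVol L = √Real.pi ^ L / Real.Gamma ((L : ℝ) / 2 + 1) := by
  have : Nonempty (Fin L) := ⟨⟨0, hL⟩⟩
  have hΓ : 0 < Real.Gamma ((L : ℝ) / 2 + 1) := Real.Gamma_pos_of_pos (by positivity)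
  rw [ballVol, Measure.real, EuclideanSpace.volume_ball]
  simp only [ENNReal.ofReal_one, one_pow, one_mul, Fintype.card_fin]
  rw [ENNReal.toReal_ofReal (by positivity)]

theorem ballVol_pos (hL : 1 ≤ L) : 0 < ballVol L := by
  have hΓ : 0 < Real.Gamma ((L : ℝ) / 2 + 1) := Real.Gamma_pos_of_pos (by positivity)
  have := Real.pi_pos
  rw [ballVol_eq hL]
  positivity

theorem pow_rpow_two_div (hL : 1 ≤ L) {x : ℝ} (hx : 0 ≤ x) :
    (x ^ L) ^ (2 / (L : ℝ)) = x ^ 2 := by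
  have : (L : ℝ) ≠ 0 := by positivity
  rw [← Real.rpow_natCast, ← Real.rpow_mul hx, ← Real.rpow_natCast]
  congr 1
  push_cast
  field_simp

/-- Removes the Gamma function from the rest of the proof: the right side is the second moment per
dimension of the uniform law on the ball of radius `R`. -/
theorem sphereG_mul_rpow (hL : 1 ≤ L) {R V : ℝ} (hR : 0 ≤ R) (h : V = ballVol L * R ^ L) :
    sphereG L * V ^ (2 / (L : ℝ)) = R ^ 2 / ((L : ℝ) + 2) := by
  have hΓ : 0 < Real.Gamma ((L : ℝ) / 2 + 1) := Real.Gamma_pos_of_pos (by positivity)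
  have hπ := Real.pi_pos
  rw [h, ballVol_eq hL, sphereG, Real.mul_rpow (by positivity) (by positivity),
    Real.div_rpow (by positivity) hΓ.le, pow_rpow_two_div hL hR,
    pow_rpow_two_div hL (Real.sqrt_nonneg _), Real.sq_sqrt hπ.le]
  have : 0 < Real.Gamma ((L : ℝ) / 2 + 1) ^ (2 / (L : ℝ)) := by positivity
  field_simp

theorem volume_real_closedBall (x : E L) {R : ℝ} (hR : 0 ≤ R) :
    volume.real (Metric.closedBall x R) = ballVol L * R ^ L := by
  rw [Measure.real, Measure.addHaar_closedBall _ _ hR, ENNReal.toReal_mul,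
    ENNReal.toReal_ofReal (by positivity), finrank_euclideanSpace_fin, mul_comm, ballVol,
    Measure.real]

theorem volume_closedBall_eq (x : E L) {R : ℝ} (hR : 0 ≤ R) :
    volume (Metric.closedBall x R) = ENNReal.ofReal (ballVol L * R ^ L) := by
  rw [← volume_real_closedBall x hR, Measure.real,
    ENNReal.ofReal_toReal measure_closedBall_lt_top.ne]

theorem setIntegral_closedBall_norm_sq (hL : 1 ≤ L) {R : ℝ} (hR : 0 ≤ R) :
    ∫ x in Metric.closedBall (0 : E L) R, ‖x‖ ^ 2
      = ballVol L * R ^ (L + 2) * ((L : ℝ) / ((L : ℝ) + 2)) := by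
  have : Nontrivial (E L) := by
    have : Nonempty (Fin L) := ⟨⟨0, hL⟩⟩
    infer_instance
  have h := integral_fun_norm_addHaar (volume : Measure (E L))
    ((Set.Iic R).indicator fun y => y ^ 2)
  rw [← integral_indicator measurableSet_closedBall]
  have e : (fun x : E L => (Set.Iic R).indicator (fun y : ℝ => y ^ 2) ‖x‖)
      = (Metric.closedBall (0 : E L) R).indicator fun x => ‖x‖ ^ 2 := by
    ext x
    simp [Set.indicator, Metric.mem_closedBall]
  rw [e] at h
  rw [h, finrank_euclideanSpace_fin, nsmul_eq_mul, smul_eq_mul]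
  have h2 : ∫ y in Set.Ioi (0 : ℝ), y ^ (L - 1) • (Set.Iic R).indicator (fun y => y ^ 2) y
      = R ^ (L + 2) / ((L : ℝ) + 2) := by
    have e2 : (fun y : ℝ => y ^ (L - 1) • (Set.Iic R).indicator (fun y => y ^ 2) y)
        = (Set.Iic R).indicator fun y => y ^ (L + 1) := by
      ext y
      by_cases hy : y ≤ R
      · simp only [Set.indicator, Set.mem_Iic, hy, if_true, smul_eq_mul, ← pow_add]
        congr 1; omega
      · simp [Set.indicator, hy]
    rw [e2, setIntegral_indicator measurableSet_Iic, Set.Ioi_inter_Iic,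
      ← intervalIntegral.integral_of_le hR, integral_pow]
    push_cast
    rw [zero_pow (by omega)]
    ring
  rw [h2, ballVol]
  ring

theorem integrableOn_norm_sq {s : Set (E L)} (hs : Bornology.IsBounded s) :
    IntegrableOn (fun x : E L => ‖x‖ ^ 2) s := by
  obtain ⟨R, hR⟩ := hs.subset_closedBall 0
  exact (ContinuousOn.integrableOn_compact (isCompact_closedBall 0 R)
    (by fun_prop)).mono_set hR

end Ball

/-! ### The ball bound for normalized second moments of lattices -/

section Voronoi

variable {L : ℕ} {Λ : Submodule ℤ (E L)}

theorem IsLattice.exists_coveringRadiusLE (hΛ : IsLattice Λ) :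
    ∃ ρ : ℝ, CoveringRadiusLE Λ ρ := by
  have := hΛ.1
  have := hΛ.isZLattice
  let b := (Module.Free.chooseBasis ℤ Λ).ofZLatticeBasis ℝ
  have hb : Submodule.span ℤ (Set.range b) = Λ :=
    (Module.Free.chooseBasis ℤ Λ).ofZLatticeBasis_span ℝ
  refine ⟨∑ i, ‖b i‖, fun x => ⟨ZSpan.floor b x, ?_, ?_⟩⟩
  · exact hb.le (ZSpan.floor b x).2
  · exact ZSpan.norm_fract_le b x

theorem IsLattice.isBounded_voronoi (hΛ : IsLattice Λ) : Bornology.IsBounded (voronoi Λ 0) := by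
  obtain ⟨ρ, hρ⟩ := hΛ.exists_coveringRadiusLE
  refine Bornology.IsBounded.subset (Metric.isBounded_closedBall (x := 0) (r := ρ)) fun x hx => ?_
  simpa using hρ.norm_sub_le hx

theorem convex_voronoi (Λ : Submodule ℤ (E L)) : Convex ℝ (voronoi Λ 0) := by
  have key : voronoi Λ 0 = ⋂ l ∈ Λ, {x : E L | innerSL ℝ l x ≤ ‖l‖ ^ 2 / 2} := by
    ext x
    simp only [voronoi, Set.mem_iInter, Set.mem_ofPred_eq, sub_zero, innerSL_apply_apply]
    refine forall₂_congr fun l _ => ?_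
    rw [← sq_le_sq₀ (norm_nonneg _) (norm_nonneg _), norm_sub_sq_real, real_inner_comm]
    constructor <;> intro h <;> linarith
  rw [key]
  exact convex_iInter₂ fun l _ => convex_halfSpace_le (innerSL ℝ l).isLinear _

/-- Bathtub principle in pointwise form: the weight `‖x‖² - R²` is nonpositive on the ball and
positive off it, so no set collects less of it than the ball. -/
theorem indicator_ball_le_indicator (V : Set (E L)) (R : ℝ) (hR : 0 ≤ R) (x : E L) :
    (Metric.closedBall (0 : E L) R).indicator (fun x => ‖x‖ ^ 2 - R ^ 2) x
      ≤ V.indicator (fun x => ‖x‖ ^ 2 - R ^ 2) x := by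
  by_cases hx : x ∈ Metric.closedBall (0 : E L) R
  · have h0 : ‖x‖ ^ 2 - R ^ 2 ≤ 0 := by
      have : ‖x‖ ≤ R := by simpa using hx
      have := pow_le_pow_left₀ (norm_nonneg x) this 2
      linarith
    rw [Set.indicator_of_mem hx]
    by_cases hV : x ∈ V
    · rw [Set.indicator_of_mem hV]
    · rw [Set.indicator_of_notMem hV]; exact h0
  · rw [Set.indicator_of_notMem hx]
    have : R < ‖x‖ := by simpa using hx
    have := pow_lt_pow_left₀ this hR two_ne_zero
    exact Set.indicator_apply_nonneg fun _ => by linarith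

theorem integral_indicator_norm_sq_sub {V : Set (E L)} (hVm : MeasurableSet V)
    (hVb : Bornology.IsBounded V) (R : ℝ) :
    Integrable (V.indicator fun x => ‖x‖ ^ 2 - R ^ 2) ∧
    ∫ x, V.indicator (fun x => ‖x‖ ^ 2 - R ^ 2) x
      = (∫ x in V, ‖x‖ ^ 2) - volume.real V * R ^ 2 := by
  have h1 := integrableOn_norm_sq hVb
  have h2 : IntegrableOn (fun _ : E L => R ^ 2) V :=
    integrableOn_const hVb.measure_lt_top.ne
  refine ⟨(integrable_indicator_iff hVm).2 (h1.sub h2), ?_⟩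
  rw [integral_indicator hVm, integral_sub h1 h2, setIntegral_const, smul_eq_mul]

theorem IsLattice.latticeG_eq (hΛ : IsLattice Λ) (hL : 1 ≤ L) :
    ∃ R : ℝ, 0 < R ∧ cellVol Λ = ballVol L * R ^ L ∧
      latticeG Λ * (cellVol Λ ^ (1 + 2 / (L : ℝ)) * L) = ∫ x in voronoi Λ 0, ‖x‖ ^ 2 ∧
      sphereG L * (cellVol Λ ^ (1 + 2 / (L : ℝ)) * L)
        = ∫ x in Metric.closedBall (0 : E L) R, ‖x‖ ^ 2 := by
  have hν := hΛ.cellVol_pos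
  have hv := ballVol_pos hL
  have hL0 : (L : ℝ) ≠ 0 := by positivity
  have hR : 0 < (cellVol Λ / ballVol L) ^ (1 / (L : ℝ)) := by positivity
  have hVR : cellVol Λ = ballVol L * ((cellVol Λ / ballVol L) ^ (1 / (L : ℝ))) ^ L := by
    rw [← Real.rpow_natCast, ← Real.rpow_mul (by positivity), one_div_mul_cancel hL0,
      Real.rpow_one]
    field_simp
  refine ⟨_, hR, hVR, ?_, ?_⟩
  · rw [latticeG]
    have : 0 < cellVol Λ ^ (1 + 2 / (L : ℝ)) := by positivity
    have e : ∀ x : E L, sqErr x 0 = ‖x‖ ^ 2 / L := fun x => by simp [sqErr]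
    simp_rw [e]
    rw [integral_div]
    field_simp
  · rw [setIntegral_closedBall_norm_sq hL hR.le, Real.rpow_add hν, Real.rpow_one, ← mul_assoc,
      mul_left_comm, sphereG_mul_rpow hL hR.le hVR, pow_add, ← mul_assoc, ← hVR]
    ring

/-- Integrate the bathtub inequality for the ball with the volume of the cell; equal volumes cancel
the `R²` terms. In case of equality a nonnegative function has integral zero, which gives the second
claim. -/
theorem IsLattice.sphereG_le_latticeG (hΛ : IsLattice Λ) (hL : 1 ≤ L) :
    sphereG L ≤ latticeG Λ ∧ (sphereG L = latticeG Λ →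
      ∃ R : ℝ, 0 < R ∧ ∀ᵐ x : E L, (Metric.closedBall (0 : E L) R).indicator
        (fun x => ‖x‖ ^ 2 - R ^ 2) x = (voronoi Λ 0).indicator (fun x => ‖x‖ ^ 2 - R ^ 2) x) := by
  obtain ⟨R, hR, hV, h1, h2⟩ := hΛ.latticeG_eq hL
  have hν := hΛ.cellVol_pos
  have hpos : 0 < cellVol Λ ^ (1 + 2 / (L : ℝ)) * L := by positivity
  obtain ⟨hi1, he1⟩ := integral_indicator_norm_sq_sub (isClosed_voronoi Λ 0).measurableSet
    hΛ.isBounded_voronoi R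
  obtain ⟨hi2, he2⟩ := integral_indicator_norm_sq_sub (L := L)
    (V := Metric.closedBall (0 : E L) R) measurableSet_closedBall Metric.isBounded_closedBall R
  have hvol : volume.real (voronoi Λ 0) = volume.real (Metric.closedBall (0 : E L) R) := by
    rw [volume_real_closedBall _ hR.le, ← hV, hΛ.cellVol_eq]; rfl
  constructor
  · refine le_of_mul_le_mul_right ?_ hpos
    have := integral_mono hi2 hi1 (indicator_ball_le_indicator (voronoi Λ 0) R hR.le)
    rw [he1, he2, hvol] at this
    rw [h1, h2]
    linarith
  · intro heq
    refine ⟨R, hR, ?_⟩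
    have h0 := integral_sub hi1 hi2
    rw [he1, he2, hvol, ← h1, ← h2, heq, sub_self] at h0
    have h3 := (integral_eq_zero_iff_of_nonneg (fun x => sub_nonneg.2
      (indicator_ball_le_indicator (voronoi Λ 0) R hR.le x)) (hi1.sub hi2)).1 h0
    filter_upwards [h3] with x hx
    simp only [Pi.zero_apply] at hx
    linarith

/-- The open ball minus the closed cell is open and null, hence empty. A point of the cell beyond
radius `R` would, by convexity and since `0` is interior, produce an open set of cell points beyond
`R`, of positive measure. -/
theorem closedBall_subset_voronoi_of_ae {R : ℝ} (hR : 0 < R)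
    (h : ∀ᵐ x : E L, (Metric.closedBall (0 : E L) R).indicator (fun x => ‖x‖ ^ 2 - R ^ 2) x
      = (voronoi Λ 0).indicator (fun x => ‖x‖ ^ 2 - R ^ 2) x) :
    voronoi Λ 0 = Metric.closedBall 0 R := by
  have hball : Metric.ball (0 : E L) R ⊆ voronoi Λ 0 := by
    have ho : IsOpen (Metric.ball (0 : E L) R \ voronoi Λ 0) :=
      Metric.isOpen_ball.sdiff (isClosed_voronoi Λ 0)
    rw [← Set.sdiff_eq_empty, ← ho.measure_eq_zero_iff volume, measure_eq_zero_iff_ae_notMem]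
    filter_upwards [h] with x hx hx'
    rw [Set.indicator_of_mem (Metric.ball_subset_closedBall hx'.1),
      Set.indicator_of_notMem hx'.2] at hx
    have : ‖x‖ < R := by simpa using hx'.1
    have := pow_lt_pow_left₀ this (norm_nonneg _) two_ne_zero
    linarith
  apply subset_antisymm
  · intro x hx
    by_contra hxR
    have hxR' : R < ‖x‖ := by simpa using hxR
    have h0 : (0 : E L) ∈ interior (voronoi Λ 0) :=
      interior_maximal hball Metric.isOpen_ball (by simpa using hR)
    have hseg := (convex_voronoi Λ).openSegment_interior_closure_subset_interior h0
      (subset_closure hx)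
    have hx0 : 0 < ‖x‖ := hR.trans hxR'
    obtain ⟨t, ht1, ht2⟩ := exists_between ((div_lt_one hx0).2 hxR')
    have ht0 : 0 < t := (div_pos hR hx0).trans ht1
    have hy : t • x ∈ interior (voronoi Λ 0) := by
      apply hseg
      refine ⟨1 - t, t, by linarith, ht0, by ring, by simp⟩
    have hyR : R < ‖t • x‖ := by
      rw [norm_smul, Real.norm_eq_abs, abs_of_pos ht0]
      exact (div_lt_iff₀ hx0).1 ht1
    have ho : IsOpen (interior (voronoi Λ 0) ∩ {y | R < ‖y‖}) :=
      isOpen_interior.inter (isOpen_lt continuous_const continuous_norm)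
    have hne : volume (interior (voronoi Λ 0) ∩ {y | R < ‖y‖}) ≠ 0 := by
      rw [Ne, ho.measure_eq_zero_iff volume]
      exact Set.Nonempty.ne_empty ⟨_, hy, hyR⟩
    apply hne
    rw [measure_eq_zero_iff_ae_notMem]
    filter_upwards [h] with y hy hy'
    have hyR : R < ‖y‖ := hy'.2
    rw [Set.indicator_of_notMem (by simpa using hyR),
      Set.indicator_of_mem (interior_subset hy'.1)] at hy
    have := pow_lt_pow_left₀ hyR hR.le two_ne_zero
    linarith
  · rw [← closure_ball _ hR.ne']
    exact closure_minimal hball (isClosed_voronoi Λ 0)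

/-- The points `t • x` with `t ↓ 1` lie outside the cell of `0`, in one of finitely many other
cells, so `x` also belongs to the cell of some `l ≠ 0` and `‖x - l‖ ≤ R`. The cell of `0` contains
the ball, so `‖l‖ ≥ 2 * R`. The parallelogram law for `x` and `x - l` then forces `l = 2 • x`. -/
theorem IsLattice.two_smul_mem_of_voronoi_eq (hΛ : IsLattice Λ) {R : ℝ} (hR : 0 < R)
    (h : voronoi Λ 0 = Metric.closedBall 0 R) {x : E L} (hx : ‖x‖ = R) : (2 : ℝ) • x ∈ Λ := by
  -- For `1 < t < 2` a lattice point nearest to `t • x` has norm at most `2 * t * R`.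
  set S : Set (E L) := (Metric.closedBall (0 : E L) (4 * R) ∩ (Λ : Set (E L))) \ {0} with hS
  have hSf : S.Finite := (hΛ.finite_inter_closedBall 0 (4 * R)).subset Set.sdiff_subset
  have hcl : IsClosed (⋃ l ∈ S, voronoi Λ l) :=
    hSf.isClosed_biUnion fun l _ => isClosed_voronoi Λ l
  have hxF : x ∈ ⋃ l ∈ S, voronoi Λ l := by
    have ht : Tendsto (fun t : ℝ => t • x) (𝓝[>] 1) (𝓝 x) := by
      have : Tendsto (fun t : ℝ => t • x) (𝓝 1) (𝓝 ((1 : ℝ) • x)) :=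
        (continuous_id.smul continuous_const).tendsto 1
      rw [one_smul] at this
      exact this.mono_left nhdsWithin_le_nhds
    refine hcl.mem_of_tendsto ht ?_
    filter_upwards [Ioo_mem_nhdsGT (show (1 : ℝ) < 2 by norm_num)] with t ht
    obtain ⟨l, hl, htl⟩ := hΛ.exists_mem_voronoi (t • x)
    have hnt : ‖t • x‖ = t * R := by
      rw [norm_smul, Real.norm_eq_abs, abs_of_pos (by linarith [ht.1]), hx]
    simp only [Set.mem_iUnion]
    refine ⟨l, ⟨⟨?_, hl⟩, ?_⟩, htl⟩
    · have h1 := htl 0 Λ.zero_mem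
      rw [sub_zero, hnt] at h1
      have h2 := norm_sub_norm_le l (t • x)
      rw [norm_sub_rev, hnt] at h2
      rw [Metric.mem_closedBall, dist_zero_right]
      have : t * R ≤ 2 * R := by gcongr; exact ht.2.le
      linarith
    · rintro rfl
      rw [h, Metric.mem_closedBall, dist_zero_right, hnt] at htl
      nlinarith [ht.1]
  simp only [Set.mem_iUnion] at hxF
  obtain ⟨l, ⟨⟨-, hl⟩, hl0⟩, hxl⟩ := hxF
  have hl0' : 0 < ‖l‖ := norm_pos_iff.2 hl0
  have h1 : ‖x - l‖ ≤ R := by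
    have := hxl 0 Λ.zero_mem
    rwa [sub_zero, hx] at this
  have h2 : 2 * R ≤ ‖l‖ := by
    have hy : (R / ‖l‖) • l ∈ voronoi Λ 0 := by
      rw [h, Metric.mem_closedBall, dist_zero_right, norm_smul, Real.norm_eq_abs,
        abs_of_pos (by positivity), div_mul_cancel₀ _ hl0'.ne']
    have := hy l hl
    have e : (R / ‖l‖) • l - l = (R / ‖l‖ - 1) • l := by rw [sub_smul, one_smul]
    rw [sub_zero, e, norm_smul, norm_smul, Real.norm_eq_abs, Real.norm_eq_abs,
      abs_of_pos (by positivity), div_mul_cancel₀ _ hl0'.ne', ← abs_of_pos hl0', ← abs_mul,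
      abs_of_pos hl0', sub_mul, one_mul, div_mul_cancel₀ _ hl0'.ne'] at this
    rcases le_abs.1 this with h' | h' <;> linarith
  have h3 := parallelogram_law_with_norm ℝ x (x - l)
  have e1 : x + (x - l) = (2 : ℝ) • x - l := by rw [two_smul]; abel
  have e2 : x - (x - l) = l := by abel
  rw [e1, e2, hx] at h3
  have h4 : ‖x - l‖ ^ 2 ≤ R ^ 2 := by gcongr
  have h5 : (2 * R) ^ 2 ≤ ‖l‖ ^ 2 := by gcongr
  have h6 : ‖(2 : ℝ) • x - l‖ = 0 := by
    have : ‖(2 : ℝ) • x - l‖ ^ 2 ≤ 0 := by nlinarith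
    exact pow_eq_zero_iff two_ne_zero |>.1 (le_antisymm this (by positivity))
  rw [norm_eq_zero, sub_eq_zero] at h6
  rw [h6]
  exact hl

/-- Among all cells of a given volume the ball has the least second moment, and no Voronoi cell
of a lattice of rank at least two is a ball. -/
theorem IsLattice.sphereG_lt_latticeG (hΛ : IsLattice Λ) (hL : 2 ≤ L) :
    sphereG L < latticeG Λ := by
  obtain ⟨hle, heq⟩ := hΛ.sphereG_le_latticeG (by omega)
  refine lt_of_le_of_ne hle fun hE => ?_
  obtain ⟨R, hR, hae⟩ := heq hE
  have hV := closedBall_subset_voronoi_of_ae hR hae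
  have : Nontrivial (E L) := by
    have : Nonempty (Fin L) := ⟨⟨0, by omega⟩⟩
    infer_instance
  have hrank : 1 < Module.rank ℝ (E L) := by
    rw [← Module.finrank_eq_rank, finrank_euclideanSpace_fin]
    exact_mod_cast hL
  have hinf : (Metric.sphere (0 : E L) R).Infinite := by
    refine (isPreconnected_sphere hrank 0 R).infinite_of_nontrivial ?_
    obtain ⟨x, hx⟩ := NormedSpace.sphere_nonempty (E := E L) (x := 0) |>.2 hR.le
    refine ⟨x, hx, -x, by simpa using hx, fun h => ?_⟩
    have hx0 : x = 0 := by
      have h' : x + x = 0 := by nth_rewrite 2 [h]; abel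
      rw [← two_smul ℝ] at h'
      simpa using h'
    rw [hx0] at hx
    simp at hx
    exact hR.ne hx
  refine (hinf.image (f := fun x => (2 : ℝ) • x) ?_)
    ((hΛ.finite_inter_closedBall 0 (2 * R)).subset ?_)
  · exact (smul_right_injective (E L) (two_ne_zero (α := ℝ))).injOn
  · rintro _ ⟨x, hx, rfl⟩
    have hxR : ‖x‖ = R := by simpa using hx
    refine ⟨?_, hΛ.two_smul_mem_of_voronoi_eq hR hV hxR⟩
    simp [norm_smul, hxR]

end Voronoi

end MDC

end

/-! ### Counting pairs of side points; the marriage argument -/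

noncomputable section

namespace MDC

open scoped ENNReal Pointwise

section Labels

variable {L : ℕ} {Γ Λ A B : Submodule ℤ (E L)}

/-- `H` is an envelope of `F` over the covering radius, which makes the bound uniform in the centre
`x`. -/
theorem IsLattice.tsum_sub_le (hB : IsLattice B) {δ : ℝ} (hδ : CoveringRadiusLE B δ)
    {F H : E L → ℝ≥0∞} (hFH : ∀ u w, ‖u - w‖ ≤ δ → F u ≤ H w) (x : E L) :
    cellVolE B * ∑' y : B, F ((y : E L) - x) ≤ ∫⁻ w, H w := by
  rw [← lintegral_sub_right_eq_self H x]
  refine hB.mul_tsum_le_lintegral fun y z hz => hFH _ _ ?_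
  rw [sub_sub_sub_cancel_right, norm_sub_rev]
  exact hδ.norm_sub_le hz

theorem IsLattice.lintegral_le_tsum_sub (hB : IsLattice B) {δ : ℝ} (hδ : CoveringRadiusLE B δ)
    {F H : E L → ℝ≥0∞} (hFH : ∀ u w, ‖u - w‖ ≤ δ → H w ≤ F u) (x : E L) :
    ∫⁻ w, H w ≤ cellVolE B * ∑' y : B, F ((y : E L) - x) := by
  rw [← lintegral_sub_right_eq_self H x]
  refine hB.lintegral_le_mul_tsum fun y z hz => hFH _ _ ?_
  rw [sub_sub_sub_cancel_right, norm_sub_rev]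
  exact hδ.norm_sub_le hz

/-- A labeling uses every pair of side points at most once, so sums over a period are bounded by
integrals over the difference of the side points. -/
theorem label_tsum_le (hΓ : IsLattice Γ) (hA : IsLattice A) (hB : IsLattice B)
    (hΓΛ : Γ ≤ Λ) (hΓA : Γ ≤ A) {a : Λ → A} {b : Λ → B}
    (ha : ∀ l c, a (shift hΓΛ l c) = shift hΓA l (a c))
    (hb : ∀ (l : Γ) c, (b (shift hΓΛ l c) : E L) = l + b c)
    (hinj : Function.Injective fun c => (a c, b c)) {δ : ℝ} (hδ : CoveringRadiusLE B δ)
    {F H : E L → ℝ≥0∞} (hFH : ∀ u w, ‖u - w‖ ≤ δ → F u ≤ H w) :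
    cellVolE A * cellVolE B *
        ∑' c : Λ, repInd Γ (c : E L) * F ((b c : E L) - (a c : E L))
      ≤ cellVolE Γ * ∫⁻ w, H w := by
  -- Change of transversal: instead of `c`, its first label `a c` is required to be a
  -- representative. The sum then runs over distinct pairs in (representatives of `A`) × `B`, where
  -- injectivity can be used.
  have h1 := tsum_unfold (shift hΓΛ) (G := fun c => F ((b c : E L) - (a c : E L)))
    (w := fun c : Λ => repInd Γ (c : E L)) (w' := fun c : Λ => repInd Γ (a c : E L))
    (K := 1) (K' := 1) (fun l c => by rw [hb, ha, coe_shift, add_sub_add_left_eq_sub])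
    (fun c => by simpa using tsum_repInd_sub Γ (c : E L))
    (fun c => by simp only [ha, coe_shift]; exact tsum_repInd_add Γ _)
  rw [one_mul, one_mul] at h1
  rw [h1]
  calc cellVolE A * cellVolE B *
        ∑' c : Λ, repInd Γ (a c : E L) * F ((b c : E L) - (a c : E L))
      ≤ cellVolE A * cellVolE B *
        ∑' p : A × B, repInd Γ (p.1 : E L) * F ((p.2 : E L) - (p.1 : E L)) := by
        gcongr
        exact ENNReal.tsum_comp_le_tsum_of_injective hinj
          (fun p : A × B => repInd Γ (p.1 : E L) * F ((p.2 : E L) - (p.1 : E L)))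
    _ = cellVolE A * ∑' x : A, repInd Γ (x : E L) *
          (cellVolE B * ∑' y : B, F ((y : E L) - (x : E L))) := by
        rw [mul_assoc, ENNReal.tsum_prod', ← ENNReal.tsum_mul_left]
        congr 1
        refine tsum_congr fun x => ?_
        simp only [ENNReal.tsum_mul_left]
        ring
    _ ≤ cellVolE A * ∑' x : A, repInd Γ (x : E L) * ∫⁻ w, H w := by
        gcongr with x
        exact hB.tsum_sub_le hδ hFH x
    _ = cellVolE Γ * ∫⁻ w, H w := by
        rw [ENNReal.tsum_mul_right, ← mul_assoc, hΓ.cellVolE_mul_tsum_repInd hA hΓA]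

open Classical in
/-- The number of pairs of side points at distance at most `R` whose weighted midpoint is at
distance at most `s` from `c`. -/
theorem le_count_pairs (hA : IsLattice A) (hB : IsLattice B) {δA δB : ℝ}
    (hδA : CoveringRadiusLE A δA) (hδB : CoveringRadiusLE B δB) {θ : ℝ} (hθ0 : 0 ≤ θ)
    (hθ1 : θ ≤ 1) {R s : ℝ} (c : E L) :
    volume (Metric.closedBall (0 : E L) (R - (δA + δB))) *
      volume (Metric.closedBall (0 : E L) (s - (δA + δB)))
      ≤ cellVolE A * (cellVolE B * ∑' x : A, ∑' y : B,
        if ‖(y : E L) - x‖ ≤ R ∧ ‖(x : E L) + θ • ((y : E L) - x) - c‖ ≤ s then 1 else 0) := by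
  set δ := δA + δB with hδ
  have hA0 := hδA.nonneg
  have hB0 := hδB.nonneg
  let H : E L → E L → ℝ≥0∞ := fun x v =>
    if ‖v‖ ≤ R - δ ∧ ‖x + θ • v - c‖ ≤ s - δ then 1 else 0
  have hHm : Measurable (Function.uncurry H) := by
    have h1 : MeasurableSet {p : E L × E L | ‖p.2‖ ≤ R - δ} :=
      measurableSet_le (by fun_prop) measurable_const
    have h2 : MeasurableSet {p : E L × E L | ‖p.1 + θ • p.2 - c‖ ≤ s - δ} :=
      measurableSet_le (by fun_prop) measurable_const
    exact Measurable.ite (h1.inter h2) measurable_const measurable_const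
  have hball : ∀ t : ℝ, ∀ z : E L, ∫⁻ x : E L, (if ‖x + z‖ ≤ t then 1 else 0)
      = volume (Metric.closedBall (0 : E L) t) := by
    intro t z
    rw [lintegral_add_right_eq_self (fun x : E L => if ‖x‖ ≤ t then (1 : ℝ≥0∞) else 0) z,
      ← lintegral_indicator_one measurableSet_closedBall]
    refine lintegral_congr fun x => ?_
    simp [Set.indicator]
  calc volume (Metric.closedBall (0 : E L) (R - δ)) * volume (Metric.closedBall (0 : E L) (s - δ))
      = ∫⁻ v : E L, ∫⁻ x : E L, H x v := by
        rw [← hball (R - δ) 0, ← lintegral_mul_const]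
        · refine lintegral_congr fun v => ?_
          by_cases hv : ‖v‖ ≤ R - δ
          · simp only [add_zero, hv, if_true, one_mul, H, true_and]
            rw [← hball (s - δ) (θ • v - c)]
            simp only [add_sub_assoc]
          · simp [H, hv]
        · refine Measurable.ite ?_ measurable_const measurable_const
          exact measurableSet_le (by fun_prop) measurable_const
    _ = ∫⁻ x : E L, ∫⁻ v : E L, H x v := by
        rw [lintegral_lintegral_swap]
        exact (hHm.comp measurable_swap).aemeasurable
    _ ≤ cellVolE A * ∑' x : A, (cellVolE B * ∑' y : B,
        if ‖(y : E L) - x‖ ≤ R ∧ ‖(x : E L) + θ • ((y : E L) - x) - c‖ ≤ s then 1 else 0) := by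
        refine hA.lintegral_le_mul_tsum fun x x' hx => ?_
        have hxx := hδA.norm_sub_le hx
        -- The integration variable `x'` stands for the lattice point `x` of its cell. The sum over
        -- `B` is centred at `x'`, so the true difference is `u + (x' - x)`, and `δA` is lost in
        -- addition to `δB`.
        refine (hB.lintegral_le_tsum_sub hδB (F := fun u => if ‖u + (x' - x)‖ ≤ R ∧
          ‖(x : E L) + θ • (u + (x' - x)) - c‖ ≤ s then 1 else 0) ?_ x').trans (le_of_eq ?_)
        · intro u w huw
          by_cases hw : ‖w‖ ≤ R - δ ∧ ‖x' + θ • w - c‖ ≤ s - δ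
          · have h1 : ‖u + (x' - x)‖ ≤ R := by
              have e : u + (x' - x) = w + (u - w) + (x' - x) := by abel
              rw [e]
              have := norm_add₃_le (a := w) (b := u - w) (c := x' - x)
              linarith [hw.1]
            have h2 : ‖(x : E L) + θ • (u + (x' - x)) - c‖ ≤ s := by
              -- The weighted midpoint moves by at most `θ * δB + (1 - θ) * δA`.
              have e : (x : E L) + θ • (u + (x' - x)) - c
                  = (x' + θ • w - c) + θ • (u - w) + (-(1 - θ)) • (x' - x) := by
                module
              rw [e]
              have := norm_add₃_le (a := x' + θ • w - c) (b := θ • (u - w))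
                (c := (-(1 - θ)) • (x' - x))
              rw [norm_smul, norm_smul, Real.norm_eq_abs, Real.norm_eq_abs, abs_neg,
                abs_of_nonneg hθ0, abs_of_nonneg (by linarith : 0 ≤ 1 - θ)] at this
              have h3 : θ * ‖u - w‖ ≤ δB := by nlinarith [norm_nonneg (u - w)]
              have h4 : (1 - θ) * ‖x' - x‖ ≤ δA := by nlinarith [norm_nonneg (x' - x)]
              linarith [hw.2]
            simp only [H, hw, h1, h2, and_self, if_true, le_refl]
          · simp [H, hw]
        · congr 1
          refine tsum_congr fun y => ?_
          simp only [sub_add_sub_cancel]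
    _ = _ := by rw [ENNReal.tsum_mul_left]

-- Bounds the degree of a pair in the bipartite graph of `exists_label`: the cells of the points
-- counted are essentially disjoint and stay within `s + δ` of `p`.
open Classical in
theorem count_near_le (hΛ : IsLattice Λ) {δ : ℝ} (hδ : CoveringRadiusLE Λ δ) {s : ℝ} (p : E L) :
    cellVolE Λ * ∑' c : Λ, (if ‖p - c‖ ≤ s then 1 else 0)
      ≤ volume (Metric.closedBall (0 : E L) (s + δ)) := by
  have := hΛ.tsum_sub_le hδ (F := fun u => if ‖u‖ ≤ s then 1 else 0)
    (H := (Metric.closedBall (0 : E L) (s + δ)).indicator 1) (fun u w huw => ?_) p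
  · rw [lintegral_indicator_one measurableSet_closedBall] at this
    simpa [norm_sub_rev] using this
  · split_ifs with h
    · rw [Set.indicator_of_mem]
      · simp
      · rw [mem_closedBall_zero_iff]
        have := norm_sub_norm_le w u
        rw [norm_sub_rev] at this
        linarith
    · simp

theorem finite_pairs_near (hA : IsLattice A) (hB : IsLattice B) {θ : ℝ} (hθ0 : 0 ≤ θ)
    (hθ1 : θ ≤ 1) (R s : ℝ) (c : E L) :
    {p : A × B | ‖(p.2 : E L) - p.1‖ ≤ R ∧
      ‖(p.1 : E L) + θ • ((p.2 : E L) - p.1) - c‖ ≤ s}.Finite := by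
  have hfA : {x : A | (x : E L) ∈ Metric.closedBall c (R + s)}.Finite :=
    Set.Finite.preimage Subtype.val_injective.injOn
      ((hA.finite_inter_closedBall c (R + s)).subset
        (fun x hx => hx) : (Metric.closedBall c (R + s) ∩ (A : Set (E L))).Finite) |>.subset
      (fun x hx => ⟨hx, x.2⟩)
  have hfB : {x : B | (x : E L) ∈ Metric.closedBall c (R + s + R)}.Finite :=
    Set.Finite.preimage Subtype.val_injective.injOn
      (hB.finite_inter_closedBall c (R + s + R)) |>.subset (fun x hx => ⟨hx, x.2⟩)
  refine (hfA.prod hfB).subset ?_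
  rintro ⟨x, y⟩ ⟨h1, h2⟩
  simp only at h1 h2
  have h3 : ‖(x : E L) - c‖ ≤ R + s := by
    have e : (x : E L) - c = ((x : E L) + θ • ((y : E L) - x) - c) - θ • ((y : E L) - x) := by abel
    rw [e]
    refine (norm_sub_le _ _).trans ?_
    rw [norm_smul, Real.norm_eq_abs, abs_of_nonneg hθ0]
    nlinarith [norm_nonneg ((y : E L) - x)]
  refine ⟨by simpa [dist_eq_norm] using h3, ?_⟩
  simp only [Set.mem_ofPred_eq, Metric.mem_closedBall, dist_eq_norm]
  have e : (y : E L) - c = ((x : E L) - c) + ((y : E L) - x) := by abel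
  rw [e]
  exact (norm_add_le _ _).trans (by linarith)

/-- The representative modulo `Γ`, within a lattice that contains `Γ`. -/
def reprIn (h : Γ ≤ Λ) (c : Λ) : Λ :=
  ⟨repr Γ c, by
    have := Λ.add_mem (h (repr_sub_mem Γ (c : E L))) c.2
    rwa [sub_add_cancel] at this⟩

@[simp] theorem coe_reprIn (h : Γ ≤ Λ) (c : Λ) : (reprIn h c : E L) = repr Γ c := rfl

theorem reprIn_eq_of_sub_mem (h : Γ ≤ Λ) {c c' : Λ} (hc : (c : E L) - c' ∈ Γ) :
    reprIn h c = reprIn h c' := Subtype.ext (repr_eq_repr hc)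

/-- The translation of a pair to the pair whose first component is a representative. -/
def normPair (hA : Γ ≤ A) (hB : Γ ≤ B) (p : A × B) : A × B :=
  (shift hA ⟨_, repr_sub_mem Γ (p.1 : E L)⟩ p.1, shift hB ⟨_, repr_sub_mem Γ (p.1 : E L)⟩ p.2)

theorem normPair_shift (hA : Γ ≤ A) (hB : Γ ≤ B) (l : Γ) (p : A × B) :
    normPair hA hB (shift hA l p.1, shift hB l p.2) = normPair hA hB p := by
  have h : repr Γ ((l : E L) + p.1) = repr Γ (p.1 : E L) := repr_eq_repr (by simp)
  ext1 <;> ext1 <;> simp only [normPair, coe_shift, h] <;> abel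

open Classical in
/-- A labeling all of whose pairs are short and have their weighted midpoints close to the labeled
point exists as soon as there is enough room, by the marriage theorem. -/
theorem exists_label (hΛ : IsLattice Λ) (hA : IsLattice A) (hB : IsLattice B)
    (hΓΛ : Γ ≤ Λ) (hΓA : Γ ≤ A) (hΓB : Γ ≤ B) {δΛ δA δB : ℝ}
    (hδΛ : CoveringRadiusLE Λ δΛ) (hδA : CoveringRadiusLE A δA) (hδB : CoveringRadiusLE B δB)
    {θ : ℝ} (hθ0 : 0 ≤ θ) (hθ1 : θ ≤ 1) {R s : ℝ} (hs : 0 < s)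
    (hroom : volume (Metric.closedBall (0 : E L) (s + δΛ)) * (cellVolE A * cellVolE B) ≤
      volume (Metric.closedBall (0 : E L) (R - (δA + δB))) *
      volume (Metric.closedBall (0 : E L) (s - (δA + δB))) * cellVolE Λ) :
    ∃ (a : Λ → A) (b : Λ → B),
      (∀ l c, a (shift hΓΛ l c) = shift hΓA l (a c)) ∧
      (∀ l c, b (shift hΓΛ l c) = shift hΓB l (b c)) ∧
      (Function.Injective fun c => (a c, b c)) ∧
      ∀ c, ‖(b c : E L) - a c‖ ≤ R ∧
        ‖(a c : E L) + θ • ((b c : E L) - a c) - c‖ ≤ s := by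
  let near : Λ → A × B → Prop := fun c p => ‖(p.2 : E L) - p.1‖ ≤ R ∧
    ‖(p.1 : E L) + θ • ((p.2 : E L) - p.1) - c‖ ≤ s
  have hnear : ∀ (l : Γ) c p, near (shift hΓΛ l c) (shift hΓA l p.1, shift hΓB l p.2) ↔
      near c p := by
    intro l c p
    simp only [near, coe_shift, add_sub_add_left_eq_sub]
    rw [add_assoc, add_sub_add_left_eq_sub]
  let ι := {c : Λ // repr Γ (c : E L) = c}
  let N : Λ → Finset (A × B) := fun c => (finite_pairs_near hA hB hθ0 hθ1 R s (c : E L)).toFinset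
  have hN : ∀ c p, p ∈ N c ↔ near c p := fun c p => by simp [N, near]
  -- The graph lives on orbits of `Γ`: central orbits are given by representatives, orbits of pairs
  -- by the pair whose first point is a representative.
  let t : ι → Finset (A × B) := fun c => (N c.1).image (normPair hΓA hΓB)
  -- An upper bound for all degrees of pairs (`hright`) and, by `hroom`, a lower bound for all
  -- degrees of central points (`hleft`).
  set dR : ℝ≥0∞ := volume (Metric.closedBall (0 : E L) (s + δΛ)) / cellVolE Λ with hdR
  have hν0 := hΛ.cellVolE_ne_zero
  have hνt := hΛ.cellVolE_ne_top
  have hdR0 : dR ≠ 0 := by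
    refine (ENNReal.div_pos ?_ hνt).ne'
    exact (Metric.measure_closedBall_pos _ _ (by have := hδΛ.nonneg; linarith)).ne'
  have hdRt : dR ≠ ∞ := ENNReal.div_ne_top measure_closedBall_lt_top.ne hν0
  have hright : ∀ p : E L, ∑' c : Λ, (if ‖p - c‖ ≤ s then (1 : ℝ≥0∞) else 0) ≤ dR := fun p => by
    rw [hdR, ENNReal.le_div_iff_mul_le (Or.inl hν0) (Or.inl hνt), mul_comm]
    exact count_near_le hΛ hδΛ p
  have hleft : ∀ c : Λ, dR ≤ ∑' p : A × B, if near c p then (1 : ℝ≥0∞) else 0 := fun c => by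
    have h1 := le_count_pairs hA hB hδA hδB hθ0 hθ1 (R := R) (s := s) (c : E L)
    rw [← mul_assoc, ← ENNReal.tsum_prod (f := fun (x : A) (y : B) =>
      if ‖(y : E L) - x‖ ≤ R ∧ ‖(x : E L) + θ • ((y : E L) - x) - c‖ ≤ s
        then (1 : ℝ≥0∞) else 0)] at h1
    have h2 := hroom.trans (mul_le_mul_left h1 _)
    rw [mul_comm (volume _) (cellVolE A * cellVolE B), mul_assoc (cellVolE A * cellVolE B) _
      (cellVolE Λ)] at h2
    have h3 := (ENNReal.mul_le_mul_iff_right (mul_ne_zero hA.cellVolE_ne_zero hB.cellVolE_ne_zero)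
      (ENNReal.mul_ne_top hA.cellVolE_ne_top hB.cellVolE_ne_top)).1 h2
    rw [hdR]
    exact ENNReal.div_le_of_le_mul h3
  -- Hall's condition, by counting incidences modulo `Γ` in two ways. With the central point as
  -- representative, each member of `S` contributes at least `dR`; with the first side point as
  -- representative, each neighbour contributes at most `dR`.
  have hall : ∀ S : Finset ι, S.card ≤ (S.biUnion t).card := by
    intro S
    let σ : Γ → Equiv.Perm (Λ × (A × B)) := fun l =>
      Equiv.prodCongr (shift hΓΛ l) (Equiv.prodCongr (shift hΓA l) (shift hΓB l))
    let G : Λ × (A × B) → ℝ≥0∞ := fun q =>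
      if near q.1 q.2 ∧ ∃ c ∈ S, reprIn hΓΛ q.1 = c.1 then 1 else 0
    have hσ1 : ∀ l q, (σ l q).1 = shift hΓΛ l q.1 := fun _ _ => rfl
    have hσ2 : ∀ l q, (σ l q).2 = (shift hΓA l q.2.1, shift hΓB l q.2.2) := fun _ _ => rfl
    have hσ3 : ∀ l q, ((σ l).symm q).1 = (shift hΓΛ l).symm q.1 := fun _ _ => rfl
    have h1 := tsum_unfold σ (G := G) (w := fun q => repInd Γ (q.1 : E L))
      (w' := fun q => repInd Γ (q.2.1 : E L)) (K := 1) (K' := 1)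
      (fun l q => by
        have hr : reprIn hΓΛ (shift hΓΛ l q.1) = reprIn hΓΛ q.1 :=
          reprIn_eq_of_sub_mem _ (by simp)
        simp only [G, hσ1, hσ2, hnear, hr])
      (fun q => by simp only [hσ3, coe_shift_symm]; exact tsum_repInd_sub Γ _)
      (fun q => by simp only [hσ2, coe_shift]; exact tsum_repInd_add Γ _)
    rw [one_mul, one_mul] at h1
    have hlow : (S.card : ℝ≥0∞) * dR ≤ ∑' q, repInd Γ (q.1 : E L) * G q := by
      rw [ENNReal.tsum_prod', ← nsmul_eq_mul, ← Finset.sum_const]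
      calc ∑ c ∈ S, dR ≤ ∑ c ∈ S, ∑' p, repInd Γ ((c.1 : Λ) : E L) * G (c.1, p) := by
            refine Finset.sum_le_sum fun c hc => (hleft c.1).trans ?_
            refine ENNReal.tsum_le_tsum fun p => ?_
            have h2 : repInd Γ ((c.1 : Λ) : E L) = 1 := by rw [repInd, if_pos c.2]
            have h3 : reprIn hΓΛ c.1 = c.1 := Subtype.ext c.2
            rw [h2, one_mul]
            by_cases hn : near c.1 p
            · have : G (c.1, p) = 1 := if_pos ⟨hn, c, hc, h3⟩
              rw [this, if_pos hn]
            · simp [hn]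
        _ = ∑ c ∈ S.map (Function.Embedding.subtype _),
              ∑' p, repInd Γ ((c : Λ) : E L) * G (c, p) := by rw [Finset.sum_map]; rfl
        _ ≤ _ := ENNReal.sum_le_tsum _
    have hupp : ∑' q, repInd Γ (q.2.1 : E L) * G q ≤ ((S.biUnion t).card : ℝ≥0∞) * dR := by
      rw [ENNReal.tsum_prod', ENNReal.tsum_comm]
      calc ∑' p : A × B, ∑' c : Λ, repInd Γ (p.1 : E L) * G (c, p)
          ≤ ∑' p : A × B, if p ∈ S.biUnion t then dR else 0 := by
            refine ENNReal.tsum_le_tsum fun p => ?_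
            by_cases hp : repr Γ (p.1 : E L) = p.1 ∧
                ∃ c, near c p ∧ ∃ c' ∈ S, reprIn hΓΛ c = c'.1
            · obtain ⟨hp1, c, hc, c', hc', hcc'⟩ := hp
              have hmem : p ∈ S.biUnion t := by
                refine Finset.mem_biUnion.2 ⟨c', hc', Finset.mem_image.2 ?_⟩
                let l : Γ := ⟨_, repr_sub_mem Γ (c : E L)⟩
                refine ⟨(shift hΓA l p.1, shift hΓB l p.2), ?_, ?_⟩
                · rw [hN, ← hcc']
                  have : reprIn hΓΛ c = shift hΓΛ l c := by ext1; simp [l]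
                  rw [this, hnear]
                  exact hc
                · rw [normPair_shift]
                  ext1 <;> ext1 <;> simp [normPair, hp1]
              rw [if_pos hmem]
              refine le_trans (ENNReal.tsum_le_tsum fun c => ?_)
                (hright ((p.1 : E L) + θ • ((p.2 : E L) - p.1)))
              have h5 : repInd Γ (p.1 : E L) ≤ 1 := by rw [repInd]; split_ifs <;> simp
              refine (mul_le_mul_left h5 _).trans ?_
              rw [one_mul]
              by_cases hn : near c p
              · rw [if_pos hn.2]
                simp only [G]; split_ifs <;> simp
              · have : G (c, p) = 0 := if_neg fun h => hn h.1
                rw [this]; exact zero_le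
            · have : ∀ c, repInd Γ (p.1 : E L) * G (c, p) = 0 := by
                intro c
                by_contra h
                rw [mul_eq_zero, not_or] at h
                apply hp
                constructor
                · by_contra h'
                  exact h.1 (if_neg h')
                · by_contra h'
                  exact h.2 (if_neg fun h'' => h' ⟨c, h''⟩)
              simp [this]
        _ = ((S.biUnion t).card : ℝ≥0∞) * dR := by
            refine (tsum_eq_sum (s := S.biUnion t) (fun p hp => if_neg hp)).trans ?_
            rw [← nsmul_eq_mul, ← Finset.sum_const]
            exact Finset.sum_congr rfl fun p hp => if_pos hp
    have h2 := (hlow.trans (h1.le)).trans hupp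
    have h3 := (ENNReal.mul_le_mul_iff_left hdR0 hdRt).1 h2
    exact_mod_cast h3
  obtain ⟨f, hfinj, hft⟩ := (Finset.all_card_le_biUnion_card_iff_exists_injective t).1 hall
  have hg : ∀ c : ι, ∃ p, near c.1 p ∧ normPair hΓA hΓB p = f c := fun c => by
    obtain ⟨p, hp, hpf⟩ := Finset.mem_image.1 (hft c)
    exact ⟨p, (hN _ _).1 hp, hpf⟩
  choose g hgn hgf using hg
  -- The matching of orbits is extended to all of `Λ` equivariantly: `c` is the translate by `lc c`
  -- of its representative `rc c`.
  let rc : Λ → ι := fun c => ⟨reprIn hΓΛ c, repr_repr Γ _⟩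
  let lc : Λ → Γ := fun c => ⟨_, sub_repr_mem Γ (c : E L)⟩
  have hrc : ∀ (l : Γ) (c : Λ), rc (shift hΓΛ l c) = rc c := by
    intro l c
    apply Subtype.ext
    exact reprIn_eq_of_sub_mem hΓΛ (by simp)
  have hlc : ∀ (l : Γ) (c : Λ), (lc (shift hΓΛ l c) : E L) = l + lc c := fun l c => by
    have h : repr Γ ((l : E L) + c) = repr Γ (c : E L) := repr_eq_repr (by simp)
    simp only [lc, coe_shift, h]
    abel
  have hcl : ∀ c, shift hΓΛ (lc c) (rc c).1 = c := fun c => by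
    ext1; simp [lc, rc]
  refine ⟨fun c => shift hΓA (lc c) (g (rc c)).1, fun c => shift hΓB (lc c) (g (rc c)).2,
    ?_, ?_, ?_, ?_⟩
  · intro l c
    ext1
    simp only [coe_shift, hlc, hrc, add_assoc]
  · intro l c
    ext1
    simp only [coe_shift, hlc, hrc, add_assoc]
  · intro c c' h
    -- Normal forms determine the orbit because the matching is injective; the first component then
    -- determines the translation.
    have h1 := congrArg (normPair hΓA hΓB) h
    simp only [normPair_shift, hgf] at h1
    have h2 : rc c = rc c' := hfinj h1
    have h3 := congrArg (fun p : A × B => (p.1 : E L)) h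
    simp only [coe_shift, h2, add_left_inj] at h3
    rw [← hcl c, ← hcl c', h2]
    congr 2
    exact Subtype.ext h3
  · intro c
    have := (hnear (lc c) (rc c).1 (g (rc c))).2 (hgn (rc c))
    rw [hcl] at this
    exact this

end Labels

end MDC

end

/-! ### Labelings of a scheme and the cost identity -/

noncomputable section

namespace MDC

open scoped ENNReal Pointwise

theorem linScale_pos (L : ℕ) {m : ℝ} (hm : 0 < m) : 0 < linScale L m := Real.rpow_pos_of_pos hm _

theorem linScale_pow {L : ℕ} (hL : 1 ≤ L) {m : ℝ} (hm : 0 < m) : linScale L m ^ L = m := by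
  have : (L : ℝ) ≠ 0 := by positivity
  rw [linScale, ← Real.rpow_natCast, ← Real.rpow_mul hm.le, one_div_mul_cancel this, Real.rpow_one]

namespace LatticeSystem

variable {L : ℕ} {μ : Fin 2 → ℝ} (S : LatticeSystem L μ)

/-- The weighted side lattices. -/
def wside (i : Fin 2) : Submodule ℤ (E L) := scaled (linScale L (μ i)) (S.side i)

variable {S}

theorem isLattice_wside (hμ : ∀ i, 0 < μ i) (i : Fin 2) : IsLattice (S.wside i) :=
  (S.isLattice_side i).scaled (linScale_pos L (hμ i)).ne'

theorem cellVol_wside (hμ : ∀ i, 0 < μ i) (hL : 1 ≤ L) (i : Fin 2) :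
    cellVol (S.wside i) = μ i * cellVol (S.side i) := by
  rw [wside, (S.isLattice_side i).cellVol_scaled (linScale_pos L (hμ i)), linScale_pow hL (hμ i)]

theorem prod_le_wside (hμ : ∀ i, 0 < μ i) (i : Fin 2) : S.prod ≤ S.wside i := by
  intro x hx
  obtain ⟨y, hy, rfl⟩ := S.prod_le_side i x hx
  exact (smul_mem_scaled (linScale_pos L (hμ i)).ne').2 hy

theorem recon_mem (hμ : ∀ i, 0 < μ i) (α : S.Label) (i : Fin 2) (c : S.central) : S.recon α i c ∈ S.wside i :=
  (smul_mem_scaled (linScale_pos L (hμ i)).ne').2 (α c i).2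

/-- The reconstructions, as points of the weighted side lattices. -/
def wlabel (hμ : ∀ i, 0 < μ i) (α : S.Label) (i : Fin 2) (c : S.central) : S.wside i :=
  ⟨S.recon α i c, recon_mem hμ α i c⟩

@[simp] theorem coe_wlabel (hμ : ∀ i, 0 < μ i) (α : S.Label) (i : Fin 2) (c : S.central) :
    (wlabel hμ α i c : E L) = S.recon α i c := rfl

theorem wlabel_injective (hμ : ∀ i, 0 < μ i) {α : S.Label} (hα : S.IsLabeling α) :
    Function.Injective fun c => (wlabel hμ α 0 c, wlabel hμ α 1 c) := by
  intro c c' h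
  apply hα.injective
  have key : ∀ i, S.recon α i c = S.recon α i c' → α c i = α c' i := fun i h =>
    Subtype.ext (smul_right_injective (E L) (linScale_pos L (hμ i)).ne' h)
  have h0 := congrArg (fun p => (p.1 : E L)) h
  have h1 := congrArg (fun p => (p.2 : E L)) h
  funext i
  fin_cases i
  · exact key 0 h0
  · exact key 1 h1

theorem recon_shift {α : S.Label} (hα : S.IsLabeling α) (i : Fin 2) (l : S.prod)
    (c : S.central) : S.recon α i (shift S.prod_le_central l c) = l + S.recon α i c := by
  rw [hα.shift c _ (by simp) i, coe_shift]
  abel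

theorem wlabel_shift (hμ : ∀ i, 0 < μ i) {α : S.Label} (hα : S.IsLabeling α) (i : Fin 2) (l : S.prod)
    (c : S.central) :
    wlabel hμ α i (shift S.prod_le_central l c) = shift (prod_le_wside hμ i) l (wlabel hμ α i c) :=
  Subtype.ext (recon_shift hα i l c)

/-- Labelings with prescribed reconstructions. -/
theorem exists_isLabeling (hμ : ∀ i, 0 < μ i) (a : S.central → S.wside 0) (b : S.central → S.wside 1)
    (ha : ∀ l c, a (shift S.prod_le_central l c) = shift (prod_le_wside hμ 0) l (a c))
    (hb : ∀ l c, b (shift S.prod_le_central l c) = shift (prod_le_wside hμ 1) l (b c))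
    (hinj : Function.Injective fun c => (a c, b c)) :
    ∃ β : S.Label, S.IsLabeling β ∧ ∀ c, S.recon β 0 c = a c ∧ S.recon β 1 c = b c := by
  let β : S.Label := fun c => Fin.cons ⟨(linScale L (μ 0))⁻¹ • (a c : E L), mem_scaled.1 (a c).2⟩
    (Fin.cons (α := fun i : Fin 1 => S.side i.succ)
      ⟨(linScale L (μ 1))⁻¹ • (b c : E L), mem_scaled.1 (b c).2⟩ finZeroElim)
  have h0 : ∀ c, S.recon β 0 c = a c := fun c =>
    smul_inv_smul₀ (linScale_pos L (hμ 0)).ne' (a c : E L)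
  have h1 : ∀ c, S.recon β 1 c = b c := fun c =>
    smul_inv_smul₀ (linScale_pos L (hμ 1)).ne' (b c : E L)
  refine ⟨β, ⟨fun c c' h => hinj ?_, fun c c' hcc i => ?_⟩, fun c => ⟨h0 c, h1 c⟩⟩
  · have e0 : (a c : E L) = a c' := by rw [← h0, ← h0, recon, recon, h]
    have e1 : (b c : E L) = b c' := by rw [← h1, ← h1, recon, recon, h]
    exact Prod.ext (Subtype.ext e0) (Subtype.ext e1)
  · have hc' : c' = shift S.prod_le_central ⟨_, hcc⟩ c := by ext1; simp
    fin_cases i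
    · show S.recon β 0 c' = S.recon β 0 c + _
      rw [h0, h0]
      nth_rewrite 1 [hc']
      rw [ha, coe_shift, add_comm]
    · show S.recon β 1 c' = S.recon β 1 c + _
      rw [h1, h1]
      nth_rewrite 1 [hc']
      rw [hb, coe_shift, add_comm]

/-- The displacement is periodic under the product lattice, so it takes finitely many values. The
bound depends on the scheme and serves only for integrability. -/
theorem exists_norm_sub_recon_le {α : S.Label} (hα : S.IsLabeling α) (i : Fin 2) :
    ∃ B : ℝ, ∀ c : S.central, ‖(c : E L) - S.recon α i c‖ ≤ B := by
  obtain ⟨ρ, hρ⟩ := S.isLattice_prod.exists_coveringRadiusLE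
  have hf : {c : S.central | (c : E L) ∈ Metric.closedBall 0 ρ}.Finite :=
    (Set.Finite.preimage Subtype.val_injective.injOn
      (S.isLattice_central.finite_inter_closedBall 0 ρ)).subset fun x hx => ⟨hx, x.2⟩
  obtain ⟨B, hB⟩ := (hf.image fun c : S.central => ‖(c : E L) - S.recon α i c‖).bddAbove
  refine ⟨B, fun c => ?_⟩
  obtain ⟨l, hl, hcl⟩ := hρ c
  set c' := (shift S.prod_le_central ⟨l, hl⟩).symm c with hc'
  have e : c = shift S.prod_le_central ⟨l, hl⟩ c' := by simp [hc']
  have h1 : (c : E L) - S.recon α i c = c' - S.recon α i c' := by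
    rw [e, recon_shift hα, coe_shift, add_sub_add_left_eq_sub]
  rw [h1]
  refine hB ⟨c', ?_, rfl⟩
  rw [Set.mem_ofPred_eq, mem_closedBall_zero_iff, hc', coe_shift_symm, neg_add_eq_sub]
  exact hcl

/-- The difference of the two side reconstructions. -/
def diff (α : S.Label) (c : S.central) : E L := S.recon α 1 c - S.recon α 0 c

/-- The point that divides the two side reconstructions in the ratio given by the weights. -/
def mid (θ : ℝ) (α : S.Label) (c : S.central) : E L := S.recon α 0 c + θ • S.diff α c

theorem exists_norm_diff_le {α : S.Label} (hα : S.IsLabeling α) :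
    ∃ B : ℝ, ∀ c : S.central, ‖S.diff α c‖ ≤ B := by
  obtain ⟨B0, h0⟩ := exists_norm_sub_recon_le hα 0
  obtain ⟨B1, h1⟩ := exists_norm_sub_recon_le hα 1
  refine ⟨B0 + B1, fun c => ?_⟩
  have e : S.diff α c = (c - S.recon α 0 c) - (c - S.recon α 1 c) := by rw [diff]; abel
  rw [e]
  exact (norm_sub_le _ _).trans (add_le_add (h0 c) (h1 c))

theorem exists_norm_sub_mid_le {α : S.Label} (hα : S.IsLabeling α) (θ : ℝ) :
    ∃ B : ℝ, ∀ c : S.central, ‖(c : E L) - S.mid θ α c‖ ≤ B := by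
  obtain ⟨B0, h0⟩ := exists_norm_sub_recon_le hα 0
  obtain ⟨B1, h1⟩ := exists_norm_diff_le hα
  refine ⟨B0 + |θ| * B1, fun c => ?_⟩
  have e : (c : E L) - S.mid θ α c = (c - S.recon α 0 c) - θ • S.diff α c := by rw [mid]; abel
  rw [e]
  refine (norm_sub_le _ _).trans (add_le_add (h0 c) ?_)
  rw [norm_smul, Real.norm_eq_abs]
  gcongr
  exact h1 c

theorem diff_shift {α : S.Label} (hα : S.IsLabeling α) {l l' : S.central}
    (h : (l' : E L) - (l : E L) ∈ S.prod) : S.diff α l' = S.diff α l := by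
  rw [diff, diff, hα.shift l l' h, hα.shift l l' h]
  abel

/-- The weight `γ 1 / (γ 0 + γ 1)` makes `mid` the barycentre of the reconstructions with masses `γ
0` and `γ 1`, so the inner products of offset and difference cancel. -/
theorem sum_cost_eq {γ : Fin 2 → ℝ} (hγ : ∀ i, 0 < γ i) (α : S.Label) (c : S.central) :
    ∑ i, γ i * sqErr (c : E L) (S.recon α i c)
      = ((γ 0 + γ 1) * ‖(c : E L) - S.mid (γ 1 / (γ 0 + γ 1)) α c‖ ^ 2
        + γ 0 * γ 1 / (γ 0 + γ 1) * ‖S.diff α c‖ ^ 2) / L := by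
  have h0 := hγ 0
  have h1 := hγ 1
  have hs : γ 0 + γ 1 ≠ 0 := by positivity
  set θ := γ 1 / (γ 0 + γ 1) with hθ
  obtain ⟨w, hw⟩ : ∃ w, w = (c : E L) - S.mid θ α c := ⟨_, rfl⟩
  obtain ⟨d, hd⟩ : ∃ d, d = S.diff α c := ⟨_, rfl⟩
  have e0 : (c : E L) - S.recon α 0 c = w + θ • d := by rw [hw, mid, hd]; abel
  have e1 : (c : E L) - S.recon α 1 c = w - (1 - θ) • d := by
    have : S.recon α 1 c = S.recon α 0 c + d := by rw [hd, diff]; abel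
    rw [this, hw, mid, ← hd]
    module
  rw [Fin.sum_univ_two, sqErr, sqErr, e0, e1, ← hw, ← hd, norm_add_sq_real, norm_sub_sq_real,
    inner_smul_right, inner_smul_right, norm_smul, norm_smul, mul_pow, mul_pow, Real.norm_eq_abs,
    Real.norm_eq_abs, sq_abs, sq_abs, hθ]
  field_simp
  ring

variable {Ω : Type*} [MeasurableSpace Ω] {P : Measure Ω} {X : Ω → E L} {Q : E L → S.central}

theorem IsQuantizer.measurable_comp (hQ : S.IsQuantizer Q) (hX : Measurable X) {β : Type*}
    [MeasurableSpace β] (G : S.central → β) : Measurable fun ω => G (Q (X ω)) :=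
  (measurable_of_nearest_comp S.isLattice_central hQ.measurable G).comp hX

theorem IsQuantizer.integrable_comp [IsFiniteMeasure P] (hQ : S.IsQuantizer Q)
    (hX : Measurable X) {G : S.central → ℝ} {B : ℝ} (hB : ∀ c, |G c| ≤ B) :
    Integrable (fun ω => G (Q (X ω))) P :=
  Integrable.of_bound (hQ.measurable_comp hX G).aestronglyMeasurable B
    (ae_of_all _ fun _ => hB _)

theorem integrable_norm_sq_comp [IsFiniteMeasure P] (hQ : S.IsQuantizer Q)
    (hX : Measurable X) {G : S.central → E L} (hG : ∃ B : ℝ, ∀ c, ‖G c‖ ≤ B) :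
    Integrable (fun ω => ‖G (Q (X ω))‖ ^ 2) P := by
  obtain ⟨B, hB⟩ := hG
  refine hQ.integrable_comp hX (G := fun c => ‖G c‖ ^ 2) (B := B ^ 2) fun c => ?_
  rw [abs_of_nonneg (by positivity)]
  exact pow_le_pow_left₀ (norm_nonneg _) (hB c) 2

theorem cost_mul_eq [IsFiniteMeasure P] (hL : 1 ≤ L) (hQ : S.IsQuantizer Q) (hX : Measurable X)
    {γ : Fin 2 → ℝ} (hγ : ∀ i, 0 < γ i) {α : S.Label} (hα : S.IsLabeling α) :
    S.cost P X Q γ α * L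
      = (γ 0 + γ 1) * ∫ ω, ‖(Q (X ω) : E L) - S.mid (γ 1 / (γ 0 + γ 1)) α (Q (X ω))‖ ^ 2 ∂P
        + γ 0 * γ 1 / (γ 0 + γ 1) * ∫ ω, ‖S.diff α (Q (X ω))‖ ^ 2 ∂P := by
  have hL0 : (L : ℝ) ≠ 0 := by positivity
  simp_rw [cost, sum_cost_eq hγ α]
  rw [integral_div, div_mul_cancel₀ _ hL0, integral_add, integral_const_mul, integral_const_mul]
  · exact (integrable_norm_sq_comp hQ hX
      (G := fun c => (c : E L) - S.mid (γ 1 / (γ 0 + γ 1)) α c)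
      (exists_norm_sub_mid_le hα _)).const_mul _
  · exact (integrable_norm_sq_comp hQ hX (exists_norm_diff_le hα)).const_mul _

end LatticeSystem

/-! ### From source expectations to integrals over differences -/

section Source

variable {L : ℕ} {Ω : Type*} [MeasurableSpace Ω] {P : Measure Ω}
  {X : Ω → E L} {f : E L → ℝ}

theorem lintegral_comp_eq (hX : Measurable X) (hf : Measurable f)
    (hXf : P.map X = (volume : Measure (E L)).withDensity fun x => ENNReal.ofReal (f x))
    {g : E L → ℝ≥0∞} (hg : Measurable g) :
    ∫⁻ ω, g (X ω) ∂P = ∫⁻ x, ENNReal.ofReal (f x) * g x := by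
  rw [← lintegral_map hg hX, hXf, lintegral_withDensity_eq_lintegral_mul _ hf.ennreal_ofReal hg]
  rfl

theorem lintegral_density [IsProbabilityMeasure P] (hX : Measurable X) (hf : Measurable f)
    (hXf : P.map X = (volume : Measure (E L)).withDensity fun x => ENNReal.ofReal (f x)) :
    ∫⁻ x, ENNReal.ofReal (f x) = 1 := by
  have := lintegral_comp_eq hX hf hXf (g := fun _ => 1) measurable_const
  simpa using this.symm

theorem integrable_density [IsProbabilityMeasure P] (hX : Measurable X) (hf : Measurable f) (hf0 : ∀ x, 0 ≤ f x)
    (hXf : P.map X = (volume : Measure (E L)).withDensity fun x => ENNReal.ofReal (f x)) :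
    Integrable f := by
  refine ⟨hf.aestronglyMeasurable, ?_⟩
  rw [hasFiniteIntegral_iff_ofReal (ae_of_all _ hf0), lintegral_density hX hf hXf]
  exact ENNReal.one_lt_top

open LatticeSystem in
/-- Expectations of functions of the difference of the two side reconstructions, compared with
integrals over `ℝ^L`. -/
theorem exists_lintegral_diff_le [IsProbabilityMeasure P] {μ : Fin 2 → ℝ} (hμ : ∀ i, 0 < μ i)
    (hX : Measurable X) (hf : Measurable f) (hf0 : ∀ x, 0 ≤ f x)
    (hXf : P.map X = (volume : Measure (E L)).withDensity fun x => ENNReal.ofReal (f x))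
    {ε : ℝ≥0∞} (hε : ε ≠ 0) :
    ∃ δ₀ : ℝ, 0 < δ₀ ∧ ∀ (S : LatticeSystem L μ) (Q : E L → S.central) (α : S.Label)
      (F H : E L → ℝ≥0∞) (M : ℝ≥0∞) (δ : ℝ), S.IsQuantizer Q → S.IsLabeling α →
      CoveringRadiusLE S.prod δ₀ → CoveringRadiusLE (S.wside 1) δ →
      (∀ u w, ‖u - w‖ ≤ δ → F u ≤ H w) → (∀ c, F (S.diff α c) ≤ M) →
      ∫⁻ ω, F (S.diff α (Q (X ω))) ∂P ≤
        cellVolE S.central * (cellVolE (S.wside 0) * cellVolE (S.wside 1))⁻¹ * (∫⁻ w, H w)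
          + ε * M := by
  obtain ⟨δ₀, hδ₀, h⟩ := exists_lintegral_le_mean (integrable_density hX hf hf0 hXf) hf
    (lintegral_density hX hf hXf) hε
  refine ⟨δ₀, hδ₀, fun S Q α F H M δ hQ hα hcov hδ hFH hM => ?_⟩
  have hgm : Measurable fun x => F (S.diff α (Q x)) :=
    measurable_of_nearest_comp S.isLattice_central hQ.measurable fun c => F (S.diff α c)
  rw [lintegral_comp_eq hX hf hXf hgm]
  have hν0 := S.isLattice_prod.cellVolE_ne_zero
  have hνt := S.isLattice_prod.cellVolE_ne_top
  have hA0 := (isLattice_wside (S := S) hμ 0).cellVolE_ne_zero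
  have hAt := (isLattice_wside (S := S) hμ 0).cellVolE_ne_top
  have hB0 := (isLattice_wside (S := S) hμ 1).cellVolE_ne_zero
  have hBt := (isLattice_wside (S := S) hμ 1).cellVolE_ne_top
  -- The mean over a period is the sum over central representatives, each with weight central cell
  -- volume over product cell volume.
  refine (h S.prod _ ((cellVolE S.prod)⁻¹ * (cellVolE S.central *
    ∑' c : S.central, repInd S.prod (c : E L) * F (S.diff α c))) M S.isLattice_prod hcov hgm
    (fun x => hM _) fun x => ?_).trans ?_
  · rw [← mul_assoc, ENNReal.mul_inv_cancel hν0 hνt, one_mul]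
    exact lintegral_voronoi_comp_quantizer S.isLattice_prod S.isLattice_central
      S.prod_le_central hQ.nearest (G := fun c => F (S.diff α c))
      (fun l l' hl => by rw [diff_shift hα hl]) x
  · refine add_le_add ?_ le_rfl
    have h2 := label_tsum_le S.isLattice_prod (isLattice_wside hμ 0) (isLattice_wside hμ 1)
      S.prod_le_central (prod_le_wside hμ 0) (a := wlabel hμ α 0) (b := wlabel hμ α 1)
      (fun l c => wlabel_shift hμ hα 0 l c) (fun l c => recon_shift hα 1 l c)
      (wlabel_injective hμ hα) hδ hFH
    set T := ∑' c : S.central, repInd S.prod (c : E L) * F (S.diff α c) with hT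
    have h3 : cellVolE (S.wside 0) * cellVolE (S.wside 1) * T ≤ cellVolE S.prod * ∫⁻ w, H w := h2
    have hAB0 : cellVolE (S.wside 0) * cellVolE (S.wside 1) ≠ 0 := mul_ne_zero hA0 hB0
    have hABt : cellVolE (S.wside 0) * cellVolE (S.wside 1) ≠ ∞ := ENNReal.mul_ne_top hAt hBt
    have h4 : T ≤ (cellVolE (S.wside 0) * cellVolE (S.wside 1))⁻¹ *
        (cellVolE S.prod * ∫⁻ w, H w) := by
      calc T = (cellVolE (S.wside 0) * cellVolE (S.wside 1))⁻¹ *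
            (cellVolE (S.wside 0) * cellVolE (S.wside 1) * T) := by
            rw [← mul_assoc, ENNReal.inv_mul_cancel hAB0 hABt, one_mul]
        _ ≤ _ := by gcongr
    calc (cellVolE S.prod)⁻¹ * (cellVolE S.central * T)
        ≤ (cellVolE S.prod)⁻¹ * (cellVolE S.central *
          ((cellVolE (S.wside 0) * cellVolE (S.wside 1))⁻¹ * (cellVolE S.prod * ∫⁻ w, H w))) := by
          gcongr
      _ = (cellVolE S.prod)⁻¹ * cellVolE S.prod * (cellVolE S.central *
          (cellVolE (S.wside 0) * cellVolE (S.wside 1))⁻¹ * ∫⁻ w, H w) := by ring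
      _ = _ := by rw [ENNReal.inv_mul_cancel hν0 hνt, one_mul]

end Source

end MDC

end

/-! ### Lower bound for differences and construction of a cheap labeling -/

noncomputable section

namespace MDC

open scoped ENNReal Pointwise

section

variable {L : ℕ}

theorem lintegral_ball_deficit (hL : 1 ≤ L) {R : ℝ} (hR : 0 ≤ R) :
    ∫⁻ w : E L, ENNReal.ofReal (R ^ 2 - ‖w‖ ^ 2)
      = ENNReal.ofReal (ballVol L * R ^ (L + 2) * (2 / ((L : ℝ) + 2))) := by
  have hi := integrableOn_norm_sq (L := L) (Metric.isBounded_closedBall (x := 0) (r := R))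
  have hc : IntegrableOn (fun _ : E L => R ^ 2) (Metric.closedBall (0 : E L) R) :=
    integrableOn_const measure_closedBall_lt_top.ne
  have hs : Integrable (fun w : E L => R ^ 2 - ‖w‖ ^ 2)
      (volume.restrict (Metric.closedBall 0 R)) := hc.sub hi
  have e : (fun w : E L => ENNReal.ofReal (R ^ 2 - ‖w‖ ^ 2))
      = (Metric.closedBall (0 : E L) R).indicator fun w => ENNReal.ofReal (R ^ 2 - ‖w‖ ^ 2) := by
    ext w
    by_cases hw : w ∈ Metric.closedBall (0 : E L) R
    · rw [Set.indicator_of_mem hw]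
    · rw [Set.indicator_of_notMem hw, ENNReal.ofReal_eq_zero]
      have : R < ‖w‖ := by simpa using hw
      nlinarith
  rw [e, lintegral_indicator measurableSet_closedBall,
    ← ofReal_integral_eq_lintegral_ofReal (f := fun w : E L => R ^ 2 - ‖w‖ ^ 2) hs]
  · congr 1
    rw [integral_sub hc hi, setIntegral_closedBall_norm_sq hL hR, setIntegral_const,
      volume_real_closedBall _ hR, smul_eq_mul, pow_add]
    field_simp
    ring
  · filter_upwards [ae_restrict_mem measurableSet_closedBall] with w hw
    have : ‖w‖ ≤ R := by simpa using hw
    have := pow_le_pow_left₀ (norm_nonneg w) this 2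
    simp only [Pi.zero_apply]
    linarith

theorem lintegral_closedBall_norm_sq_add (hL : 1 ≤ L) {R K : ℝ} (hR : 0 ≤ R) (hK : 0 ≤ K) :
    ∫⁻ w : E L, (Metric.closedBall (0 : E L) R).indicator (fun w => ENNReal.ofReal (‖w‖ ^ 2 + K)) w
      = ENNReal.ofReal (ballVol L * R ^ (L + 2) * ((L : ℝ) / ((L : ℝ) + 2))
        + K * (ballVol L * R ^ L)) := by
  have hi := integrableOn_norm_sq (L := L) (Metric.isBounded_closedBall (x := 0) (r := R))
  have hc : IntegrableOn (fun _ : E L => K) (Metric.closedBall (0 : E L) R) :=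
    integrableOn_const measure_closedBall_lt_top.ne
  have hs : Integrable (fun w : E L => ‖w‖ ^ 2 + K)
      (volume.restrict (Metric.closedBall 0 R)) := hi.add hc
  rw [lintegral_indicator measurableSet_closedBall,
    ← ofReal_integral_eq_lintegral_ofReal (f := fun w : E L => ‖w‖ ^ 2 + K) hs]
  · congr 1
    rw [integral_add hi hc, setIntegral_closedBall_norm_sq hL hR, setIntegral_const,
      volume_real_closedBall _ hR, smul_eq_mul, mul_comm K]
  · exact ae_of_all _ fun w => add_nonneg (by positivity) hK

variable {μ : Fin 2 → ℝ}

namespace LatticeSystem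

/-- `r` is the radius at which the pairs of side points are as many as the central points. -/
def IsScale (S : LatticeSystem L μ) (r : ℝ) : Prop :=
  0 < r ∧ ballVol L * r ^ L * cellVol S.central = cellVol (S.wside 0) * cellVol (S.wside 1)

theorem IsScale.prefactor {S : LatticeSystem L μ} (hμ : ∀ i, 0 < μ i) (hL : 1 ≤ L) {r : ℝ}
    (hr : S.IsScale r) :
    cellVolE S.central * (cellVolE (S.wside 0) * cellVolE (S.wside 1))⁻¹
      = ENNReal.ofReal (ballVol L * r ^ L)⁻¹ := by
  have hA := isLattice_wside (S := S) hμ 0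
  have hB := isLattice_wside (S := S) hμ 1
  have hν := S.isLattice_central.cellVol_pos
  have hv := ballVol_pos hL
  have hr0 := hr.1
  rw [S.isLattice_central.cellVolE_eq, hA.cellVolE_eq, hB.cellVolE_eq,
    ← ENNReal.ofReal_mul hA.cellVol_pos.le, ← hr.2, ← ENNReal.ofReal_inv_of_pos (by positivity),
    ← ENNReal.ofReal_mul hν.le]
  congr 1
  field_simp

end LatticeSystem

open LatticeSystem

variable {Ω : Type*} [MeasurableSpace Ω] {P : Measure Ω} [IsProbabilityMeasure P]
  {X : Ω → E L} {f : E L → ℝ}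

/-- The truncated quantity `(r² - ‖d‖²)₊` is at most `r²` for every labeling, so the averaging error
stays below `ε * r²`; `‖d‖²` itself has no such uniform bound. The factor `(1 + τ) ^ (L + 2)` is the
price of the envelope over the covering radius. -/
theorem exists_integral_deficit_le (hL : 1 ≤ L) (hμ : ∀ i, 0 < μ i)
    (hX : Measurable X) (hf : Measurable f) (hf0 : ∀ x, 0 ≤ f x)
    (hXf : P.map X = (volume : Measure (E L)).withDensity fun x => ENNReal.ofReal (f x))
    {ε : ℝ} (hε : 0 < ε) :
    ∃ δ₀ : ℝ, 0 < δ₀ ∧ ∀ (S : LatticeSystem L μ) (Q : E L → S.central) (α : S.Label) (r τ : ℝ),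
      S.IsQuantizer Q → S.IsLabeling α → S.IsScale r → CoveringRadiusLE S.prod δ₀ →
      CoveringRadiusLE (S.wside 1) (τ * r) → 0 ≤ τ →
      ∫ ω, max 0 (r ^ 2 - ‖S.diff α (Q (X ω))‖ ^ 2) ∂P
        ≤ r ^ 2 * (2 / ((L : ℝ) + 2) * (1 + τ) ^ (L + 2) + ε) := by
  obtain ⟨δ₀, hδ₀, h⟩ := exists_lintegral_diff_le hμ hX hf hf0 hXf
    (ε := ENNReal.ofReal ε) (by simpa using hε)
  refine ⟨δ₀, hδ₀, fun S Q α r τ hQ hα hr hcov hδ hτ => ?_⟩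
  have hr0 := hr.1
  have hv := ballVol_pos hL
  have h1 := h S Q α (fun u => ENNReal.ofReal (r ^ 2 - ‖u‖ ^ 2))
    (fun w => ENNReal.ofReal ((r + τ * r) ^ 2 - ‖w‖ ^ 2)) (ENNReal.ofReal (r ^ 2)) (τ * r)
    hQ hα hcov hδ (fun u w huw => ?_) (fun c => ENNReal.ofReal_le_ofReal (by nlinarith [norm_nonneg (S.diff α c)]))
  · have hm : Measurable fun ω => max 0 (r ^ 2 - ‖S.diff α (Q (X ω))‖ ^ 2) :=
      hQ.measurable_comp hX fun c => max 0 (r ^ 2 - ‖S.diff α c‖ ^ 2)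
    rw [integral_eq_lintegral_of_nonneg_ae
      (f := fun ω => max 0 (r ^ 2 - ‖S.diff α (Q (X ω))‖ ^ 2)) (ae_of_all _ fun ω => le_max_left _ _)
      hm.aestronglyMeasurable]
    refine ENNReal.toReal_le_of_le_ofReal (by positivity) ?_
    have e : ∀ t : ℝ, ENNReal.ofReal (max 0 t) = ENNReal.ofReal t := fun t => by
      rcases le_total 0 t with ht | ht
      · rw [max_eq_right ht]
      · rw [max_eq_left ht, ENNReal.ofReal_zero, ENNReal.ofReal_of_nonpos ht]
    simp_rw [e]
    refine h1.trans (le_of_eq ?_)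
    rw [hr.prefactor hμ hL, lintegral_ball_deficit hL (by positivity),
      ← ENNReal.ofReal_mul (by positivity), ← ENNReal.ofReal_mul hε.le,
      ← ENNReal.ofReal_add (by positivity) (by positivity)]
    congr 1
    have e2 : r + τ * r = r * (1 + τ) := by ring
    rw [e2, mul_pow, pow_add r]
    field_simp
  · refine ENNReal.ofReal_le_ofReal_iff'.2 ?_
    by_cases hu : ‖u‖ ≤ r
    · left
      have h2 := norm_sub_norm_le w u
      rw [norm_sub_rev] at h2
      have h3 : ‖w‖ ≤ ‖u‖ + τ * r := by linarith
      have h4 : ‖w‖ ^ 2 ≤ (‖u‖ + τ * r) ^ 2 := pow_le_pow_left₀ (norm_nonneg _) h3 2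
      have h5 : 0 ≤ τ * r := by positivity
      nlinarith
    · right
      push Not at hu
      nlinarith

/-- The last condition on `ε` and `τ` is the L-th root of the room condition of `exists_label` for
`R = (1 + ε) * r` and `s = ε * r`. At `τ = 0` it reads `ε ≤ (1 + ε) * ε`: stretching the differences
by `1 + ε` creates the slack that absorbs the covering radii. -/
theorem exists_labeling_cost_le (hL : 1 ≤ L) (hμ : ∀ i, 0 < μ i)
    (hX : Measurable X) (hf : Measurable f) (hf0 : ∀ x, 0 ≤ f x)
    (hXf : P.map X = (volume : Measure (E L)).withDensity fun x => ENNReal.ofReal (f x))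
    {γ : Fin 2 → ℝ} (hγ : ∀ i, 0 < γ i) {ε : ℝ} (hε : 0 < ε) :
    ∃ δ₀ : ℝ, 0 < δ₀ ∧ ∀ (S : LatticeSystem L μ) (Q : E L → S.central) (r τ : ℝ),
      S.IsQuantizer Q → S.IsScale r → CoveringRadiusLE S.prod δ₀ →
      CoveringRadiusLE S.central (τ * r) → (∀ i, CoveringRadiusLE (S.wside i) (τ * r)) →
      0 ≤ τ → 2 * τ ≤ ε → ε + τ ≤ (1 + ε - 2 * τ) * (ε - 2 * τ) →
      ∃ β : S.Label, S.IsLabeling β ∧ S.cost P X Q γ β * L ≤ r ^ 2 * ((γ 0 + γ 1) * ε ^ 2 +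
        γ 0 * γ 1 / (γ 0 + γ 1) * ((1 + ε + τ) ^ (L + 2) * ((L : ℝ) / ((L : ℝ) + 2))
          + (2 * (1 + ε + τ) * τ + τ ^ 2) * (1 + ε + τ) ^ L + ε * (1 + ε) ^ 2)) := by
  obtain ⟨δ₀, hδ₀, h⟩ := exists_lintegral_diff_le hμ hX hf hf0 hXf
    (ε := ENNReal.ofReal ε) (by simpa using hε)
  refine ⟨δ₀, hδ₀, fun S Q r τ hQ hr hcov hδc hδ hτ hτε hroom => ?_⟩
  have hr0 := hr.1
  have hv := ballVol_pos hL
  have hγ0 := hγ 0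
  have hγ1 := hγ 1
  set θ := γ 1 / (γ 0 + γ 1) with hθ
  have hθ0 : 0 ≤ θ := by positivity
  have hθ1 : θ ≤ 1 := by
    rw [hθ, div_le_one (by positivity)]
    linarith
  have hA := isLattice_wside (S := S) hμ 0
  have hB := isLattice_wside (S := S) hμ 1
  have hν := S.isLattice_central.cellVol_pos
  obtain ⟨a, b, ha, hb, hinj, hab⟩ := exists_label S.isLattice_central hA hB S.prod_le_central
    (prod_le_wside hμ 0) (prod_le_wside hμ 1) hδc (hδ 0) (hδ 1) hθ0 hθ1
    (R := (1 + ε) * r) (s := ε * r) (by positivity) (by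
      have e1 : ε * r - (τ * r + τ * r) = (ε - 2 * τ) * r := by ring
      have e2 : (1 + ε) * r - (τ * r + τ * r) = (1 + ε - 2 * τ) * r := by ring
      have h1 : 0 ≤ ε - 2 * τ := by linarith
      have h2 : 0 ≤ 1 + ε - 2 * τ := by linarith
      rw [e1, e2, volume_closedBall_eq _ (by positivity), volume_closedBall_eq _ (by positivity),
        volume_closedBall_eq _ (by positivity), hA.cellVolE_eq, hB.cellVolE_eq,
        S.isLattice_central.cellVolE_eq, ← ENNReal.ofReal_mul hA.cellVol_pos.le, ← hr.2,
        ← ENNReal.ofReal_mul (by positivity), ← ENNReal.ofReal_mul (by positivity),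
        ← ENNReal.ofReal_mul (by positivity)]
      refine ENNReal.ofReal_le_ofReal ?_
      have h3 := pow_le_pow_left₀ (by positivity) hroom L
      calc ballVol L * (ε * r + τ * r) ^ L * (ballVol L * r ^ L * cellVol S.central)
          = ballVol L * ballVol L * cellVol S.central * r ^ L * r ^ L * (ε + τ) ^ L := by
            rw [← add_mul, mul_pow]; ring
        _ ≤ ballVol L * ballVol L * cellVol S.central * r ^ L * r ^ L *
              ((1 + ε - 2 * τ) * (ε - 2 * τ)) ^ L := by gcongr
        _ = _ := by rw [mul_pow, mul_pow, mul_pow]; ring)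
  obtain ⟨β, hβ, hβab⟩ := exists_isLabeling hμ a b ha hb hinj
  refine ⟨β, hβ, ?_⟩
  have hd : ∀ c, ‖S.diff β c‖ ≤ (1 + ε) * r := fun c => by
    rw [diff, (hβab c).1, (hβab c).2]; exact (hab c).1
  have hm : ∀ c : S.central, ‖(c : E L) - S.mid θ β c‖ ≤ ε * r := fun c => by
    rw [mid, diff, (hβab c).1, (hβab c).2, norm_sub_rev]; exact (hab c).2
  rw [cost_mul_eq hL hQ hX hγ hβ, mul_add, ← hθ]
  have hmint : ∫ ω, ‖(Q (X ω) : E L) - S.mid θ β (Q (X ω))‖ ^ 2 ∂P ≤ (ε * r) ^ 2 := by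
    have := integral_mono (μ := P) (integrable_norm_sq_comp hQ hX
      (G := fun c => (c : E L) - S.mid θ β c) (exists_norm_sub_mid_le hβ θ))
      (integrable_const ((ε * r) ^ 2))
      (fun ω => pow_le_pow_left₀ (norm_nonneg _) (hm (Q (X ω))) 2)
    simpa using this
  have hdint : ∫ ω, ‖S.diff β (Q (X ω))‖ ^ 2 ∂P ≤
      r ^ 2 * ((1 + ε + τ) ^ (L + 2) * ((L : ℝ) / ((L : ℝ) + 2))
          + (2 * (1 + ε + τ) * τ + τ ^ 2) * (1 + ε + τ) ^ L + ε * (1 + ε) ^ 2) := by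
    classical
    -- All differences of `β` have length at most `(1 + ε) * r`, so cutting off there changes
    -- nothing and keeps the envelope inside a ball. The added constant comes from `‖u‖ ≤ ‖w‖ + τ *
    -- r`.
    have h1 := h S Q β (fun u => if ‖u‖ ≤ (1 + ε) * r then ENNReal.ofReal (‖u‖ ^ 2) else 0)
      (fun w => (Metric.closedBall (0 : E L) ((1 + ε + τ) * r)).indicator
        (fun w => ENNReal.ofReal (‖w‖ ^ 2 + (2 * (1 + ε + τ) * τ + τ ^ 2) * r ^ 2)) w)
      (ENNReal.ofReal (((1 + ε) * r) ^ 2)) (τ * r)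
      hQ hβ hcov (hδ 1) (fun u w huw => ?_) (fun c => ?_)
    · rw [integral_eq_lintegral_of_nonneg_ae (ae_of_all _ fun ω => by positivity)
        (hQ.measurable_comp hX fun c => ‖S.diff β c‖ ^ 2).aestronglyMeasurable]
      refine ENNReal.toReal_le_of_le_ofReal (by positivity) ?_
      simp only [hd, if_true] at h1
      refine h1.trans (le_of_eq ?_)
      rw [hr.prefactor hμ hL, lintegral_closedBall_norm_sq_add hL (by positivity) (by positivity),
        ← ENNReal.ofReal_mul (by positivity), ← ENNReal.ofReal_mul hε.le,
        ← ENNReal.ofReal_add (by positivity) (by positivity)]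
      congr 1
      rw [mul_pow _ r (L + 2), mul_pow _ r L, pow_add r]
      field_simp
    · split_ifs with hu
      · have h2 := norm_sub_norm_le w u
        have h3 := norm_sub_norm_le u w
        rw [norm_sub_rev] at h2
        have hw : ‖w‖ ≤ (1 + ε + τ) * r := by linarith
        rw [Set.indicator_of_mem (by simpa using hw)]
        refine ENNReal.ofReal_le_ofReal ?_
        have h4 : ‖u‖ ≤ ‖w‖ + τ * r := by linarith
        have h5 := pow_le_pow_left₀ (norm_nonneg _) h4 2
        have h6 : 0 ≤ τ * r := by positivity
        have h7 := mul_le_mul_of_nonneg_right hw h6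
        nlinarith
      · exact zero_le
    · simp only [hd, if_true]
      exact ENNReal.ofReal_le_ofReal (pow_le_pow_left₀ (norm_nonneg _) (hd c) 2)
  have hκ : 0 ≤ γ 0 * γ 1 / (γ 0 + γ 1) := by positivity
  have h1 := mul_le_mul_of_nonneg_left hmint (show 0 ≤ γ 0 + γ 1 by positivity)
  have h2 := mul_le_mul_of_nonneg_left hdint hκ
  refine (add_le_add h1 h2).trans (le_of_eq ?_)
  ring

end

end MDC

end

/-! ### Asymptotics of optimal labelings -/

noncomputable section

namespace MDC

namespace LatticeSystem

variable {L : ℕ} {μ : Fin 2 → ℝ}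

/-- A sequence of lattice systems whose central and side lattices are fine with respect to the
scale `r`, and whose product lattices become fine. -/
structure IsFine (S : ℕ → LatticeSystem L μ) (r τ ρ : ℕ → ℝ) : Prop where
  scale : ∀ k, (S k).IsScale (r k)
  nonneg : ∀ k, 0 ≤ τ k
  tendsto : Tendsto τ atTop (𝓝 0)
  central : ∀ k, CoveringRadiusLE (S k).central (τ k * r k)
  side : ∀ k i, CoveringRadiusLE ((S k).wside i) (τ k * r k)
  prod : ∀ k, CoveringRadiusLE (S k).prod (ρ k)
  prod_tendsto : Tendsto ρ atTop (𝓝 0)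

theorem _root_.MDC.CoveringRadiusLE.mono {Λ : Submodule ℤ (E L)} {a b : ℝ}
    (h : CoveringRadiusLE Λ a) (hab : a ≤ b) : CoveringRadiusLE Λ b := fun x =>
  let ⟨l, hl, h'⟩ := h x
  ⟨l, hl, h'.trans hab⟩

variable {S : ℕ → LatticeSystem L μ} {r τ ρ : ℕ → ℝ}
  {Ω : Type*} [MeasurableSpace Ω] {P : Measure Ω}
  {X : Ω → E L} {f : E L → ℝ} {Q : (k : ℕ) → E L → (S k).central}

theorem IsFine.eventually_prod (hS : IsFine S r τ ρ) {δ : ℝ} (hδ : 0 < δ) :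
    ∀ᶠ k in atTop, CoveringRadiusLE (S k).prod δ := by
  filter_upwards [hS.prod_tendsto.eventually_lt_const hδ] with k hk
  exact (hS.prod k).mono hk.le

/-- The normalized mean deficit `E (r² - d²)₊ / r²`. -/
def deficit (P : Measure Ω) (X : Ω → E L) (S : LatticeSystem L μ) (Q : E L → S.central)
    (α : S.Label) (r : ℝ) : ℝ := (∫ ω, max 0 (r ^ 2 - ‖S.diff α (Q (X ω))‖ ^ 2) ∂P) / r ^ 2

/-- The normalized mean square of the difference of the two side reconstructions. -/
def spread (P : Measure Ω) (X : Ω → E L) (S : LatticeSystem L μ) (Q : E L → S.central)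
    (α : S.Label) (r : ℝ) : ℝ := (∫ ω, ‖S.diff α (Q (X ω))‖ ^ 2 ∂P) / r ^ 2

/-- The normalized mean square distance to the weighted midpoint. -/
def offset (θ : ℝ) (P : Measure Ω) (X : Ω → E L) (S : LatticeSystem L μ) (Q : E L → S.central)
    (α : S.Label) (r : ℝ) : ℝ :=
  (∫ ω, ‖(Q (X ω) : E L) - S.mid θ α (Q (X ω))‖ ^ 2 ∂P) / r ^ 2

theorem offset_nonneg (θ : ℝ) (P : Measure Ω) (X : Ω → E L) (S : LatticeSystem L μ)
    (Q : E L → S.central) (α : S.Label) (r : ℝ) : 0 ≤ offset θ P X S Q α r :=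
  div_nonneg (integral_nonneg fun _ => by positivity) (by positivity)

theorem integrable_deficit [IsFiniteMeasure P] {S : LatticeSystem L μ} {Q : E L → S.central}
    (hQ : S.IsQuantizer Q) (hX : Measurable X) (α : S.Label) (r : ℝ) :
    Integrable (fun ω => max 0 (r ^ 2 - ‖S.diff α (Q (X ω))‖ ^ 2)) P := by
  refine hQ.integrable_comp hX (G := fun c => max 0 (r ^ 2 - ‖S.diff α c‖ ^ 2)) (B := r ^ 2)
    fun c => ?_
  rw [abs_of_nonneg (le_max_left _ _)]
  exact max_le (by positivity) (by nlinarith [norm_nonneg (S.diff α c)])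

/-- The normalized mean excess `E (d² - r²)₊ / r²`. -/
theorem excess_eq [IsProbabilityMeasure P] {S : LatticeSystem L μ} {Q : E L → S.central}
    (hQ : S.IsQuantizer Q) (hX : Measurable X) {α : S.Label} (hα : S.IsLabeling α) {r : ℝ}
    (hr : 0 < r) :
    (∫ ω, max 0 (‖S.diff α (Q (X ω))‖ ^ 2 - r ^ 2) ∂P) / r ^ 2
      = spread P X S Q α r - 1 + deficit P X S Q α r := by
  have h1 := integrable_norm_sq_comp (P := P) hQ hX (exists_norm_diff_le hα)
  have h2 := integrable_deficit (P := P) hQ hX α r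
  have e : ∀ ω, max 0 (‖S.diff α (Q (X ω))‖ ^ 2 - r ^ 2)
      = ‖S.diff α (Q (X ω))‖ ^ 2 - r ^ 2 + max 0 (r ^ 2 - ‖S.diff α (Q (X ω))‖ ^ 2) := by
    intro ω
    rcases le_total (‖S.diff α (Q (X ω))‖ ^ 2) (r ^ 2) with h | h
    · rw [max_eq_left (by linarith), max_eq_right (by linarith)]; ring
    · rw [max_eq_right (by linarith), max_eq_left (by linarith)]; ring
  simp_rw [e]
  have h3 : Integrable (fun ω => ‖S.diff α (Q (X ω))‖ ^ 2 - r ^ 2) P :=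
    h1.sub (integrable_const _)
  rw [integral_add h3 h2, integral_sub h1 (integrable_const _), spread, deficit]
  simp only [integral_const, probReal_univ, smul_eq_mul, one_mul]
  field_simp

theorem excess_nonneg (P : Measure Ω) (X : Ω → E L) (S : LatticeSystem L μ) (Q : E L → S.central)
    (α : S.Label) (r : ℝ) :
    0 ≤ (∫ ω, max 0 (‖S.diff α (Q (X ω))‖ ^ 2 - r ^ 2) ∂P) / r ^ 2 :=
  div_nonneg (integral_nonneg fun _ => le_max_left _ _) (by positivity)

section

variable [IsProbabilityMeasure P]

theorem IsFine.eventually_deficit_le (hS : IsFine S r τ ρ) (hL : 1 ≤ L) (hμ : ∀ i, 0 < μ i)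
    (hX : Measurable X) (hf : Measurable f) (hf0 : ∀ x, 0 ≤ f x)
    (hXf : P.map X = (volume : Measure (E L)).withDensity fun x => ENNReal.ofReal (f x))
    (hQ : ∀ k, (S k).IsQuantizer (Q k)) {α : (k : ℕ) → (S k).Label}
    (hα : ∀ k, (S k).IsLabeling (α k)) {ε : ℝ} (hε : 0 < ε) :
    ∀ᶠ k in atTop, deficit P X (S k) (Q k) (α k) (r k) ≤ 2 / ((L : ℝ) + 2) + ε := by
  obtain ⟨δ₀, hδ₀, h⟩ := exists_integral_deficit_le hL hμ hX hf hf0 hXf (half_pos hε)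
  have hlim : Tendsto (fun k => 2 / ((L : ℝ) + 2) * (1 + τ k) ^ (L + 2)) atTop
      (𝓝 (2 / ((L : ℝ) + 2) * (1 + 0) ^ (L + 2))) :=
    ((hS.tendsto.const_add 1).pow _).const_mul _
  rw [add_zero, one_pow, mul_one] at hlim
  filter_upwards [hS.eventually_prod hδ₀, hlim.eventually_lt_const
    (show 2 / ((L : ℝ) + 2) < 2 / ((L : ℝ) + 2) + ε / 2 by linarith)] with k hk hτ
  have hr := (hS.scale k).1
  have := h (S k) (Q k) (α k) (r k) (τ k) (hQ k) (hα k) (hS.scale k) hk (hS.side k 1) (hS.nonneg k)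
  rw [deficit, div_le_iff₀ (by positivity), mul_comm]
  refine this.trans (mul_le_mul_of_nonneg_left ?_ (sq_nonneg _))
  linarith

theorem IsFine.eventually_cost_le (hS : IsFine S r τ ρ) (hL : 1 ≤ L) (hμ : ∀ i, 0 < μ i)
    (hX : Measurable X) (hf : Measurable f) (hf0 : ∀ x, 0 ≤ f x)
    (hXf : P.map X = (volume : Measure (E L)).withDensity fun x => ENNReal.ofReal (f x))
    (hQ : ∀ k, (S k).IsQuantizer (Q k)) {γ : Fin 2 → ℝ} (hγ : ∀ i, 0 < γ i)
    {α : (k : ℕ) → (S k).Label}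
    (hα : ∀ k, (S k).IsOptimal P X (Q k) γ (α k)) {ε : ℝ} (hε : 0 < ε) :
    ∀ᶠ k in atTop, (γ 0 + γ 1) * offset (γ 1 / (γ 0 + γ 1)) P X (S k) (Q k) (α k) (r k)
      + γ 0 * γ 1 / (γ 0 + γ 1) * spread P X (S k) (Q k) (α k) (r k)
      ≤ γ 0 * γ 1 / (γ 0 + γ 1) * ((L : ℝ) / ((L : ℝ) + 2)) + ε := by
  let Φ : ℝ → ℝ → ℝ := fun e t => (γ 0 + γ 1) * e ^ 2 +
        γ 0 * γ 1 / (γ 0 + γ 1) * ((1 + e + t) ^ (L + 2) * ((L : ℝ) / ((L : ℝ) + 2))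
          + (2 * (1 + e + t) * t + t ^ 2) * (1 + e + t) ^ L + e * (1 + e) ^ 2)
  have hΦ0 : Φ 0 0 = γ 0 * γ 1 / (γ 0 + γ 1) * ((L : ℝ) / ((L : ℝ) + 2)) := by simp [Φ]
  -- The parameter of the constructed labeling is fixed first, with covering radii zero; `τ k → 0`
  -- is used afterwards.
  obtain ⟨e, he0, he⟩ : ∃ e : ℝ, 0 < e ∧ Φ e 0 < Φ 0 0 + ε := by
    have hc : Tendsto (fun e => Φ e 0) (𝓝[>] 0) (𝓝 (Φ 0 0)) := by
      have : Continuous fun e => Φ e 0 := by fun_prop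
      exact (this.tendsto 0).mono_left nhdsWithin_le_nhds
    obtain ⟨e, h1, h2⟩ := ((hc.eventually_lt_const (lt_add_of_pos_right _ hε)).and
      self_mem_nhdsWithin).exists
    exact ⟨e, h2, h1⟩
  obtain ⟨δ₀, hδ₀, h⟩ := exists_labeling_cost_le hL hμ hX hf hf0 hXf hγ he0
  have hlim : Tendsto (fun k => Φ e (τ k)) atTop (𝓝 (Φ e 0)) := by
    have : Continuous (Φ e) := by fun_prop
    exact (this.tendsto 0).comp hS.tendsto
  -- The limit is `e ^ 2 > 0`, so the room condition holds eventually.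
  have hlim2 : Tendsto (fun k => (1 + e - 2 * τ k) * (e - 2 * τ k) - (e + τ k)) atTop
      (𝓝 ((1 + e - 2 * 0) * (e - 2 * 0) - (e + 0))) := by
    have : Continuous fun t : ℝ => (1 + e - 2 * t) * (e - 2 * t) - (e + t) := by fun_prop
    exact (this.tendsto 0).comp hS.tendsto
  filter_upwards [hS.eventually_prod hδ₀, hlim.eventually_lt_const he,
    hlim2.eventually_const_lt (show (0 : ℝ) < (1 + e - 2 * 0) * (e - 2 * 0) - (e + 0) by nlinarith),
    hS.tendsto.eventually_lt_const (half_pos he0)] with k hk h1 h2 h3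
  have hr := (hS.scale k).1
  have hr2 : 0 < r k ^ 2 := by positivity
  obtain ⟨β, hβ, hβc⟩ := h (S k) (Q k) (r k) (τ k) (hQ k) (hS.scale k) hk (hS.central k)
    (hS.side k) (hS.nonneg k) (by linarith) (by linarith)
  have h4 := mul_le_mul_of_nonneg_right ((hα k).2 β hβ) (Nat.cast_nonneg (α := ℝ) L)
  rw [cost_mul_eq hL (hQ k) hX hγ (hα k).1] at h4
  have h5 := h4.trans hβc
  rw [offset, spread, ← mul_div_assoc, ← mul_div_assoc, ← add_div, div_le_iff₀ hr2, 
    mul_comm _ (r k ^ 2)]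
  refine h5.trans (mul_le_mul_of_nonneg_left ?_ hr2.le)
  rw [← hΦ0]
  exact h1.le

/-- Optimal labelings: the weighted midpoints are asymptotically at the central points, the mean
square difference is asymptotically that of a ball, and long differences are negligible. -/
theorem IsFine.tendsto_of_isOptimal (hS : IsFine S r τ ρ) (hL : 1 ≤ L) (hμ : ∀ i, 0 < μ i)
    (hX : Measurable X) (hf : Measurable f) (hf0 : ∀ x, 0 ≤ f x)
    (hXf : P.map X = (volume : Measure (E L)).withDensity fun x => ENNReal.ofReal (f x))
    (hQ : ∀ k, (S k).IsQuantizer (Q k)) {γ : Fin 2 → ℝ} (hγ : ∀ i, 0 < γ i)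
    {α : (k : ℕ) → (S k).Label} (hα : ∀ k, (S k).IsOptimal P X (Q k) γ (α k)) :
    Tendsto (fun k => offset (γ 1 / (γ 0 + γ 1)) P X (S k) (Q k) (α k) (r k)) atTop (𝓝 0) ∧
    Tendsto (fun k => spread P X (S k) (Q k) (α k) (r k)) atTop (𝓝 ((L : ℝ) / ((L : ℝ) + 2))) ∧
    Tendsto (fun k => (∫ ω, max 0 (‖(S k).diff (α k) (Q k (X ω))‖ ^ 2 - r k ^ 2) ∂P) / r k ^ 2)
      atTop (𝓝 0) := by
  have hγ0 := hγ 0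
  have hγ1 := hγ 1
  have hs : 0 < γ 0 + γ 1 := by positivity
  set κ := γ 0 * γ 1 / (γ 0 + γ 1) with hκ
  have hκ0 : 0 < κ := by positivity
  set W := fun k => offset (γ 1 / (γ 0 + γ 1)) P X (S k) (Q k) (α k) (r k) with hW
  set D := fun k => spread P X (S k) (Q k) (α k) (r k) with hD
  set U := fun k => deficit P X (S k) (Q k) (α k) (r k) with hU
  set V := fun k => (∫ ω, max 0 (‖(S k).diff (α k) (Q k (X ω))‖ ^ 2 - r k ^ 2) ∂P) / r k ^ 2
    with hV
  -- This identity closes the squeeze: `V = D - 1 + U ≥ 0` and the bound on `U` push `D` up to `1 -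
  -- 2 / (L + 2)`, while the cost bound with `W ≥ 0` holds it down to `L / (L + 2)`.
  have hsum : (L : ℝ) / ((L : ℝ) + 2) = 1 - 2 / ((L : ℝ) + 2) := by field_simp; ring
  have hV0 : ∀ k, 0 ≤ V k := fun k => excess_nonneg _ _ _ _ _ _
  have hW0 : ∀ k, 0 ≤ W k := fun k => offset_nonneg _ _ _ _ _ _ _
  have hVDU : ∀ k, V k = D k - 1 + U k := fun k => excess_eq (hQ k) hX (hα k).1 (hS.scale k).1
  have hUle : ∀ ε > 0, ∀ᶠ k in atTop, U k ≤ 2 / ((L : ℝ) + 2) + ε := fun ε hε =>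
    hS.eventually_deficit_le hL hμ hX hf hf0 hXf hQ (fun k => (hα k).1) hε
  have hcost : ∀ ε > 0, ∀ᶠ k in atTop, (γ 0 + γ 1) * W k + κ * D k
      ≤ κ * ((L : ℝ) / ((L : ℝ) + 2)) + ε := fun ε hε =>
    hS.eventually_cost_le hL hμ hX hf hf0 hXf hQ hγ hα hε
  have hDhi : ∀ ε > 0, ∀ᶠ k in atTop, D k ≤ (L : ℝ) / ((L : ℝ) + 2) + ε := fun ε hε => by
    filter_upwards [hcost (κ * ε) (by positivity)] with k hk
    have h1 : 0 ≤ (γ 0 + γ 1) * W k := mul_nonneg hs.le (hW0 k)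
    refine le_of_mul_le_mul_left ?_ hκ0
    rw [mul_add]
    linarith
  have hDlo : ∀ ε > 0, ∀ᶠ k in atTop, (L : ℝ) / ((L : ℝ) + 2) - ε ≤ D k := fun ε hε => by
    filter_upwards [hUle ε hε] with k hk
    have := hV0 k
    rw [hVDU] at this
    rw [hsum]
    linarith
  refine ⟨?_, ?_, ?_⟩
  · rw [Metric.tendsto_nhds]
    intro ε hε
    -- This amount is lost once in the cost bound and `κ` times in the lower bound for `D`, in total
    -- half of `(γ 0 + γ 1) * ε`.
    have hη : 0 < (γ 0 + γ 1) * ε / (2 * (1 + κ)) := by positivity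
    filter_upwards [hcost _ hη, hDlo _ hη] with k h1 h2
    rw [Real.dist_eq, sub_zero, abs_of_nonneg (hW0 k)]
    refine lt_of_mul_lt_mul_left ?_ hs.le
    have h3 := mul_le_mul_of_nonneg_left h2 hκ0.le
    have h4 : (1 + κ) * ((γ 0 + γ 1) * ε / (2 * (1 + κ))) = (γ 0 + γ 1) * ε / 2 := by
      field_simp
    have h5 : 0 < (γ 0 + γ 1) * ε := by positivity
    nlinarith
  · rw [Metric.tendsto_nhds]
    intro ε hε
    filter_upwards [hDhi _ (half_pos hε), hDlo _ (half_pos hε)] with k h1 h2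
    rw [Real.dist_eq, abs_lt]
    constructor <;> linarith
  · rw [Metric.tendsto_nhds]
    intro ε hε
    filter_upwards [hDhi _ (show 0 < ε / 3 by positivity), hUle _ (show 0 < ε / 3 by positivity)]
      with k h1 h2
    have := hVDU k
    rw [Real.dist_eq, sub_zero, abs_of_nonneg (hV0 k)]
    rw [hsum] at h1
    linarith

end

/-- Expand the square and split the cross term with weight `t`. In the application `t` is small and
fixed while the mean of `‖w‖²` becomes negligible. -/
theorem abs_norm_add_smul_sq_sub_le (w d : E L) (s : ℝ) {t : ℝ} (ht : 0 < t) :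
    |‖w + s • d‖ ^ 2 - s ^ 2 * ‖d‖ ^ 2| ≤ t * ‖d‖ ^ 2 + (1 + s ^ 2 / t) * ‖w‖ ^ 2 := by
  have e : ‖w + s • d‖ ^ 2 - s ^ 2 * ‖d‖ ^ 2 = ‖w‖ ^ 2 + 2 * (s * inner ℝ w d) := by
    rw [norm_add_sq_real, inner_smul_right, norm_smul, mul_pow, Real.norm_eq_abs, sq_abs]
    ring
  have h1 : |s * inner ℝ w d| ≤ |s| * ‖w‖ * ‖d‖ := by
    rw [abs_mul, mul_assoc]
    gcongr
    exact abs_real_inner_le_norm w d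
  have h2 : 2 * (|s| * ‖w‖ * ‖d‖) ≤ t * ‖d‖ ^ 2 + s ^ 2 / t * ‖w‖ ^ 2 := by
    have h3 : 0 ≤ (t * ‖d‖ - |s| * ‖w‖) ^ 2 / t := by positivity
    have h4 : (t * ‖d‖ - |s| * ‖w‖) ^ 2 / t
        = t * ‖d‖ ^ 2 + |s| ^ 2 / t * ‖w‖ ^ 2 - 2 * (|s| * ‖w‖ * ‖d‖) := by
      field_simp
      ring
    rw [sq_abs] at h4
    linarith
  rw [e]
  refine (abs_add_le _ _).trans ?_
  rw [abs_of_nonneg (by positivity : 0 ≤ ‖w‖ ^ 2), abs_mul, abs_two]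
  linarith

theorem integrable_norm_sq_sub_recon [IsFiniteMeasure P] {S : LatticeSystem L μ}
    {Q : E L → S.central} (hQ : S.IsQuantizer Q) (hX : Measurable X) {δ : ℝ}
    (hδ : CoveringRadiusLE S.central δ) {G : S.central → E L}
    (hG : ∃ B : ℝ, ∀ c : S.central, ‖(c : E L) - G c‖ ≤ B) :
    Integrable (fun ω => ‖X ω - G (Q (X ω))‖ ^ 2) P := by
  obtain ⟨B, hB⟩ := hG
  have hm : Measurable fun ω => ‖X ω - G (Q (X ω))‖ ^ 2 :=
    ((hX.sub (hQ.measurable_comp hX G)).norm).pow_const 2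
  refine Integrable.of_bound hm.aestronglyMeasurable ((δ + B) ^ 2) (ae_of_all _ fun ω => ?_)
  rw [Real.norm_of_nonneg (by positivity)]
  refine pow_le_pow_left₀ (norm_nonneg _) ?_ 2
  have e : X ω - G (Q (X ω)) = (X ω - Q (X ω)) + ((Q (X ω) : E L) - G (Q (X ω))) := by abel
  rw [e]
  exact (norm_add_le _ _).trans (add_le_add (hδ.norm_sub_le (hQ.nearest _)) (hB _))

/-- The mean square distance of the source from a point that divides the two side reconstructions
in a ratio given by `s`. -/
theorem IsFine.tendsto_integral_norm_sq [IsProbabilityMeasure P] (hS : IsFine S r τ ρ) (hL : 1 ≤ L)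
    (hX : Measurable X) (hQ : ∀ k, (S k).IsQuantizer (Q k)) {θ : ℝ}
    {α : (k : ℕ) → (S k).Label} (hα : ∀ k, (S k).IsLabeling (α k))
    (hW : Tendsto (fun k => offset θ P X (S k) (Q k) (α k) (r k)) atTop (𝓝 0))
    (hD : Tendsto (fun k => spread P X (S k) (Q k) (α k) (r k)) atTop
      (𝓝 ((L : ℝ) / ((L : ℝ) + 2)))) (s : ℝ) (G : (k : ℕ) → (S k).central → E L)
    (hGb : ∀ k, ∃ B : ℝ, ∀ c : (S k).central, ‖(c : E L) - G k c‖ ≤ B)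
    (hG : ∀ k c, G k c = (S k).mid θ (α k) c - s • (S k).diff (α k) c) :
    Tendsto (fun k => (∫ ω, ‖X ω - G k (Q k (X ω))‖ ^ 2 ∂P) / r k ^ 2) atTop
      (𝓝 (s ^ 2 * ((L : ℝ) / ((L : ℝ) + 2)))) := by
  set W := fun k => offset θ P X (S k) (Q k) (α k) (r k) with hWd
  set D := fun k => spread P X (S k) (Q k) (α k) (r k) with hDd
  have hbound : ∀ t : ℝ, 0 < t → ∀ k,
      |(∫ ω, ‖X ω - G k (Q k (X ω))‖ ^ 2 ∂P) / r k ^ 2 - s ^ 2 * D k|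
        ≤ t * D k + (1 + s ^ 2 / t) * (2 * τ k ^ 2 + 2 * W k) := by
    intro t ht k
    have hr := (hS.scale k).1
    have hr2 : 0 < r k ^ 2 := by positivity
    have i1 := integrable_norm_sq_sub_recon (P := P) (hQ k) hX (hS.central k) (hGb k)
    have i2 := integrable_norm_sq_comp (P := P) (hQ k) hX (exists_norm_diff_le (hα k))
    have i3 := integrable_norm_sq_comp (P := P) (hQ k) hX
      (G := fun c => (c : E L) - (S k).mid θ (α k) c) (exists_norm_sub_mid_le (hα k) θ)
    have hpt : ∀ ω, |‖X ω - G k (Q k (X ω))‖ ^ 2 - s ^ 2 * ‖(S k).diff (α k) (Q k (X ω))‖ ^ 2|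
        ≤ t * ‖(S k).diff (α k) (Q k (X ω))‖ ^ 2 + (1 + s ^ 2 / t) * (2 * (τ k * r k) ^ 2
          + 2 * ‖(Q k (X ω) : E L) - (S k).mid θ (α k) (Q k (X ω))‖ ^ 2) := by
      intro ω
      have e : X ω - G k (Q k (X ω)) = (X ω - (S k).mid θ (α k) (Q k (X ω)))
          + s • (S k).diff (α k) (Q k (X ω)) := by rw [hG]; abel
      rw [e]
      refine (abs_norm_add_smul_sq_sub_le _ _ s ht).trans ?_
      gcongr
      have e2 : X ω - (S k).mid θ (α k) (Q k (X ω)) = (X ω - Q k (X ω))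
        + ((Q k (X ω) : E L) - (S k).mid θ (α k) (Q k (X ω))) := by abel
      have h1 : ‖X ω - Q k (X ω)‖ ≤ τ k * r k :=
        (hS.central k).norm_sub_le ((hQ k).nearest _)
      have h2 := pow_le_pow_left₀ (norm_nonneg _) h1 2
      have h3 := norm_add_le (X ω - Q k (X ω))
        ((Q k (X ω) : E L) - (S k).mid θ (α k) (Q k (X ω)))
      rw [← e2] at h3
      have h4 := pow_le_pow_left₀ (norm_nonneg _) h3 2
      nlinarith [sq_nonneg (‖X ω - Q k (X ω)‖
        - ‖(Q k (X ω) : E L) - (S k).mid θ (α k) (Q k (X ω))‖)]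
    have i4 : Integrable (fun ω => t * ‖(S k).diff (α k) (Q k (X ω))‖ ^ 2 + (1 + s ^ 2 / t) *
        (2 * (τ k * r k) ^ 2
          + 2 * ‖(Q k (X ω) : E L) - (S k).mid θ (α k) (Q k (X ω))‖ ^ 2)) P :=
      (i2.const_mul t).add (((integrable_const _).add (i3.const_mul 2)).const_mul _)
    have h5 := integral_mono (μ := P) (i1.sub (i2.const_mul (s ^ 2))).abs i4 hpt
    have h6 := (abs_integral_le_integral_abs (μ := P) (f := fun ω => ‖X ω - G k (Q k (X ω))‖ ^ 2
      - s ^ 2 * ‖(S k).diff (α k) (Q k (X ω))‖ ^ 2)).trans h5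
    have i5 : Integrable (fun ω => 2 * (τ k * r k) ^ 2
          + 2 * ‖(Q k (X ω) : E L) - (S k).mid θ (α k) (Q k (X ω))‖ ^ 2) P :=
      (integrable_const _).add (i3.const_mul 2)
    rw [integral_sub i1 (i2.const_mul _), integral_const_mul,
      integral_add (i2.const_mul t) (i5.const_mul _), integral_const_mul, integral_const_mul,
      integral_add (integrable_const _) (i3.const_mul 2), integral_const_mul 2
        (fun ω => ‖(Q k (X ω) : E L) - (S k).mid θ (α k) (Q k (X ω))‖ ^ 2)] at h6
    simp only [integral_const, probReal_univ, smul_eq_mul, one_mul] at h6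
    have e3 : (∫ ω, ‖X ω - G k (Q k (X ω))‖ ^ 2 ∂P) / r k ^ 2 - s ^ 2 * D k
        = ((∫ ω, ‖X ω - G k (Q k (X ω))‖ ^ 2 ∂P)
          - s ^ 2 * ∫ ω, ‖(S k).diff (α k) (Q k (X ω))‖ ^ 2 ∂P) / r k ^ 2 := by
      simp only [hDd, spread]; ring
    rw [e3, abs_div, abs_of_pos hr2, div_le_iff₀ hr2]
    refine h6.trans (le_of_eq ?_)
    simp only [hDd, hWd, spread, offset]
    field_simp
  have hlt : (L : ℝ) / ((L : ℝ) + 2) < 1 := by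
    rw [div_lt_one (by positivity)]; linarith
  have hdiff : Tendsto (fun k => (∫ ω, ‖X ω - G k (Q k (X ω))‖ ^ 2 ∂P) / r k ^ 2 - s ^ 2 * D k)
      atTop (𝓝 0) := by
    rw [Metric.tendsto_nhds]
    intro ε hε
    have hz : Tendsto (fun k => (1 + s ^ 2 / (ε / 2)) * (2 * τ k ^ 2 + 2 * W k)) atTop
        (𝓝 ((1 + s ^ 2 / (ε / 2)) * (2 * 0 ^ 2 + 2 * 0))) :=
      (((hS.tendsto.pow 2).const_mul 2).add (hW.const_mul 2)).const_mul _
    filter_upwards [hD.eventually_lt_const hlt,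
      hz.eventually_lt_const (show _ < ε / 2 by simpa using hε)] with k h1 h2
    rw [Real.dist_eq, sub_zero]
    refine (hbound (ε / 2) (half_pos hε) k).trans_lt ?_
    have : ε / 2 * D k ≤ ε / 2 * 1 := by gcongr
    linarith
  have := hdiff.add (hD.const_mul (s ^ 2))
  simpa using this

end LatticeSystem

end MDC

end

/-! ### Discrete entropy and Gibbs' inequality -/

noncomputable section

namespace MDC

open scoped ENNReal

section Entropy

variable {Ω T : Type*} [MeasurableSpace Ω] {P : Measure Ω} [MeasurableSpace T]
  [MeasurableSingletonClass T] [Countable T]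

/-- The Shannon entropy in nats. -/
def natEntropy (P : Measure Ω) {T : Type*} (Y : Ω → T) : ℝ :=
  ∑' y : T, Real.negMulLog (P.real (Y ⁻¹' {y}))

theorem entropyBits_eq (P : Measure Ω) {T : Type*} (Y : Ω → T) :
    entropyBits P Y = natEntropy P Y / Real.log 2 := by
  rw [entropyBits, natEntropy, tsum_div_const]

theorem hasSum_integral_fiber {Y : Ω → T} (hY : Measurable Y) {g : Ω → ℝ} (hg : Integrable g P) :
    HasSum (fun t => ∫ ω in Y ⁻¹' {t}, g ω ∂P) (∫ ω, g ω ∂P) := by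
  have h := hasSum_integral_iUnion (μ := P) (f := g) (s := fun t => Y ⁻¹' {t})
    (fun t => hY (measurableSet_singleton t))
    (fun a b hab => Set.disjoint_left.2 fun ω h1 h2 => hab (h1.symm.trans h2)) hg.integrableOn
  have e : ⋃ t, Y ⁻¹' {t} = Set.univ := by
    ext ω; simp
  rw [e, setIntegral_univ] at h
  exact h

theorem hasSum_mul_of_integrable {Y : Ω → T} (hY : Measurable Y) {φ : T → ℝ}
    (hφ : Integrable (fun ω => φ (Y ω)) P) :
    HasSum (fun t => P.real (Y ⁻¹' {t}) * φ t) (∫ ω, φ (Y ω) ∂P) := by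
  refine (hasSum_integral_fiber hY hφ).congr_fun fun t => ?_
  rw [setIntegral_congr_fun (g := fun _ => φ t) (hY (measurableSet_singleton t))
    (fun ω hω => by rw [show Y ω = t from hω]), setIntegral_const, smul_eq_mul]

theorem integrable_of_summable_mul [IsFiniteMeasure P] {Y : Ω → T} (hY : Measurable Y) {φ : T → ℝ}
    (hφ0 : ∀ t, 0 ≤ φ t) (hφ : Summable fun t => P.real (Y ⁻¹' {t}) * φ t) :
    Integrable (fun ω => φ (Y ω)) P := by
  have hm : Measurable φ := measurable_of_countable φ
  refine ⟨(hm.comp hY).aestronglyMeasurable, ?_⟩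
  rw [hasFiniteIntegral_iff_ofReal (ae_of_all _ fun ω => hφ0 _)]
  rw [← lintegral_map (f := fun t => ENNReal.ofReal (φ t)) (measurable_of_countable _) hY,
    lintegral_countable']
  have e : ∀ t, ENNReal.ofReal (φ t) * P.map Y {t}
      = ENNReal.ofReal (P.real (Y ⁻¹' {t}) * φ t) := fun t => by
    rw [Measure.map_apply hY (measurableSet_singleton t), ENNReal.ofReal_mul measureReal_nonneg,
      Measure.real, ENNReal.ofReal_toReal (measure_ne_top _ _), mul_comm]
  simp_rw [e]
  rw [← ENNReal.ofReal_tsum_of_nonneg (fun t => mul_nonneg measureReal_nonneg (hφ0 t)) hφ]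
  exact ENNReal.ofReal_lt_top

theorem hasSum_prob [IsProbabilityMeasure P] {Y : Ω → T} (hY : Measurable Y) :
    HasSum (fun t => P.real (Y ⁻¹' {t})) 1 := by
  have := hasSum_mul_of_integrable (P := P) hY (φ := fun _ => 1) (integrable_const _)
  simpa using this

/-- This is `log t ≤ t - 1` at `t = r / p`. The term `r - p` is kept, so reference weights need not
be normalized. -/
theorem negMulLog_le_of_pos {p r : ℝ} (hp : 0 ≤ p) (hr0 : 0 ≤ r) (hr : p ≠ 0 → 0 < r) :
    Real.negMulLog p ≤ p * -Real.log r + (r - p) := by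
  rcases hp.eq_or_lt with rfl | hp
  · simpa using hr0
  · have hr' := hr hp.ne'
    have h := Real.log_le_sub_one_of_pos (div_pos hr' hp)
    rw [Real.log_div hr'.ne' hp.ne'] at h
    have h2 := mul_le_mul_of_nonneg_left h hp.le
    have h3 : p * (r / p - 1) = r - p := by field_simp
    rw [h3] at h2
    rw [Real.negMulLog]
    linarith

/-- Gibbs' inequality. -/
theorem natEntropy_le [IsProbabilityMeasure P] {Y : Ω → T} (hY : Measurable Y) {r : T → ℝ}
    (hr0 : ∀ t, 0 ≤ r t) (hr : ∀ t, P.real (Y ⁻¹' {t}) ≠ 0 → 0 < r t) (hrs : Summable r)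
    (hi : Integrable (fun ω => -Real.log (r (Y ω))) P) :
    (Summable fun t => Real.negMulLog (P.real (Y ⁻¹' {t}))) ∧
      natEntropy P Y ≤ ∫ ω, -Real.log (r (Y ω)) ∂P + (∑' t, r t - 1) := by
  have h1 := hasSum_mul_of_integrable (P := P) hY (φ := fun t => -Real.log (r t)) hi
  have h2 := h1.add (hrs.hasSum.sub (hasSum_prob (P := P) hY))
  have hle : ∀ t, Real.negMulLog (P.real (Y ⁻¹' {t}))
      ≤ P.real (Y ⁻¹' {t}) * -Real.log (r t) + (r t - P.real (Y ⁻¹' {t})) := fun t =>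
    negMulLog_le_of_pos measureReal_nonneg (hr0 t) (hr t)
  -- Summability belongs to the result: without it the `tsum` takes its default value `0` and says
  -- nothing about the entropy.
  have hs : Summable fun t => Real.negMulLog (P.real (Y ⁻¹' {t})) :=
    Summable.of_nonneg_of_le
      (fun t => Real.negMulLog_nonneg measureReal_nonneg measureReal_le_one) hle h2.summable
  refine ⟨hs, ?_⟩
  rw [← h2.tsum_eq]
  exact hs.tsum_le_tsum hle h2.summable

end Entropy

/-! ### Reference densities with controlled logarithm -/

section Reference

variable {L : ℕ}

theorem abs_log_one_add_sub_le {a b : ℝ} (ha : 0 ≤ a) (hb : 0 ≤ b) :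
    |Real.log (1 + a) - Real.log (1 + b)| ≤ |a - b| := by
  wlog h : b ≤ a generalizing a b
  · rw [abs_sub_comm, abs_sub_comm a b]
    exact this hb ha (le_of_not_ge h)
  have h1 : Real.log (1 + b) ≤ Real.log (1 + a) := Real.log_le_log (by linarith) (by linarith)
  rw [abs_of_nonneg (by linarith), abs_of_nonneg (by linarith),
    ← Real.log_div (by linarith) (by linarith)]
  refine (Real.log_le_sub_one_of_pos (by positivity)).trans ?_
  have h2 : (1 + a) / (1 + b) - 1 = (a - b) / (1 + b) := by field_simp; ring
  rw [h2]
  exact div_le_self (by linarith) (by linarith)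

/-- Clipping `q` clips `log q` to the interval `[-M, M]` around `0`, so its absolute value does not
grow. This gives the dominating function when the clip is removed. -/
theorem log_clip_abs_le {q : ℝ} (hq : 0 < q) {M : ℝ} (hM : 0 ≤ M) :
    |Real.log (max (Real.exp (-M)) (min (Real.exp M) q))| ≤ |Real.log q| ∧
    |Real.log (max (Real.exp (-M)) (min (Real.exp M) q))| ≤ M := by
  have h1 : Real.log (max (Real.exp (-M)) (min (Real.exp M) q))
      = max (-M) (min M (Real.log q)) := by
    have e1 : ∀ a b : ℝ, 0 < a → 0 < b → Real.log (max a b) = max (Real.log a) (Real.log b) :=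
      fun a b ha hb => by
        rcases le_total a b with h | h
        · rw [max_eq_right h, max_eq_right (Real.log_le_log ha h)]
        · rw [max_eq_left h, max_eq_left (Real.log_le_log hb h)]
    have e2 : ∀ a b : ℝ, 0 < a → 0 < b → Real.log (min a b) = min (Real.log a) (Real.log b) :=
      fun a b ha hb => by
        rcases le_total a b with h | h
        · rw [min_eq_left h, min_eq_left (Real.log_le_log ha h)]
        · rw [min_eq_right h, min_eq_right (Real.log_le_log hb h)]
    have := Real.exp_pos M
    rw [e1 _ _ (Real.exp_pos _) (lt_min this hq), e2 _ _ this hq, Real.log_exp, Real.log_exp]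
  rw [h1]
  constructor
  · rw [abs_le]
    constructor
    · refine le_max_of_le_right (le_min ?_ (neg_abs_le _))
      have := abs_nonneg (Real.log q)
      linarith
    · refine max_le ?_ ((min_le_right _ _).trans (le_abs_self _))
      have := abs_nonneg (Real.log q)
      linarith
  · rw [abs_le]
    exact ⟨le_max_left _ _, max_le (by linarith) (min_le_left _ _)⟩

/-- The weight `(1 + ‖x‖)^(-(L + 1))`. -/
def decay (L : ℕ) (x : E L) : ℝ := ((1 + ‖x‖) ^ (L + 1))⁻¹

theorem decay_pos (x : E L) : 0 < decay L x := by
  unfold decay; positivity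

theorem continuous_decay : Continuous (decay L) := by
  unfold decay
  refine Continuous.inv₀ (by fun_prop) fun x => by positivity

theorem integrable_decay : Integrable (decay L) := by
  have h := integrable_one_add_norm (E := E L) (μ := volume) (r := (L : ℝ) + 1) (by
    rw [finrank_euclideanSpace_fin]; linarith)
  refine h.congr (ae_of_all _ fun x => ?_)
  have h1 : (0 : ℝ) ≤ 1 + ‖x‖ := by positivity
  simp only [decay]
  rw [Real.rpow_neg h1]
  congr 1
  exact_mod_cast Real.rpow_natCast (1 + ‖x‖) (L + 1)

theorem log_decay (x : E L) : Real.log (decay L x) = -((L + 1 : ℕ) * Real.log (1 + ‖x‖)) := by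
  rw [decay, Real.log_inv, Real.log_pow]

theorem integrable_mul_log_decay {f : E L → ℝ} (hf : Measurable f) (hf0 : ∀ x, 0 ≤ f x)
    (hfm : Integrable fun x => f x * ‖x‖) :
    Integrable fun x => f x * Real.log (decay L x) := by
  refine (hfm.const_mul ((L + 1 : ℕ) : ℝ)).mono'
    (hf.mul (Real.measurable_log.comp continuous_decay.measurable)).aestronglyMeasurable
    (ae_of_all _ fun x => ?_)
  have h1 : 0 ≤ Real.log (1 + ‖x‖) := Real.log_nonneg (by linarith [norm_nonneg x])
  have h2 : Real.log (1 + ‖x‖) ≤ ‖x‖ := by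
    have := Real.log_le_sub_one_of_pos (show 0 < 1 + ‖x‖ by positivity)
    linarith
  rw [log_decay, Real.norm_eq_abs, abs_mul, abs_neg, abs_of_nonneg (hf0 x),
    abs_of_nonneg (by positivity)]
  have := hf0 x
  calc f x * ((L + 1 : ℕ) * Real.log (1 + ‖x‖)) ≤ f x * ((L + 1 : ℕ) * ‖x‖) := by gcongr
    _ = _ := by ring

/-- Reference log-densities: a density is approximated, in the sense of relative entropy, by
densities with uniformly continuous logarithm. -/
theorem exists_reference {f : E L → ℝ} (hf : Measurable f) (hf0 : ∀ x, 0 ≤ f x)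
    (hfi : Integrable f) (hf1 : ∫ x, f x = 1) (hfm : Integrable fun x => f x * ‖x‖)
    (hent : Integrable fun x => f x * Real.log (f x)) {η : ℝ} (hη : 0 < η) :
    ∃ u : E L → ℝ, Continuous u ∧ (∀ ε > 0, ∃ K ≥ 0, ∀ x y, |u x - u y| ≤ ε + K * ‖x - y‖) ∧
      Integrable (fun x => Real.exp (u x)) ∧ ∫ x, Real.exp (u x) ≤ 1 + η ∧
      Integrable (fun x => f x * u x) ∧
      (∫ x, f x * Real.log (f x)) - η ≤ ∫ x, f x * u x := by
  have hφ0 := decay_pos (L := L)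
  have hφi := integrable_decay (L := L)
  have hfd := integrable_mul_log_decay hf hf0 hfm
  have hdm : Measurable (decay L) := continuous_decay.measurable
  -- The density relative to a heavy-tailed integrable weight whose logarithm is Lipschitz. Only
  -- `log q` has to be clipped and smoothed, and its clip is bounded.
  let q : E L → ℝ := fun x => f x / decay L x
  have hqm : Measurable q := hf.div hdm
  let w : ℝ → E L → ℝ := fun M x => Real.log (max (Real.exp (-M)) (min (Real.exp M) (q x)))
  have hwm : ∀ M, Measurable (w M) := fun M =>
    Real.measurable_log.comp (measurable_const.max (measurable_const.min hqm))
  have hfq : ∀ x, f x * Real.log (q x) = f x * Real.log (f x) - f x * Real.log (decay L x) := by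
    intro x
    rcases (hf0 x).eq_or_lt with h | h
    · simp [← h]
    · simp only [q]
      rw [Real.log_div h.ne' (hφ0 x).ne']
      ring
  have hfqi : Integrable fun x => f x * Real.log (q x) := by
    simp_rw [hfq]; exact hent.sub hfd
  have hlim : Tendsto (fun n : ℕ => ∫ x, f x * w n x) atTop (𝓝 (∫ x, f x * Real.log (q x))) := by
    refine tendsto_integral_of_dominated_convergence (fun x => ‖f x * Real.log (q x)‖)
      (fun n => (hf.mul (hwm n)).aestronglyMeasurable) hfqi.norm (fun n => ae_of_all _ fun x => ?_)
      (ae_of_all _ fun x => ?_)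
    · rcases (hf0 x).eq_or_lt with h | h
      · simp [← h]
      · rw [norm_mul, norm_mul]
        gcongr
        exact (log_clip_abs_le (div_pos h (hφ0 x)) (Nat.cast_nonneg n)).1
    · rcases (hf0 x).eq_or_lt with h | h
      · simp [← h]
      · have hq : 0 < q x := div_pos h (hφ0 x)
        refine tendsto_const_nhds.congr' ?_
        have h1 := (tendsto_natCast_atTop_atTop (R := ℝ)).eventually_ge_atTop (|Real.log (q x)|)
        filter_upwards [h1] with n hn
        have h2 : q x ≤ Real.exp n := by
          rw [← Real.log_le_iff_le_exp hq]; exact (le_abs_self _).trans hn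
        have h3 : Real.exp (-n) ≤ q x := by
          rw [← Real.le_log_iff_exp_le hq]
          have := neg_abs_le (Real.log (q x)); linarith
        simp only [w]
        rw [min_eq_right h2, max_eq_right h3]
  have hexp : Tendsto (fun n : ℕ => Real.exp (-(n : ℝ)) * ∫ x, decay L x) atTop
      (𝓝 (0 * ∫ x, decay L x)) :=
    ((Real.tendsto_exp_neg_atTop_nhds_zero).comp tendsto_natCast_atTop_atTop).mul_const _
  rw [zero_mul] at hexp
  -- The level `n` must nearly preserve the integral of `f * log q`, and the lower clip must add
  -- little mass, `exp (-n)` times the total weight.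
  obtain ⟨n, hn1, hn2⟩ := ((hlim.eventually_const_lt
    (show (∫ x, f x * Real.log (q x)) - η / 2 < ∫ x, f x * Real.log (q x) by linarith)).and
    (hexp.eventually_lt_const (half_pos hη))).exists
  have hqc : ∀ x, |w n x| ≤ n := fun x => by
    rcases (div_nonneg (hf0 x) (hφ0 x).le).eq_or_lt with h | h
    · simp only [w, q]
      rw [← h, min_eq_right (Real.exp_pos _).le, max_eq_left (Real.exp_pos _).le, Real.log_exp]
      simp
    · exact (log_clip_abs_le h (Nat.cast_nonneg n)).2
  have hmass : ∀ x, Real.exp (w n x) * decay L x ≤ f x + Real.exp (-(n : ℝ)) * decay L x := by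
    intro x
    simp only [w]
    rw [Real.exp_log (lt_max_of_lt_left (Real.exp_pos _))]
    have h1 : max (Real.exp (-(n : ℝ))) (min (Real.exp n) (q x)) ≤ Real.exp (-(n : ℝ)) + q x := by
      refine max_le ?_ ((min_le_right _ _).trans ?_)
      · have : 0 ≤ q x := div_nonneg (hf0 x) (hφ0 x).le
        linarith
      · have := Real.exp_pos (-(n : ℝ)); linarith
    have h2 := mul_le_mul_of_nonneg_right h1 (hφ0 x).le
    have h3 : q x * decay L x = f x := div_mul_cancel₀ _ (hφ0 x).ne'
    rw [add_mul, h3] at h2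
    linarith
  -- approximate by a continuous function with compact support
  set ρ : E L → ℝ := fun x => f x + decay L x with hρ
  have hρ0 : ∀ x, 0 ≤ ρ x := fun x => add_nonneg (hf0 x) (hφ0 x).le
  have hρi : Integrable ρ := hfi.add hφi
  have hρm : Measurable ρ := hf.add hdm
  set ν : Measure (E L) := volume.withDensity fun x => ENNReal.ofReal (ρ x) with hν
  have : IsFiniteMeasure ν := by
    refine isFiniteMeasure_withDensity ?_
    exact ((hasFiniteIntegral_iff_ofReal (ae_of_all _ hρ0)).1 hρi.2).ne
  have hwν : Integrable (w n) ν :=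
    Integrable.of_bound (hwm n).aestronglyMeasurable n (ae_of_all _ fun x => hqc x)
  -- The second entry pays for the factor `exp n` that appears when `exp (ψ x)` is compared with
  -- `exp (w n x)`.
  set η' : ℝ := min (η / 2) (Real.exp (-(n : ℝ)) * (η / 2)) with hη'
  have hη'0 : 0 < η' := lt_min (half_pos hη) (mul_pos (Real.exp_pos _) (half_pos hη))
  obtain ⟨ψ₀, hψc, hψle, hψcont, hψint⟩ := hwν.exists_hasCompactSupport_integral_sub_le hη'0
  -- Clipping again restores the bound `n` and brings `ψ` no further from `w n`, which already lies
  -- in `[-n, n]`.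
  set ψ : E L → ℝ := fun x => max (-(n : ℝ)) (min n (ψ₀ x)) with hψ
  have hψcont' : Continuous ψ := continuous_const.max (continuous_const.min hψcont)
  have hψcs : HasCompactSupport ψ := by
    refine hψc.mono fun x hx => ?_
    contrapose hx
    have h0 : ψ₀ x = 0 := by simpa using hx
    simp [hψ, h0]
  have hψn : ∀ x, |ψ x| ≤ n := fun x => by
    rw [abs_le]
    exact ⟨le_max_left _ _, max_le (by have := Nat.cast_nonneg (α := ℝ) n; linarith)
      (min_le_left _ _)⟩
  have hclip : ∀ x, |w n x - ψ x| ≤ |w n x - ψ₀ x| := fun x => by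
    have h1 := abs_le.1 (hqc x)
    have e : w n x = max (-(n : ℝ)) (min n (w n x)) := by
      rw [min_eq_right h1.2, max_eq_right h1.1]
    calc |w n x - ψ x| = |max (-(n : ℝ)) (min n (w n x)) - max (-(n : ℝ)) (min n (ψ₀ x))| := by
          rw [← e]
      _ ≤ |min (n : ℝ) (w n x) - min (n : ℝ) (ψ₀ x)| := by
          have := abs_max_sub_max_le_max (-(n : ℝ)) (min n (w n x)) (-(n : ℝ)) (min n (ψ₀ x))
          simpa using this
      _ ≤ _ := by
          have := abs_min_sub_min_le_max (n : ℝ) (w n x) (n : ℝ) (ψ₀ x)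
          simpa using this
  have hdi : Integrable fun x => ρ x * |w n x - ψ x| := by
    refine (hρi.mul_const (2 * (n : ℝ))).mono'
      (hρm.mul ((hwm n).sub hψcont'.measurable).abs).aestronglyMeasurable (ae_of_all _ fun x => ?_)
    rw [Real.norm_eq_abs, abs_mul, abs_of_nonneg (hρ0 x), abs_abs]
    gcongr
    · exact hρ0 x
    · refine (abs_sub _ _).trans ?_
      linarith [hqc x, hψn x]
  have hd : ∫ x, ρ x * |w n x - ψ x| ≤ η' := by
    have h1 : ∫ x, |w n x - ψ x| ∂ν = ∫ x, ρ x * |w n x - ψ x| := by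
      rw [hν, integral_withDensity_eq_integral_toReal_smul hρm.ennreal_ofReal
        (ae_of_all _ fun x => ENNReal.ofReal_lt_top)]
      refine integral_congr_ae (ae_of_all _ fun x => ?_)
      simp [ENNReal.toReal_ofReal (hρ0 x)]
    rw [← h1]
    refine le_trans (integral_mono_of_nonneg (ae_of_all _ fun x => abs_nonneg _)
      (hwν.sub hψint).abs (ae_of_all _ fun x => hclip x)) ?_
    exact hψle
  have hi1 : Integrable fun x => f x * |w n x - ψ x| :=
    hdi.mono' (hf.mul ((hwm n).sub hψcont'.measurable).abs).aestronglyMeasurable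
      (ae_of_all _ fun x => by
        rw [Real.norm_eq_abs, abs_of_nonneg (mul_nonneg (hf0 x) (abs_nonneg _))]
        gcongr
        simp only [hρ]; linarith [hφ0 x])
  have hi2 : Integrable fun x => decay L x * |w n x - ψ x| :=
    hdi.mono' (hdm.mul ((hwm n).sub hψcont'.measurable).abs).aestronglyMeasurable
      (ae_of_all _ fun x => by
        rw [Real.norm_eq_abs, abs_of_nonneg (mul_nonneg (hφ0 x).le (abs_nonneg _))]
        gcongr
        simp only [hρ]; linarith [hf0 x])
  have hd1 : ∫ x, f x * |w n x - ψ x| ≤ η' := by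
    refine (integral_mono hi1 hdi fun x => ?_).trans hd
    have := hφ0 x
    simp only [hρ]
    gcongr
    linarith
  have hd2 : ∫ x, decay L x * |w n x - ψ x| ≤ η' := by
    refine (integral_mono hi2 hdi fun x => ?_).trans hd
    have := hf0 x
    simp only [hρ]
    gcongr
    linarith
  have hfψ : Integrable fun x => f x * ψ x := by
    refine (hfi.mul_const (n : ℝ)).mono' (hf.mul hψcont'.measurable).aestronglyMeasurable
      (ae_of_all _ fun x => ?_)
    rw [Real.norm_eq_abs, abs_mul, abs_of_nonneg (hf0 x)]
    exact mul_le_mul_of_nonneg_left (hψn x) (hf0 x)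
  have hfw : Integrable fun x => f x * w n x := by
    refine (hfi.mul_const (n : ℝ)).mono' (hf.mul (hwm n)).aestronglyMeasurable
      (ae_of_all _ fun x => ?_)
    rw [Real.norm_eq_abs, abs_mul, abs_of_nonneg (hf0 x)]
    exact mul_le_mul_of_nonneg_left (hqc x) (hf0 x)
  have hexpu : ∀ x, Real.exp (ψ x + Real.log (decay L x)) = Real.exp (ψ x) * decay L x := fun x => by
    rw [Real.exp_add, Real.exp_log (hφ0 x)]
  have hiu : Integrable fun x => Real.exp (ψ x) * decay L x := by
    refine (hφi.const_mul (Real.exp n)).mono'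
      ((Real.measurable_exp.comp hψcont'.measurable).mul hdm).aestronglyMeasurable
      (ae_of_all _ fun x => ?_)
    rw [Real.norm_eq_abs, abs_of_nonneg (mul_nonneg (Real.exp_pos _).le (hφ0 x).le)]
    have := hφ0 x
    gcongr
    exact (abs_le.1 (hψn x)).2
  refine ⟨fun x => ψ x + Real.log (decay L x), ?_, ?_, ?_, ?_, ?_, ?_⟩
  · exact hψcont'.add (continuous_decay.log fun x => (hφ0 x).ne')
  · intro ε hε
    have huc : UniformContinuous ψ :=
      hψcont'.uniformContinuous_of_tendsto_cocompact hψcs.is_zero_at_infty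
    obtain ⟨δ, hδ0, hδ⟩ := Metric.uniformContinuous_iff.1 huc ε hε
    -- Beyond distance `δ` the oscillation `2 * n` of `ψ` is absorbed linearly; `L + 1` is a
    -- Lipschitz constant of `log ∘ decay L`.
    refine ⟨2 * n / δ + (L + 1 : ℕ), by positivity, fun x y => ?_⟩
    have h1 : |ψ x - ψ y| ≤ ε + 2 * n / δ * ‖x - y‖ := by
      rcases lt_or_ge (dist x y) δ with h | h
      · have := (hδ h).le
        rw [Real.dist_eq] at this
        have : 0 ≤ 2 * (n : ℝ) / δ * ‖x - y‖ := by positivity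
        linarith
      · rw [dist_eq_norm] at h
        have h2 : |ψ x - ψ y| ≤ 2 * n := by
          refine (abs_sub _ _).trans ?_
          linarith [hψn x, hψn y]
        have h3 : 2 * (n : ℝ) / δ * δ ≤ 2 * (n : ℝ) / δ * ‖x - y‖ := by gcongr
        rw [div_mul_cancel₀ _ hδ0.ne'] at h3
        linarith
    have h2 : |Real.log (decay L x) - Real.log (decay L y)| ≤ (L + 1 : ℕ) * ‖x - y‖ := by
      have e : Real.log (decay L x) - Real.log (decay L y)
          = (L + 1 : ℕ) * (Real.log (1 + ‖y‖) - Real.log (1 + ‖x‖)) := by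
        rw [log_decay, log_decay]; ring
      rw [e, abs_mul, abs_of_nonneg (Nat.cast_nonneg _), ← norm_sub_rev y x]
      gcongr
      exact (abs_log_one_add_sub_le (norm_nonneg _) (norm_nonneg _)).trans
        (abs_norm_sub_norm_le _ _)
    have e : ψ x + Real.log (decay L x) - (ψ y + Real.log (decay L y))
        = (ψ x - ψ y) + (Real.log (decay L x) - Real.log (decay L y)) := by ring
    rw [e]
    refine (abs_add_le _ _).trans ?_
    rw [add_mul]
    linarith
  · simp_rw [hexpu]; exact hiu
  · simp_rw [hexpu]
    have hpt : ∀ x, Real.exp (ψ x) * decay L x ≤ f x + Real.exp (-(n : ℝ)) * decay L x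
        + Real.exp n * (decay L x * |w n x - ψ x|) := by
      intro x
      have h1 : Real.exp (ψ x) ≤ Real.exp (w n x) + Real.exp n * |w n x - ψ x| := by
        have h2 := Real.add_one_le_exp (w n x - ψ x)
        have h3 : Real.exp (ψ x) * Real.exp (w n x - ψ x) = Real.exp (w n x) := by
          rw [← Real.exp_add]; congr 1; ring
        have h4 := mul_le_mul_of_nonneg_left h2 (Real.exp_pos (ψ x)).le
        rw [h3] at h4
        have h5 : Real.exp (ψ x) ≤ Real.exp n := Real.exp_le_exp.2 (abs_le.1 (hψn x)).2
        have h6 : -|w n x - ψ x| ≤ w n x - ψ x := neg_abs_le _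
        have h7 := mul_le_mul_of_nonneg_left h6 (Real.exp_pos (ψ x)).le
        have h8 := mul_le_mul_of_nonneg_right h5 (abs_nonneg (w n x - ψ x))
        linarith
      have h2 := mul_le_mul_of_nonneg_right h1 (hφ0 x).le
      have h3 := hmass x
      linarith
    have hi3 : Integrable fun x => f x + Real.exp (-(n : ℝ)) * decay L x :=
      hfi.add (hφi.const_mul _)
    refine (integral_mono hiu (hi3.add (hi2.const_mul _)) hpt).trans ?_
    rw [integral_add' hi3 (hi2.const_mul _), integral_add hfi (hφi.const_mul _),
      integral_const_mul, integral_const_mul, hf1]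
    have h1 : Real.exp n * ∫ x, decay L x * |w n x - ψ x| ≤ η / 2 := by
      calc Real.exp n * ∫ x, decay L x * |w n x - ψ x|
          ≤ Real.exp n * (Real.exp (-(n : ℝ)) * (η / 2)) := by
            gcongr
            exact hd2.trans (min_le_right _ _)
        _ = η / 2 := by rw [← mul_assoc, ← Real.exp_add]; simp
    linarith
  · simp_rw [mul_add]; exact hfψ.add hfd
  · simp_rw [mul_add]
    rw [integral_add hfψ hfd]
    have h1 : ∫ x, f x * Real.log (q x)
        = (∫ x, f x * Real.log (f x)) - ∫ x, f x * Real.log (decay L x) := by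
      simp_rw [hfq]; exact integral_sub hent hfd
    have h2 : (∫ x, f x * w n x) - ∫ x, f x * ψ x ≤ η' := by
      rw [← integral_sub hfw hfψ]
      refine (integral_mono (hfw.sub hfψ) hi1 fun x => ?_).trans hd1
      simp only [Pi.sub_apply]
      rw [← mul_sub]
      exact mul_le_mul_of_nonneg_left (le_abs_self _) (hf0 x)
    have h3 : η' ≤ η / 2 := min_le_left _ _
    linarith

end Reference

end MDC

end

/-! ### Entropy bounds for lattice-valued descriptions -/

noncomputable section

namespace MDC

open scoped ENNReal

variable {L : ℕ}

section Bounds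

variable {Ω : Type*} [MeasurableSpace Ω] {P : Measure Ω}
  {X : Ω → E L} {f : E L → ℝ}

theorem summable_of_tsum_le_lintegral {ι : Type*} {F : ι → ℝ} (hF : ∀ a, 0 ≤ F a) {H : E L → ℝ}
    (hH : ∀ x, 0 ≤ H x) (hHi : Integrable H) {ν : ℝ} (hν : 0 < ν)
    (h : ENNReal.ofReal ν * ∑' a, ENNReal.ofReal (F a) ≤ ∫⁻ x, ENNReal.ofReal (H x)) :
    Summable F ∧ ν * ∑' a, F a ≤ ∫ x, H x := by
  rw [← ofReal_integral_eq_lintegral_ofReal hHi (ae_of_all _ hH)] at h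
  have hν' : ENNReal.ofReal ν ≠ 0 := by simpa using hν
  have hne : ∑' a, ENNReal.ofReal (F a) ≠ ∞ := by
    intro h'
    rw [h', ENNReal.mul_top hν'] at h
    exact absurd h (by simp)
  have hs : Summable F := by
    have := ENNReal.summable_toReal hne
    simpa [ENNReal.toReal_ofReal (hF _)] using this
  refine ⟨hs, ?_⟩
  rw [← ENNReal.ofReal_tsum_of_nonneg hF hs, ← ENNReal.ofReal_mul hν.le] at h
  exact (ENNReal.ofReal_le_ofReal_iff (integral_nonneg hH)).1 h

theorem integral_pos_of_pos {H : E L → ℝ} (hH : ∀ x, 0 < H x) (hHi : Integrable H) :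
    0 < ∫ x, H x := by
  rw [integral_pos_iff_support_of_nonneg (fun w => (hH w).le) hHi]
  have : Function.support H = Set.univ := Set.eq_univ_of_forall fun w => (hH w).ne'
  rw [this]
  exact Measure.measure_univ_pos.2 (NeZero.ne _)

theorem integrable_comp_density [IsProbabilityMeasure P] (hX : Measurable X) (hf : Measurable f)
    (hf0 : ∀ x, 0 ≤ f x)
    (hXf : P.map X = (volume : Measure (E L)).withDensity fun x => ENNReal.ofReal (f x))
    {u : E L → ℝ} (hu : Measurable u) :
    (Integrable (fun ω => u (X ω)) P ↔ Integrable fun x => f x * u x) ∧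
      ∫ ω, u (X ω) ∂P = ∫ x, f x * u x := by
  have e : ∀ x, (ENNReal.ofReal (f x)).toReal • u x = f x * u x := fun x => by
    rw [ENNReal.toReal_ofReal (hf0 x), smul_eq_mul]
  constructor
  · have h1 := integrable_map_measure (μ := P) hu.aestronglyMeasurable hX.aemeasurable
    rw [hXf, integrable_withDensity_iff_integrable_smul' hf.ennreal_ofReal
      (ae_of_all _ fun x => ENNReal.ofReal_lt_top)] at h1
    simp_rw [e] at h1
    exact h1.symm
  · rw [← integral_map hX.aemeasurable hu.aestronglyMeasurable, hXf,
      integral_withDensity_eq_integral_toReal_smul hf.ennreal_ofReal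
        (ae_of_all _ fun x => ENNReal.ofReal_lt_top)]
    simp_rw [e]

/-- Upper bound on the entropy of a lattice valued description of the source. -/
theorem IsLattice.natEntropy_le [IsProbabilityMeasure P] (hX : Measurable X) (hf : Measurable f)
    (hf0 : ∀ x, 0 ≤ f x)
    (hXf : P.map X = (volume : Measure (E L)).withDensity fun x => ENNReal.ofReal (f x))
    {u : E L → ℝ} (hu : Continuous u) (hui : Integrable fun x => Real.exp (u x))
    (hfu : Integrable fun x => f x * u x) {ε K : ℝ} (hK : 0 ≤ K)
    (huK : ∀ x y, |u x - u y| ≤ ε + K * ‖x - y‖)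
    {A : Submodule ℤ (E L)} (hA : IsLattice A) {δ : ℝ} (hδ : CoveringRadiusLE A δ)
    {T : Type*} [MeasurableSpace T] [MeasurableSingletonClass T] [Countable T]
    {ι : T → A} (hι : Function.Injective ι) {Y : Ω → T} (hY : Measurable Y)
    (hYi : Integrable (fun ω => ‖X ω - ι (Y ω)‖) P) :
    (Summable fun t => Real.negMulLog (P.real (Y ⁻¹' {t}))) ∧
      natEntropy P Y ≤ -Real.log (cellVol A) - (∫ x, f x * u x) + ε
        + K * (∫ ω, ‖X ω - ι (Y ω)‖ ∂P)
        + (Real.exp (ε + K * δ) * (∫ x, Real.exp (u x)) - 1) := by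
  have hν := hA.cellVol_pos
  have huX := integrable_comp_density (u := u) hX hf hf0 hXf hu.measurable
  -- The Gibbs weights will be `cellVol A * exp (u a)`, a Riemann sum of the reference density.
  -- Inside a cell `u` varies by at most `ε + K * δ`, which bounds their total mass.
  have hsum := summable_of_tsum_le_lintegral (F := fun a : A => Real.exp (u a))
    (H := fun x => Real.exp (ε + K * δ) * Real.exp (u x)) (fun a => (Real.exp_pos _).le)
    (fun x => by positivity) (hui.const_mul _) hν (by
      rw [← hA.cellVolE_eq]
      refine hA.mul_tsum_le_lintegral fun a x hx => ENNReal.ofReal_le_ofReal ?_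
      rw [← Real.exp_add]
      refine Real.exp_le_exp.2 ?_
      have h1 := (abs_le.1 (huK x a)).1
      have h2 := mul_le_mul_of_nonneg_left (hδ.norm_sub_le hx) hK
      linarith)
  rw [integral_const_mul] at hsum
  have hmY : Measurable fun ω => u (ι (Y ω)) :=
    (measurable_of_countable fun t => u (ι t)).comp hY
  have hlog : ∀ ω, -Real.log (cellVol A * Real.exp (u (ι (Y ω))))
      = -Real.log (cellVol A) - u (ι (Y ω)) := fun ω => by
    rw [Real.log_mul hν.ne' (Real.exp_pos _).ne', Real.log_exp]; ring
  have hbi : Integrable (fun ω => ε + K * ‖X ω - ι (Y ω)‖) P :=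
    (integrable_const _).add (hYi.const_mul _)
  have hdi : Integrable (fun ω => u (X ω) - u (ι (Y ω))) P :=
    hbi.mono' ((hu.measurable.comp hX).sub hmY).aestronglyMeasurable
      (ae_of_all _ fun ω => huK _ _)
  have hYu : Integrable (fun ω => u (ι (Y ω))) P := by
    have := (huX.1.2 hfu).sub hdi
    refine this.congr (ae_of_all _ fun ω => ?_)
    simp
  have hi : Integrable (fun ω => -Real.log (cellVol A * Real.exp (u (ι (Y ω))))) P := by
    simp_rw [hlog]; exact (integrable_const _).sub hYu
  obtain ⟨h1, h2⟩ := MDC.natEntropy_le (P := P) hY (r := fun t => cellVol A * Real.exp (u (ι t)))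
    (fun t => by positivity) (fun t _ => by positivity)
    ((hsum.1.comp_injective hι).mul_left _) hi
  refine ⟨h1, h2.trans ?_⟩
  simp_rw [hlog]
  rw [integral_sub (integrable_const _) hYu, tsum_mul_left]
  simp only [integral_const, probReal_univ, smul_eq_mul, one_mul]
  have h3 : ∑' t, Real.exp (u (ι t)) ≤ ∑' a : A, Real.exp (u a) :=
    tsum_comp_le_tsum_of_inj hsum.1 (fun a => (Real.exp_pos _).le) hι
  have h4 := (mul_le_mul_of_nonneg_left h3 hν.le).trans hsum.2
  have h5 := integral_mono hdi hbi fun ω => (le_abs_self _).trans (huK (X ω) (ι (Y ω)))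
  rw [integral_sub (huX.1.2 hfu) hYu, huX.2, integral_add (integrable_const _) (hYi.const_mul _),
    integral_const_mul] at h5
  simp only [integral_const, probReal_univ, smul_eq_mul, one_mul] at h5
  linarith

/-- The differential entropy is at most the entropy of the quantized source plus the logarithm of
the cell volume. -/
theorem IsLattice.integral_negMulLog_le [IsProbabilityMeasure P] (hX : Measurable X)
    (hf : Measurable f) (hf0 : ∀ x, 0 ≤ f x)
    (hXf : P.map X = (volume : Measure (E L)).withDensity fun x => ENNReal.ofReal (f x))
    (hent : Integrable fun x => f x * Real.log (f x))
    {A : Submodule ℤ (E L)} (hA : IsLattice A) {q : E L → A} (hq : Measurable q)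
    (hqn : ∀ x, x ∈ voronoi A (q x : E L))
    (hs : Summable fun c => Real.negMulLog (P.real ((fun ω => q (X ω)) ⁻¹' {c}))) :
    ∫ x, Real.negMulLog (f x) ≤ natEntropy P (fun ω => q (X ω)) + Real.log (cellVol A) := by
  have := hA.countable
  have hν := hA.cellVol_pos
  have hfi := integrable_density hX hf hf0 hXf
  have hni : Integrable fun x => Real.negMulLog (f x) := by
    refine hent.neg.congr (ae_of_all _ fun x => ?_)
    simp [Real.negMulLog]
  have hY : Measurable fun ω => q (X ω) := hq.comp hX
  have hp : ∀ c, P.real ((fun ω => q (X ω)) ⁻¹' {c}) = ∫ x in q ⁻¹' {c}, f x := fun c => by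
    have hm : MeasurableSet (q ⁻¹' {c}) := hq (measurableSet_singleton c)
    rw [Measure.real, show (fun ω => q (X ω)) ⁻¹' {c} = X ⁻¹' (q ⁻¹' {c}) from rfl,
      ← Measure.map_apply hX hm, hXf, withDensity_apply _ hm,
      integral_eq_lintegral_of_nonneg_ae (ae_of_all _ hf0) hf.aestronglyMeasurable]
  have hvol : ∀ c, volume (q ⁻¹' {c}) ≤ ENNReal.ofReal (cellVol A) := fun c => by
    rw [← hA.cellVolE_eq, cellVolE, ← volume_voronoi_eq c.2]
    refine measure_mono fun x hx => ?_
    have h := hqn x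
    rwa [show q x = c from hx] at h
  have hcell : ∀ c, ∫ x in q ⁻¹' {c}, Real.negMulLog (f x)
      ≤ Real.negMulLog (P.real ((fun ω => q (X ω)) ⁻¹' {c}))
        + P.real ((fun ω => q (X ω)) ⁻¹' {c}) * Real.log (cellVol A) := by
    intro c
    set p := P.real ((fun ω => q (X ω)) ⁻¹' {c}) with hpd
    have hp0 : 0 ≤ p := measureReal_nonneg
    have hfin : volume (q ⁻¹' {c}) ≠ ∞ := ((hvol c).trans_lt ENNReal.ofReal_lt_top).ne
    have hvr : volume.real (q ⁻¹' {c}) ≤ cellVol A :=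
      ENNReal.toReal_le_of_le_ofReal hν.le (hvol c)
    -- Gibbs' inequality on one cell, against the uniform density of the same mass. If the mass is
    -- zero, `f` vanishes almost everywhere on the cell.
    have hae : ∀ᵐ x ∂volume.restrict (q ⁻¹' {c}), Real.negMulLog (f x)
        ≤ f x * -Real.log (p / cellVol A) + (p / cellVol A - f x) := by
      rcases hp0.eq_or_lt with h | h
      · have h0 : ∫ x in q ⁻¹' {c}, f x = 0 := by rw [← hp, ← hpd, ← h]
        rw [integral_eq_zero_iff_of_nonneg hf0 hfi.integrableOn] at h0
        filter_upwards [h0] with x hx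
        rw [show f x = 0 from hx, ← h]
        simp
      · exact ae_of_all _ fun x =>
          negMulLog_le_of_pos (hf0 x) (by positivity) fun _ => by positivity
    have hci : IntegrableOn (fun _ : E L => p / cellVol A) (q ⁻¹' {c}) :=
      integrableOn_const hfin
    have hdi : IntegrableOn (fun x => p / cellVol A - f x) (q ⁻¹' {c}) := hci.sub hfi.integrableOn
    refine (integral_mono_ae hni.integrableOn ((hfi.integrableOn.mul_const _).add hdi) hae).trans ?_
    simp only [Pi.add_apply]
    rw [integral_add (hfi.integrableOn.mul_const _) hdi, integral_mul_const,
      integral_sub hci hfi.integrableOn, ← hp, ← hpd, setIntegral_const, smul_eq_mul]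
    have h1 : volume.real (q ⁻¹' {c}) * (p / cellVol A) ≤ p := by
      calc _ ≤ cellVol A * (p / cellVol A) := by gcongr
        _ = p := by field_simp
    have h2 : p * -Real.log (p / cellVol A) = Real.negMulLog p + p * Real.log (cellVol A) := by
      rcases hp0.eq_or_lt with h | h
      · simp [← h]
      · rw [Real.log_div h.ne' hν.ne', Real.negMulLog]; ring
    linarith
  have h1 := hasSum_integral_fiber (P := (volume : Measure (E L))) hq hni
  have h2 := hs.hasSum.add ((hasSum_prob (P := P) hY).mul_right (Real.log (cellVol A)))
  rw [one_mul] at h2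
  exact hasSum_le hcell h1 h2

/-- The entropy of a discrete variable that is determined by one description and by a point of a
lattice close to it. -/
theorem IsLattice.natEntropy_le_add [IsProbabilityMeasure P] {B : Submodule ℤ (E L)}
    (hB : IsLattice B) {δ : ℝ} (hδ : CoveringRadiusLE B δ)
    {C T : Type*} [MeasurableSpace C] [MeasurableSingletonClass C] [Countable C]
    [MeasurableSpace T] [MeasurableSingletonClass T] [Countable T]
    {a : C → T} {b : C → B} (hab : Function.Injective fun c => (a c, b c)) (x : T → E L)
    {Y : Ω → C} (hY : Measurable Y) {φ H : E L → ℝ}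
    (hH : ∀ w, 0 < H w) (hHi : Integrable H) (hφH : ∀ u w, ‖u - w‖ ≤ δ → Real.exp (-φ u) ≤ H w)
    (hs : Summable fun t => Real.negMulLog (P.real ((fun ω => a (Y ω)) ⁻¹' {t})))
    (hφi : Integrable (fun ω => φ (b (Y ω) - x (a (Y ω)))) P) :
    natEntropy P Y ≤ natEntropy P (fun ω => a (Y ω)) + Real.log ((∫ w, H w) / cellVol B)
      + ∫ ω, φ (b (Y ω) - x (a (Y ω))) ∂P := by
  have hν := hB.cellVol_pos
  have haY : Measurable fun ω => a (Y ω) := (measurable_of_countable a).comp hY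
  set p : T → ℝ := fun t => P.real ((fun ω => a (Y ω)) ⁻¹' {t}) with hp
  have hp0 : ∀ t, 0 ≤ p t := fun t => measureReal_nonneg
  have hp1 : ∀ t, p t ≤ 1 := fun t => measureReal_le_one
  set K := (∫ w, H w) / cellVol B with hK
  have hK0 : 0 < K := div_pos (integral_pos_of_pos hH hHi) hν
  -- A model for the pair: the first description has its true law, and given it the point of `B` has
  -- weight `exp (-φ)` around `x (a c)`. `K` bounds all the normalizers, so by injectivity of the
  -- pair the total mass is at most `1`.
  set r : C → ℝ := fun c => p (a c) * Real.exp (-φ (b c - x (a c))) / K with hr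
  have hr0 : ∀ c, 0 ≤ r c := fun c =>
    div_nonneg (mul_nonneg (hp0 _) (Real.exp_pos _).le) hK0.le
  have hle : ∀ c, P.real (Y ⁻¹' {c}) ≤ p (a c) := fun c => by
    refine measureReal_mono fun ω hω => ?_
    simp only [Set.mem_preimage, Set.mem_singleton_iff] at hω ⊢
    rw [hω]
  have hpos : ∀ c, P.real (Y ⁻¹' {c}) ≠ 0 → 0 < p (a c) := fun c hc =>
    (lt_of_le_of_ne measureReal_nonneg hc.symm).trans_le (hle c)
  have hrpos : ∀ c, P.real (Y ⁻¹' {c}) ≠ 0 → 0 < r c := fun c hc =>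
    div_pos (mul_pos (hpos c hc) (Real.exp_pos _)) hK0
  have hsumB : ∀ t, (Summable fun y : B => Real.exp (-φ (y - x t))) ∧
      ∑' y : B, Real.exp (-φ (y - x t)) ≤ K := by
    intro t
    obtain ⟨h1, h2⟩ := summable_of_tsum_le_lintegral (F := fun y : B => Real.exp (-φ (y - x t)))
      (fun y => (Real.exp_pos _).le) (fun w => (hH w).le) hHi hν (by
        rw [← hB.cellVolE_eq]
        exact hB.tsum_sub_le hδ (F := fun u => ENNReal.ofReal (Real.exp (-φ u)))
          (fun u w h => ENNReal.ofReal_le_ofReal (hφH u w h)) (x t))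
    refine ⟨h1, ?_⟩
    rw [hK, le_div_iff₀ hν, mul_comm]
    exact h2
  have hprob := hasSum_prob (P := P) haY
  have hprod : ∑' c, ENNReal.ofReal (r c) ≤ 1 := by
    let g : T × B → ℝ≥0∞ := fun z =>
      ENNReal.ofReal (p z.1 / K) * ENNReal.ofReal (Real.exp (-φ (z.2 - x z.1)))
    have e : ∀ c, ENNReal.ofReal (r c) = g (a c, b c) := fun c => by
      simp only [g, hr]
      rw [← ENNReal.ofReal_mul (div_nonneg (hp0 _) hK0.le)]
      congr 1
      ring
    simp_rw [e]
    refine (ENNReal.tsum_comp_le_tsum_of_injective hab g).trans ?_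
    rw [ENNReal.tsum_prod']
    simp only [g]
    simp_rw [ENNReal.tsum_mul_left]
    calc ∑' t, ENNReal.ofReal (p t / K) * ∑' y : B, ENNReal.ofReal (Real.exp (-φ (y - x t)))
        ≤ ∑' t, ENNReal.ofReal (p t) := by
          refine ENNReal.tsum_le_tsum fun t => ?_
          rw [← ENNReal.ofReal_tsum_of_nonneg (fun y => (Real.exp_pos _).le) (hsumB t).1,
            ← ENNReal.ofReal_mul (div_nonneg (hp0 _) hK0.le)]
          refine ENNReal.ofReal_le_ofReal ?_
          rw [div_mul_eq_mul_div, div_le_iff₀ hK0]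
          exact mul_le_mul_of_nonneg_left (hsumB t).2 (hp0 t)
      _ = 1 := by
          rw [← ENNReal.ofReal_tsum_of_nonneg hp0 hprob.summable, hprob.tsum_eq, ENNReal.ofReal_one]
  have hrs : Summable r := by
    have := ENNReal.summable_toReal (hprod.trans_lt ENNReal.one_lt_top).ne
    simpa [ENNReal.toReal_ofReal (hr0 _)] using this
  have hr1 : ∑' c, r c ≤ 1 := by
    rw [← ENNReal.ofReal_tsum_of_nonneg hr0 hrs] at hprod
    exact ENNReal.ofReal_le_one.1 hprod
  have hpl : ∀ t, p t * -Real.log (p t) = Real.negMulLog (p t) := fun t => by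
    rw [Real.negMulLog]; ring
  have hlogi : Integrable (fun ω => -Real.log (p (a (Y ω)))) P :=
    integrable_of_summable_mul haY (φ := fun t => -Real.log (p t))
      (fun t => neg_nonneg.2 (Real.log_nonpos (hp0 t) (hp1 t)))
      (hs.congr fun t => (hpl t).symm)
  have hlogv : ∫ ω, -Real.log (p (a (Y ω))) ∂P = natEntropy P fun ω => a (Y ω) := by
    rw [← (hasSum_mul_of_integrable haY (φ := fun t => -Real.log (p t)) hlogi).tsum_eq, natEntropy]
    exact tsum_congr hpl
  -- Only almost everywhere: the logarithm of the product splits only where the factor `p` is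
  -- nonzero.
  have hae : ∀ᵐ ω ∂P, -Real.log (r (Y ω))
      = -Real.log (p (a (Y ω))) + Real.log K + φ (b (Y ω) - x (a (Y ω))) := by
    have h0 : ∀ᵐ ω ∂P, P.real (Y ⁻¹' {Y ω}) ≠ 0 := by
      have : ∀ c, ∀ᵐ ω ∂P, P.real (Y ⁻¹' {c}) = 0 → Y ω ≠ c := fun c => by
        by_cases hc : P.real (Y ⁻¹' {c}) = 0
        · have h1 : P (Y ⁻¹' {c}) = 0 := by
            rwa [measureReal_eq_zero_iff] at hc
          filter_upwards [measure_eq_zero_iff_ae_notMem.1 h1] with ω hω _ h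
          exact hω h
        · exact ae_of_all _ fun ω h => absurd h hc
      filter_upwards [ae_all_iff.2 this] with ω hω h
      exact hω _ h rfl
    filter_upwards [h0] with ω hω
    have h1 := hpos _ hω
    simp only [hr]
    rw [Real.log_div (mul_pos h1 (Real.exp_pos _)).ne' hK0.ne',
      Real.log_mul h1.ne' (Real.exp_pos _).ne', Real.log_exp]
    ring
  have hi1 : Integrable (fun ω => -Real.log (p (a (Y ω))) + Real.log K) P :=
    hlogi.add (integrable_const _)
  have hi : Integrable (fun ω => -Real.log (r (Y ω))) P :=
    (hi1.add hφi).congr (hae.mono fun ω h => h.symm)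
  have h1 := (MDC.natEntropy_le hY hr0 hrpos hrs hi).2
  rw [integral_congr_ae hae, integral_add hi1 hφi, integral_add hlogi (integrable_const _), hlogv]
    at h1
  simp only [integral_const, probReal_univ, smul_eq_mul, one_mul] at h1
  linarith

end Bounds

/-! ### The smoothed indicator of a ball -/

section Tent

/-- The integral of a function that is `1` on the unit ball and decays exponentially outside it. -/
def ballTail (L : ℕ) (s : ℝ) : ℝ := ∫ x : E L, Real.exp (-(s * max 0 (‖x‖ - 1)))

theorem integrable_ballTail {s : ℝ} (hs : 1 ≤ s) :
    Integrable fun x : E L => Real.exp (-(s * max 0 (‖x‖ - 1))) := by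
  have hc : Continuous fun x : E L => Real.exp (-(s * max 0 (‖x‖ - 1))) := by fun_prop
  refine (integrable_decay.const_mul (Real.exp 2 * (L + 1).factorial)).mono'
    hc.aestronglyMeasurable (ae_of_all _ fun x => ?_)
  rw [Real.norm_of_nonneg (Real.exp_pos _).le, decay, ← div_eq_mul_inv,
    le_div_iff₀ (by positivity)]
  have h1 := Real.pow_div_factorial_le_exp (1 + ‖x‖) (by positivity) (L + 1)
  rw [div_le_iff₀ (by positivity)] at h1
  have h2 : Real.exp (-(s * max 0 (‖x‖ - 1))) ≤ Real.exp (1 - ‖x‖) := by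
    refine Real.exp_le_exp.2 ?_
    have h3 : 0 ≤ max 0 (‖x‖ - 1) := le_max_left _ _
    have h4 : ‖x‖ - 1 ≤ max 0 (‖x‖ - 1) := le_max_right _ _
    nlinarith
  calc Real.exp (-(s * max 0 (‖x‖ - 1))) * (1 + ‖x‖) ^ (L + 1)
      ≤ Real.exp (1 - ‖x‖) * (Real.exp (1 + ‖x‖) * (L + 1).factorial) := by gcongr
    _ = _ := by
      rw [← mul_assoc, ← Real.exp_add]
      ring_nf

/-- The integrand is `1` on the closed unit ball and decays to `0` off it as the slope grows; slope
`1` dominates. -/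
theorem tendsto_ballTail : Tendsto (fun n : ℕ => ballTail L n) atTop (𝓝 (ballVol L)) := by
  have hb : ballVol L = ∫ x : E L, (Metric.closedBall (0 : E L) 1).indicator (fun _ => (1 : ℝ)) x := by
    rw [integral_indicator measurableSet_closedBall, setIntegral_const, smul_eq_mul, mul_one,
      volume_real_closedBall _ zero_le_one, one_pow, mul_one]
  rw [hb]
  refine tendsto_integral_filter_of_dominated_convergence
    (fun x => Real.exp (-(1 * max 0 (‖x‖ - 1)))) (Eventually.of_forall fun n => ?_) ?_
    (integrable_ballTail le_rfl) (ae_of_all _ fun x => ?_)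
  · exact Continuous.aestronglyMeasurable (by fun_prop)
  · filter_upwards [eventually_ge_atTop 1] with n hn
    refine ae_of_all _ fun x => ?_
    rw [Real.norm_of_nonneg (Real.exp_pos _).le]
    have : (1 : ℝ) ≤ n := by exact_mod_cast hn
    have h3 : 0 ≤ max 0 (‖x‖ - 1) := le_max_left _ _
    gcongr
  · by_cases hx : ‖x‖ ≤ 1
    · rw [Set.indicator_of_mem (mem_closedBall_zero_iff.2 hx), max_eq_left (by linarith)]
      simp
    · rw [Set.indicator_of_notMem (fun h => hx (mem_closedBall_zero_iff.1 h)),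
        max_eq_right (by linarith)]
      push Not at hx
      exact Real.tendsto_exp_neg_atTop_nhds_zero.comp
        (tendsto_natCast_atTop_atTop.atTop_mul_const (sub_pos.2 hx))

theorem integral_ballTail_div {r : ℝ} (hr : 0 < r) (s : ℝ) :
    ∫ x : E L, Real.exp (-(s * max 0 (‖x‖ / r - 1))) = r ^ L * ballTail L s := by
  have h := Measure.integral_comp_inv_smul (volume : Measure (E L))
    (fun x : E L => Real.exp (-(s * max 0 (‖x‖ - 1)))) r
  rw [finrank_euclideanSpace_fin, abs_of_pos (pow_pos hr L), smul_eq_mul] at h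
  rw [ballTail, ← h]
  refine integral_congr_ae (ae_of_all _ fun x => ?_)
  simp only
  rw [norm_smul, norm_inv, Real.norm_of_nonneg hr.le, div_eq_inv_mul]

theorem integrable_ballTail_div {r : ℝ} (hr : 0 < r) {s : ℝ} (hs : 1 ≤ s) :
    Integrable fun x : E L => Real.exp (-(s * max 0 (‖x‖ / r - 1))) := by
  refine ((integrable_ballTail (L := L) hs).comp_smul (inv_ne_zero hr.ne')).congr
    (ae_of_all _ fun x => ?_)
  simp only
  rw [norm_smul, norm_inv, Real.norm_of_nonneg hr.le, div_eq_inv_mul]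

end Tent

end MDC

end

/-! ### Asymptotics of the rates -/

noncomputable section

namespace MDC

namespace LatticeSystem

variable {L : ℕ} {μ : Fin 2 → ℝ} {Ω : Type*} [MeasurableSpace Ω] {P : Measure Ω}
  {X : Ω → E L} {f : E L → ℝ}

theorem integrable_excess [IsFiniteMeasure P] {S : LatticeSystem L μ} {Q : E L → S.central}
    (hQ : S.IsQuantizer Q) (hX : Measurable X) {α : S.Label} (hα : S.IsLabeling α) (r : ℝ) :
    Integrable (fun ω => max 0 (‖S.diff α (Q (X ω))‖ ^ 2 - r ^ 2)) P := by
  obtain ⟨B, hB⟩ := exists_norm_diff_le hα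
  refine hQ.integrable_comp hX (G := fun c => max 0 (‖S.diff α c‖ ^ 2 - r ^ 2)) (B := B ^ 2)
    fun c => ?_
  rw [abs_of_nonneg (le_max_left _ _)]
  have h1 := pow_le_pow_left₀ (norm_nonneg _) (hB c) 2
  exact max_le (by positivity) (by nlinarith [sq_nonneg r])

/-- The central entropy is bounded by one side entropy and the volume of the other side. -/
theorem natEntropy_central_le [IsProbabilityMeasure P] (hL : 1 ≤ L) (hμ : ∀ i, 0 < μ i)
    (hX : Measurable X) {S : LatticeSystem L μ} {Q : E L → S.central} (hQ : S.IsQuantizer Q)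
    {α : S.Label} (hα : S.IsLabeling α) {r τ s : ℝ} (hr : S.IsScale r) (hs : 1 ≤ s)
    {i j : Fin 2} (hij : i ≠ j) (hτ : CoveringRadiusLE (S.wside j) (τ * r))
    (hsum : Summable fun t => Real.negMulLog (P.real ((fun ω => α (Q (X ω)) i) ⁻¹' {t}))) :
    natEntropy P (fun ω => Q (X ω)) ≤ natEntropy P (fun ω => α (Q (X ω)) i)
      + (s * τ + Real.log (ballTail L s / ballVol L) + Real.log (cellVol (S.wside i))
        - Real.log (cellVol S.central))
      + s * ((∫ ω, max 0 (‖S.diff α (Q (X ω))‖ ^ 2 - r ^ 2) ∂P) / r ^ 2) := by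
  have hr0 := hr.1
  have := S.isLattice_central.countable
  have := (S.isLattice_side i).countable
  have hdiff : ∀ c, ‖(wlabel hμ α j c : E L) - linScale L (μ i) • (α c i : E L)‖
      = ‖S.diff α c‖ := by
    intro c
    rw [coe_wlabel, diff]
    fin_cases i <;> fin_cases j <;> first | exact absurd rfl hij | rfl | exact norm_sub_rev _ _
  have hinj : Function.Injective fun c => (α c i, wlabel hμ α j c) := by
    intro c c' h
    refine wlabel_injective hμ hα ?_
    have h0 : α c i = α c' i := congrArg Prod.fst h
    have h1 : wlabel hμ α i c = wlabel hμ α i c' := by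
      refine Subtype.ext ?_
      rw [coe_wlabel, coe_wlabel, recon, recon, h0]
    have h2 : wlabel hμ α j c = wlabel hμ α j c' := congrArg Prod.snd h
    fin_cases i <;> fin_cases j <;>
      first | exact absurd rfl hij | exact Prod.ext h1 h2 | exact Prod.ext h2 h1
  have hex := integrable_excess (P := P) hQ hX hα r
  -- With `t = ‖d‖ / r`, this is `t - 1 ≤ t ^ 2 - 1` for `t ≥ 1`.
  have hpt : ∀ c, max 0 (‖S.diff α c‖ / r - 1) ≤ max 0 (‖S.diff α c‖ ^ 2 - r ^ 2) / r ^ 2 := by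
    intro c
    rw [le_div_iff₀ (by positivity)]
    rcases le_total (‖S.diff α c‖) r with h | h
    · rw [max_eq_left (by rw [sub_nonpos, div_le_one hr0]; exact h), zero_mul]
      exact le_max_left _ _
    · rw [max_eq_right (by rw [sub_nonneg, one_le_div hr0]; exact h)]
      refine le_max_of_le_right ?_
      have e : (‖S.diff α c‖ / r - 1) * r ^ 2 = ‖S.diff α c‖ * r - r ^ 2 := by
        field_simp
      rw [e]
      nlinarith
  have hφm : Measurable fun ω => s * max 0 (‖S.diff α (Q (X ω))‖ / r - 1) :=
    hQ.measurable_comp hX fun c => s * max 0 (‖S.diff α c‖ / r - 1)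
  have hφi : Integrable (fun ω => s * max 0 (‖S.diff α (Q (X ω))‖ / r - 1)) P := by
    refine ((hex.div_const (r ^ 2)).const_mul s).mono' hφm.aestronglyMeasurable
      (ae_of_all _ fun ω => ?_)
    rw [Real.norm_of_nonneg (mul_nonneg (by linarith) (le_max_left _ _))]
    exact mul_le_mul_of_nonneg_left (hpt _) (by linarith)
  -- The penalty vanishes up to length `r` and has slope `s / r` beyond. For large `s` its
  -- exponential weight integrates to nearly the volume of the ball, while its mean is at most `s`
  -- times the normalized excess.
  have key := (isLattice_wside hμ j).natEntropy_le_add (P := P) hτ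
    (a := fun c => α c i) (b := wlabel hμ α j) hinj
    (fun t => linScale L (μ i) • (t : E L)) (Y := fun ω => Q (X ω)) (hQ.measurable.comp hX)
    (φ := fun u => s * max 0 (‖u‖ / r - 1))
    (H := fun w => Real.exp (s * τ) * Real.exp (-(s * max 0 (‖w‖ / r - 1))))
    (fun w => by positivity) ((integrable_ballTail_div hr0 hs).const_mul _)
    (fun u w huw => by
      rw [← Real.exp_add]
      refine Real.exp_le_exp.2 ?_
      have h1 : ‖w‖ / r ≤ ‖u‖ / r + τ := by
        rw [div_add' _ _ _ hr0.ne']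
        gcongr
        have := norm_sub_norm_le w u
        rw [norm_sub_rev] at this
        linarith
      have hτ0 : 0 ≤ τ := nonneg_of_mul_nonneg_left hτ.nonneg hr0
      have h2 : max 0 (‖w‖ / r - 1) ≤ max 0 (‖u‖ / r - 1) + τ :=
        max_le (add_nonneg (le_max_left _ _) hτ0)
          (by linarith [le_max_right 0 (‖u‖ / r - 1)])
      nlinarith)
    hsum (by simpa only [hdiff] using hφi)
  simp only [hdiff] at key
  have hJ : 0 < ballTail L s := integral_pos_of_pos (fun _ => Real.exp_pos _) (integrable_ballTail hs)
  have hb := ballVol_pos hL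
  have hνc := S.isLattice_central.cellVol_pos
  have hν0 := (isLattice_wside (S := S) hμ 0).cellVol_pos
  have hν1 := (isLattice_wside (S := S) hμ 1).cellVol_pos
  have hrL : 0 < r ^ L := pow_pos hr0 L
  -- By the choice of `r`, the ball volume divided by the cell volume of side `j` equals that of
  -- side `i` divided by the central one.
  have hlog := congrArg Real.log hr.2
  rw [Real.log_mul (by positivity) hνc.ne', Real.log_mul hb.ne' hrL.ne',
    Real.log_mul hν0.ne' hν1.ne'] at hlog
  have hsumlog : Real.log (cellVol (S.wside 0)) + Real.log (cellVol (S.wside 1))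
      = Real.log (cellVol (S.wside i)) + Real.log (cellVol (S.wside j)) := by
    fin_cases i <;> fin_cases j <;>
      first | exact absurd rfl hij | rfl | exact add_comm _ _
  have hνj := (isLattice_wside (S := S) hμ j).cellVol_pos
  rw [integral_const_mul, integral_ballTail_div hr0, Real.log_div (by positivity) hνj.ne',
    Real.log_mul (by positivity) (by positivity), Real.log_mul hrL.ne' hJ.ne', Real.log_exp,
    integral_const_mul] at key
  rw [Real.log_div hJ.ne' hb.ne']
  have hint : ∫ ω, max 0 (‖S.diff α (Q (X ω))‖ / r - 1) ∂P
      ≤ (∫ ω, max 0 (‖S.diff α (Q (X ω))‖ ^ 2 - r ^ 2) ∂P) / r ^ 2 := by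
    rw [← integral_div]
    exact integral_mono_of_nonneg (ae_of_all _ fun ω => le_max_left _ _)
      (hex.div_const _) (ae_of_all _ fun ω => hpt _)
  have hint2 := mul_le_mul_of_nonneg_left hint (show 0 ≤ s by linarith)
  linarith

variable [IsProbabilityMeasure P]

theorem integrable_norm_sub {S : LatticeSystem L μ} {Q : E L → S.central} (hQ : S.IsQuantizer Q)
    (hX : Measurable X) {δ : ℝ} (hδ : CoveringRadiusLE S.central δ) {G : S.central → E L}
    (hG : ∃ B : ℝ, ∀ c : S.central, ‖(c : E L) - G c‖ ≤ B) :
    Integrable (fun ω => ‖X ω - G (Q (X ω))‖) P := by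
  have h := integrable_norm_sq_sub_recon (P := P) hQ hX hδ hG
  refine ((integrable_const 1).add h).mono'
    (hX.sub (hQ.measurable_comp hX G)).norm.aestronglyMeasurable (ae_of_all _ fun ω => ?_)
  rw [norm_norm, Pi.add_apply]
  nlinarith [sq_nonneg (‖X ω - G (Q (X ω))‖ - 1)]

/-- The mean distance vanishes when the mean square distance is of the order of `r ^ 2`. -/
theorem tendsto_integral_norm {Y : ℕ → Ω → E L} {r : ℕ → ℝ} (hr0 : ∀ k, 0 < r k)
    (hr : Tendsto r atTop (𝓝 0)) (hY1 : ∀ k, Integrable (fun ω => ‖Y k ω‖) P)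
    (hY2 : ∀ k, Integrable (fun ω => ‖Y k ω‖ ^ 2) P) {b : ℝ}
    (h : Tendsto (fun k => (∫ ω, ‖Y k ω‖ ^ 2 ∂P) / r k ^ 2) atTop (𝓝 b)) :
    Tendsto (fun k => ∫ ω, ‖Y k ω‖ ∂P) atTop (𝓝 0) := by
  have hlim : Tendsto (fun k => r k * (1 + (∫ ω, ‖Y k ω‖ ^ 2 ∂P) / r k ^ 2)) atTop
      (𝓝 (0 * (1 + b))) := hr.mul (h.const_add 1)
  rw [zero_mul] at hlim
  refine squeeze_zero (fun k => integral_nonneg fun ω => norm_nonneg _) (fun k => ?_) hlim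
  have hk := hr0 k
  have h1 : ∀ ω, ‖Y k ω‖ ≤ r k + ‖Y k ω‖ ^ 2 / r k := fun ω => by
    rw [← sub_nonneg]
    have e : r k + ‖Y k ω‖ ^ 2 / r k - ‖Y k ω‖
        = ((r k - ‖Y k ω‖) ^ 2 + r k * ‖Y k ω‖) / r k := by field_simp; ring
    rw [e]
    positivity
  refine (integral_mono (hY1 k) ((integrable_const (r k)).add ((hY2 k).div_const (r k))) h1).trans
    (le_of_eq ?_)
  simp only [Pi.add_apply]
  rw [integral_add (integrable_const _) ((hY2 k).div_const _), integral_div]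
  simp only [integral_const, probReal_univ, smul_eq_mul, one_mul]
  field_simp

variable {S : ℕ → LatticeSystem L μ} {r τ ρ : ℕ → ℝ} {Q : (k : ℕ) → E L → (S k).central}

/-- The side entropies are asymptotically at most those of fine quantizations of the source. -/
theorem IsFine.eventually_natEntropy_side_le (hS : IsFine S r τ ρ) (hμ : ∀ i, 0 < μ i)
    (hr : Tendsto r atTop (𝓝 0)) (hX : Measurable X) (hf : Measurable f) (hf0 : ∀ x, 0 ≤ f x)
    (hXf : P.map X = (volume : Measure (E L)).withDensity fun x => ENNReal.ofReal (f x))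
    (hfm : Integrable fun x => f x * ‖x‖) (hent : Integrable fun x => f x * Real.log (f x))
    (hQ : ∀ k, (S k).IsQuantizer (Q k)) {α : (k : ℕ) → (S k).Label}
    (hα : ∀ k, (S k).IsLabeling (α k)) (i : Fin 2)
    (hm : Tendsto (fun k => ∫ ω, ‖X ω - (S k).recon (α k) i (Q k (X ω))‖ ∂P) atTop (𝓝 0))
    {e : ℝ} (he : 0 < e) :
    (∀ k, Summable fun t => Real.negMulLog (P.real ((fun ω => α k (Q k (X ω)) i) ⁻¹' {t}))) ∧
    ∀ᶠ k in atTop, natEntropy P (fun ω => α k (Q k (X ω)) i)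
      ≤ (∫ x, Real.negMulLog (f x)) - Real.log (cellVol ((S k).wside i)) + e := by
  have hfi := integrable_density hX hf hf0 hXf
  have hf1 : ∫ x, f x = 1 := by
    rw [integral_eq_lintegral_of_nonneg_ae (ae_of_all _ hf0) hf.aestronglyMeasurable,
      lintegral_density hX hf hXf, ENNReal.toReal_one]
  -- Error budget: one `t` from the modulus of `u`, one from replacing `log f` by `u`, and the rest
  -- from the excess mass of the Gibbs weights.
  obtain ⟨t, ht0, ht⟩ : ∃ t : ℝ, 0 < t ∧ t + t + (Real.exp t * (1 + t) - 1) < e := by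
    have hc : Tendsto (fun t : ℝ => t + t + (Real.exp t * (1 + t) - 1)) (𝓝[>] 0)
        (𝓝 (0 + 0 + (Real.exp 0 * (1 + 0) - 1))) := by
      have : Continuous fun t : ℝ => t + t + (Real.exp t * (1 + t) - 1) := by fun_prop
      exact (this.tendsto 0).mono_left nhdsWithin_le_nhds
    obtain ⟨t, h1, h2⟩ := ((hc.eventually_lt_const (show _ < e by simpa using he)).and
      self_mem_nhdsWithin).exists
    exact ⟨t, h2, h1⟩
  obtain ⟨u, hu, huK, hui, hu1, hfu, hfu1⟩ := exists_reference hf hf0 hfi hf1 hfm hent ht0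
  obtain ⟨K, hK, huK⟩ := huK t ht0
  have hneg : ∫ x, Real.negMulLog (f x) = -∫ x, f x * Real.log (f x) := by
    rw [← integral_neg]
    refine integral_congr_ae (ae_of_all _ fun x => ?_)
    simp only [Real.negMulLog]; ring
  have key : ∀ k, (Summable fun t => Real.negMulLog
      (P.real ((fun ω => α k (Q k (X ω)) i) ⁻¹' {t}))) ∧
      natEntropy P (fun ω => α k (Q k (X ω)) i) ≤ -Real.log (cellVol ((S k).wside i))
        - (∫ x, f x * u x) + t
        + K * (∫ ω, ‖X ω - (S k).recon (α k) i (Q k (X ω))‖ ∂P)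
        + (Real.exp (t + K * (τ k * r k)) * (∫ x, Real.exp (u x)) - 1) := by
    intro k
    have := ((S k).isLattice_side i).countable
    let ι : (S k).side i → (S k).wside i := fun y =>
      ⟨linScale L (μ i) • (y : E L), (smul_mem_scaled (linScale_pos L (hμ i)).ne').2 y.2⟩
    have hι : Function.Injective ι := fun y y' h =>
      Subtype.ext (smul_right_injective (E L) (linScale_pos L (hμ i)).ne' (congrArg Subtype.val h))
    have hY : Measurable fun ω => α k (Q k (X ω)) i := (hQ k).measurable_comp hX fun c => α k c i
    have hYi : Integrable (fun ω => ‖X ω - ι (α k (Q k (X ω)) i)‖) P :=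
      integrable_norm_sub (G := (S k).recon (α k) i) (hQ k) hX (hS.central k)
        (exists_norm_sub_recon_le (hα k) i)
    have hA : IsLattice ((S k).wside i) := isLattice_wside hμ i
    exact hA.natEntropy_le hX hf hf0 hXf hu hui hfu hK huK (hS.side k i) hι hY hYi
  refine ⟨fun k => (key k).1, ?_⟩
  have hlim : Tendsto (fun k => t + t + K * (∫ ω, ‖X ω - (S k).recon (α k) i (Q k (X ω))‖ ∂P)
      + (Real.exp (t + K * (τ k * r k)) * (1 + t) - 1)) atTop
      (𝓝 (t + t + K * 0 + (Real.exp (t + K * (0 * 0)) * (1 + t) - 1))) := by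
    refine ((hm.const_mul K).const_add (t + t)).add (Tendsto.sub_const ?_ 1)
    exact ((Real.continuous_exp.tendsto _).comp
      (((hS.tendsto.mul hr).const_mul K).const_add t)).mul_const _
  filter_upwards [hlim.eventually_lt_const (show _ < e by simpa using ht)] with k hk
  have h1 := (key k).2
  have h2 := mul_le_mul_of_nonneg_left hu1 (Real.exp_pos (t + K * (τ k * r k))).le
  rw [hneg]
  linarith

/-- The entropies of the central point and of the two descriptions, asymptotically. -/
theorem IsFine.tendsto_entropy (hS : IsFine S r τ ρ) (hL : 1 ≤ L) (hμ : ∀ i, 0 < μ i)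
    (hr : Tendsto r atTop (𝓝 0)) (hX : Measurable X) (hf : Measurable f) (hf0 : ∀ x, 0 ≤ f x)
    (hXf : P.map X = (volume : Measure (E L)).withDensity fun x => ENNReal.ofReal (f x))
    (hfm : Integrable fun x => f x * ‖x‖) (hent : Integrable fun x => f x * Real.log (f x))
    (hQ : ∀ k, (S k).IsQuantizer (Q k)) {α : (k : ℕ) → (S k).Label}
    (hα : ∀ k, (S k).IsLabeling (α k))
    (hm : ∀ i, Tendsto (fun k => ∫ ω, ‖X ω - (S k).recon (α k) i (Q k (X ω))‖ ∂P) atTop (𝓝 0))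
    (hV : Tendsto (fun k => (∫ ω, max 0 (‖(S k).diff (α k) (Q k (X ω))‖ ^ 2 - r k ^ 2) ∂P)
      / r k ^ 2) atTop (𝓝 0)) :
    Tendsto (fun k => (∫ x, Real.negMulLog (f x)) + natEntropy P (fun ω => Q k (X ω))
      - (natEntropy P (fun ω => α k (Q k (X ω)) 0) + natEntropy P (fun ω => α k (Q k (X ω)) 1))
      - (Real.log (cellVol ((S k).wside 0)) + Real.log (cellVol ((S k).wside 1))
        - Real.log (cellVol (S k).central))) atTop (𝓝 0) := by
  have hside := fun (i : Fin 2) {e : ℝ} (he : 0 < e) => hS.eventually_natEntropy_side_le hμ hr hX hf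
    hf0 hXf hfm hent hQ hα i (hm i) he
  have hcentral : ∀ k, ∫ x, Real.negMulLog (f x)
      ≤ natEntropy P (fun ω => Q k (X ω)) + Real.log (cellVol (S k).central) := by
    intro k
    have hfi := integrable_density hX hf hf0 hXf
    have hf1 : ∫ x, f x = 1 := by
      rw [integral_eq_lintegral_of_nonneg_ae (ae_of_all _ hf0) hf.aestronglyMeasurable,
        lintegral_density hX hf hXf, ENNReal.toReal_one]
    -- Any accuracy will do: only the summability of the central entropy is wanted.
    obtain ⟨u, hu, huK, hui, -, hfu, -⟩ := exists_reference hf hf0 hfi hf1 hfm hent one_pos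
    obtain ⟨K, hK, huK⟩ := huK 1 one_pos
    have := (S k).isLattice_central.countable
    refine (S k).isLattice_central.integral_negMulLog_le hX hf hf0 hXf hent (hQ k).measurable
      (hQ k).nearest ?_
    exact ((S k).isLattice_central.natEntropy_le hX hf hf0 hXf hu hui hfu hK huK (hS.central k)
      Function.injective_id ((hQ k).measurable.comp hX)
      (integrable_norm_sub (G := fun c => (c : E L)) (hQ k) hX (hS.central k)
        ⟨0, fun c => by simp⟩)).1
  have hb := ballVol_pos hL
  have hJ : Tendsto (fun n : ℕ => Real.log (ballTail L n / ballVol L)) atTop (𝓝 0) := by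
    have h1 : Tendsto (fun n : ℕ => ballTail L n / ballVol L) atTop (𝓝 1) := by
      have := (tendsto_ballTail (L := L)).div_const (ballVol L)
      rwa [div_self hb.ne'] at this
    have := h1.log one_ne_zero
    rwa [Real.log_one] at this
  rw [Metric.tendsto_nhds]
  intro e he
  -- The slope `n` is fixed before `k`, so that `n` times the vanishing excess still tends to `0`.
  obtain ⟨n, hn, hn1⟩ := ((hJ.eventually_lt_const (show 0 < e / 8 by positivity)).and
    (eventually_ge_atTop 1)).exists
  have hn1' : (1 : ℝ) ≤ n := by exact_mod_cast hn1
  have hz : Tendsto (fun k => n * τ k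
      + n * ((∫ ω, max 0 (‖(S k).diff (α k) (Q k (X ω))‖ ^ 2 - r k ^ 2) ∂P) / r k ^ 2)) atTop
      (𝓝 (n * 0 + n * 0)) := (hS.tendsto.const_mul _).add (hV.const_mul _)
  have he8 : 0 < e / 8 := by positivity
  filter_upwards [(hside 0 he8).2, (hside 1 he8).2,
    hz.eventually_lt_const (show _ < e / 8 by simpa using he8)] with k h0 h1 h2
  have h3 := hcentral k
  have h4 := natEntropy_central_le (P := P) hL hμ hX (hQ k) (hα k) (hS.scale k) hn1'
    (i := 0) (j := 1) (by decide) (hS.side k 1) ((hside 0 he8).1 k)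
  have h5 := natEntropy_central_le (P := P) hL hμ hX (hQ k) (hα k) (hS.scale k) hn1'
    (i := 1) (j := 0) (by decide) (hS.side k 0) ((hside 1 he8).1 k)
  -- Lower bound: both side estimates together with `h3`. Upper bound: `h4` removes the central and
  -- first side entropies, and `h3` with `h5` bounds the differential entropy by the second side
  -- entropy plus the logarithm of its cell volume.
  rw [Real.dist_eq, sub_zero, abs_lt]
  constructor <;> linarith

end LatticeSystem

end MDC

end

/-! ### The scale of the differences, and constants -/

noncomputable section

namespace MDC

namespace LatticeSystem

variable {L : ℕ} {μ : Fin 2 → ℝ}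

/-- The volume `ν_c N₀ N₁ μ₀ μ₁` of the ball that the differences of the side reconstructions
fill. -/
def diffVol (S : LatticeSystem L μ) : ℝ :=
  cellVol S.central * (S.index 0 * S.index 1) * (μ 0 * μ 1)

/-- The radius of the ball that the differences of the side reconstructions fill. -/
def diffRadius (S : LatticeSystem L μ) : ℝ := (S.diffVol / ballVol L) ^ (1 / (L : ℝ))

theorem index_pos (S : LatticeSystem L μ) (i : Fin 2) : 0 < S.index i :=
  div_pos (S.isLattice_side i).cellVol_pos S.isLattice_central.cellVol_pos

theorem diffVol_pos (S : LatticeSystem L μ) (hμ : ∀ i, 0 < μ i) : 0 < S.diffVol :=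
  mul_pos (mul_pos S.isLattice_central.cellVol_pos (mul_pos (S.index_pos 0) (S.index_pos 1)))
    (mul_pos (hμ 0) (hμ 1))

theorem diffRadius_pos (S : LatticeSystem L μ) (hL : 1 ≤ L) (hμ : ∀ i, 0 < μ i) :
    0 < S.diffRadius := Real.rpow_pos_of_pos (div_pos (S.diffVol_pos hμ) (ballVol_pos hL)) _

theorem diffVol_eq (S : LatticeSystem L μ) (hL : 1 ≤ L) (hμ : ∀ i, 0 < μ i) :
    S.diffVol = ballVol L * S.diffRadius ^ L := by
  have hb := ballVol_pos hL
  have : (L : ℝ) ≠ 0 := by positivity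
  rw [diffRadius, ← Real.rpow_natCast, ← Real.rpow_mul (div_pos (S.diffVol_pos hμ) hb).le,
    one_div_mul_cancel this, Real.rpow_one, mul_div_cancel₀ _ hb.ne']

theorem diffVol_mul (S : LatticeSystem L μ) (hL : 1 ≤ L) (hμ : ∀ i, 0 < μ i) :
    S.diffVol * cellVol S.central = cellVol (S.wside 0) * cellVol (S.wside 1) := by
  have h := S.isLattice_central.cellVol_pos
  rw [diffVol, index, index, cellVol_wside hμ hL, cellVol_wside hμ hL]
  field_simp

theorem isScale_diffRadius (S : LatticeSystem L μ) (hL : 1 ≤ L) (hμ : ∀ i, 0 < μ i) :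
    S.IsScale S.diffRadius :=
  ⟨S.diffRadius_pos hL hμ, by rw [← S.diffVol_eq hL hμ, S.diffVol_mul hL hμ]⟩

theorem log_diffVol (S : LatticeSystem L μ) (hL : 1 ≤ L) (hμ : ∀ i, 0 < μ i) :
    Real.log S.diffVol = Real.log (cellVol (S.wside 0)) + Real.log (cellVol (S.wside 1))
      - Real.log (cellVol S.central) := by
  have h := congrArg Real.log (S.diffVol_mul hL hμ)
  rw [Real.log_mul (S.diffVol_pos hμ).ne' S.isLattice_central.cellVol_pos.ne',
    Real.log_mul (isLattice_wside hμ 0).cellVol_pos.ne' (isLattice_wside hμ 1).cellVol_pos.ne'] at h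
  linarith

theorem rpow_eq_mul_diffRadius (S : LatticeSystem L μ) (hL : 1 ≤ L) (hμ : ∀ i, 0 < μ i) {ν : ℝ}
    (hν : 0 < ν) :
    ν ^ (1 / (L : ℝ)) = (ν / (S.diffVol / ballVol L)) ^ (1 / (L : ℝ)) * S.diffRadius := by
  have h := div_pos (S.diffVol_pos hμ) (ballVol_pos hL)
  rw [diffRadius, ← Real.mul_rpow (div_pos hν h).le h.le, div_mul_cancel₀ _ h.ne']

theorem tendsto_rpow_one_div (hL : 1 ≤ L) {a : ℕ → ℝ} (ha : Tendsto a atTop (𝓝 0)) :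
    Tendsto (fun k => a k ^ (1 / (L : ℝ))) atTop (𝓝 0) := by
  have h0 : (0 : ℝ) < 1 / (L : ℝ) := by positivity
  have := ha.rpow_const (p := 1 / (L : ℝ)) (Or.inr h0.le)
  rwa [Real.zero_rpow h0.ne'] at this

variable {S : ℕ → LatticeSystem L μ}

theorem tendsto_diffRadius (hL : 1 ≤ L)
    (h : Tendsto (fun k => cellVol (S k).central * ((S k).index 0 * (S k).index 1)) atTop (𝓝 0)) :
    Tendsto (fun k => (S k).diffRadius) atTop (𝓝 0) := by
  refine tendsto_rpow_one_div hL ?_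
  have := (h.mul_const (μ 0 * μ 1)).div_const (ballVol L)
  rwa [zero_mul, zero_div] at this

/-- Sequences of lattice systems with bounded normalized covering radii and with index values that
tend to infinity are fine with respect to the radius of the ball of differences. -/
theorem exists_isFine (hL : 1 ≤ L) (hμ : ∀ i, 0 < μ i) {C : ℝ}
    (hCc : ∀ k, CoveringRadiusLE (S k).central (C * cellVol (S k).central ^ (1 / (L : ℝ))))
    (hCs : ∀ k i, CoveringRadiusLE ((S k).side i) (C * cellVol ((S k).side i) ^ (1 / (L : ℝ))))
    (hN : ∀ i, Tendsto (fun k => (S k).index i) atTop atTop)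
    {ρ : ℕ → ℝ} (hρ : Tendsto ρ atTop (𝓝 0)) (hCπ : ∀ k, CoveringRadiusLE (S k).prod (ρ k)) :
    ∃ τ : ℕ → ℝ, IsFine S (fun k => (S k).diffRadius) τ ρ := by
  have hb := ballVol_pos hL
  have hνc := fun k => (S k).isLattice_central.cellVol_pos
  have hνs := fun k i => ((S k).isLattice_side i).cellVol_pos
  have hV := fun k => (S k).diffVol_pos hμ
  have hC : 0 ≤ C := nonneg_of_mul_nonneg_left (hCc 0).nonneg (Real.rpow_pos_of_pos (hνc 0) _)
  let c : ℕ → ℝ := fun k => (cellVol (S k).central / ((S k).diffVol / ballVol L)) ^ (1 / (L : ℝ))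
  let w : Fin 2 → ℕ → ℝ := fun i k =>
    (μ i * cellVol ((S k).side i) / ((S k).diffVol / ballVol L)) ^ (1 / (L : ℝ))
  have hc0 : ∀ k, 0 ≤ c k := fun k =>
    Real.rpow_nonneg (div_pos (hνc k) (div_pos (hV k) hb)).le _
  have hw0 : ∀ i k, 0 ≤ w i k := fun i k =>
    Real.rpow_nonneg (div_pos (mul_pos (hμ i) (hνs k i)) (div_pos (hV k) hb)).le _
  have hr := fun k => (S k).diffRadius_pos hL hμ
  have hμ0 := hμ 0
  have hμ1 := hμ 1
  -- The ratio of the weighted cell volume of side `i` to `diffVol` is `1 / (μ j * N j)`: each side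
  -- lattice is fine at scale `r` because the other index grows.
  have hwlim : ∀ i j, i ≠ j → Tendsto (w i) atTop (𝓝 0) := by
    intro i j hij
    refine tendsto_rpow_one_div hL ?_
    have h := (tendsto_const_nhds (x := ballVol L)).div_atTop ((hN j).const_mul_atTop (hμ j))
    refine h.congr fun k => ?_
    have h1 := (hνc k).ne'
    have h2 := (hνs k 0).ne'
    have h3 := (hνs k 1).ne'
    fin_cases i <;> fin_cases j <;> first
      | exact absurd rfl hij
      | (simp only [Fin.zero_eta, Fin.mk_one, diffVol, index]; field_simp)
  have hclim : Tendsto c atTop (𝓝 0) := by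
    refine tendsto_rpow_one_div hL ?_
    have h := (tendsto_const_nhds (x := ballVol L)).div_atTop
      (((hN 0).atTop_mul_atTop₀ (hN 1)).const_mul_atTop (mul_pos hμ0 hμ1))
    refine h.congr fun k => ?_
    have h1 := (hνc k).ne'
    have h2 := (hνs k 0).ne'
    have h3 := (hνs k 1).ne'
    simp only [diffVol, index]
    field_simp
  refine ⟨fun k => C * (c k + w 0 k + w 1 k), fun k => (S k).isScale_diffRadius hL hμ, fun k => ?_,
    ?_, fun k => ?_, fun k i => ?_, hCπ, hρ⟩
  · exact mul_nonneg hC (add_nonneg (add_nonneg (hc0 k) (hw0 0 k)) (hw0 1 k))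
  · have := ((hclim.add (hwlim 0 1 (by decide))).add (hwlim 1 0 (by decide))).const_mul C
    simpa using this
  · refine (hCc k).mono ?_
    rw [(S k).rpow_eq_mul_diffRadius hL hμ (hνc k), ← mul_assoc]
    refine mul_le_mul_of_nonneg_right (mul_le_mul_of_nonneg_left ?_ hC) (hr k).le
    show c k ≤ _
    linarith [hw0 0 k, hw0 1 k]
  · refine ((hCs k i).scaled (linScale_pos L (hμ i))).mono ?_
    rw [mul_left_comm, linScale, ← Real.mul_rpow (hμ i).le (hνs k i).le,
      (S k).rpow_eq_mul_diffRadius hL hμ (mul_pos (hμ i) (hνs k i)), ← mul_assoc]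
    refine mul_le_mul_of_nonneg_right (mul_le_mul_of_nonneg_left ?_ hC) (hr k).le
    show w i k ≤ _
    have h0 := hw0 0 k
    have h1 := hw0 1 k
    have h2 := hc0 k
    fin_cases i <;> simp only [Fin.zero_eta, Fin.mk_one] <;> linarith

theorem sphereG_mul_diffVol (S : LatticeSystem L μ) (hL : 1 ≤ L) (hμ : ∀ i, 0 < μ i) :
    sphereG L * cellVol S.central ^ (2 / (L : ℝ)) * (S.index 0 * S.index 1) ^ (2 / (L : ℝ))
      * (μ 0 * μ 1) ^ (2 / (L : ℝ)) = S.diffRadius ^ 2 / ((L : ℝ) + 2) := by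
  have h1 := S.isLattice_central.cellVol_pos.le
  have h2 := (mul_pos (S.index_pos 0) (S.index_pos 1)).le
  have h3 := (mul_pos (hμ 0) (hμ 1)).le
  rw [← sphereG_mul_rpow hL (S.diffRadius_pos hL hμ).le (S.diffVol_eq hL hμ), diffVol,
    Real.mul_rpow (mul_nonneg h1 h2) h3, Real.mul_rpow h1 h2]
  ring

variable {Ω : Type*} [MeasurableSpace Ω] {P : Measure Ω} {X : Ω → E L}

/-- The factor that depends on the rates, expressed by the entropies in nats. -/
theorem two_rpow_entropy (hL : 1 ≤ L) (hμ : ∀ i, 0 < μ i) (f : E L → ℝ) (S : LatticeSystem L μ)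
    (Q : E L → S.central) (α : S.Label) :
    (2 : ℝ) ^ (2 / (L : ℝ) * diffEntropyBits f)
      * (2 : ℝ) ^ (2 * (S.centralRate P X Q - (S.sideRate P X Q α 0 + S.sideRate P X Q α 1)))
    = S.diffVol ^ (2 / (L : ℝ)) * Real.exp (2 / (L : ℝ) * ((∫ x, Real.negMulLog (f x))
      + natEntropy P (fun ω => Q (X ω))
      - (natEntropy P (fun ω => α (Q (X ω)) 0) + natEntropy P (fun ω => α (Q (X ω)) 1))
      - (Real.log (cellVol (S.wside 0)) + Real.log (cellVol (S.wside 1))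
        - Real.log (cellVol S.central)))) := by
  have hl : Real.log 2 ≠ 0 := (Real.log_pos one_lt_two).ne'
  have hL0 : (L : ℝ) ≠ 0 := by positivity
  rw [← S.log_diffVol hL hμ, ← Real.rpow_add two_pos, Real.rpow_def_of_pos two_pos,
    Real.rpow_def_of_pos (S.diffVol_pos hμ), ← Real.exp_add, diffEntropyBits, integral_div,
    centralRate, sideRate, sideRate, entropyBits_eq, entropyBits_eq, entropyBits_eq]
  congr 1
  field_simp
  ring

end LatticeSystem

end MDC

end

/-! ### Assembly of the theorem -/

theorem mainTheorem3 {L : ℕ} (hL : 1 ≤ L)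
    -- description weights and distortion weights
    (μ γ : Fin 2 → ℝ) (hμ : ∀ i, 0 < μ i) (hγ : ∀ i, 0 < γ i)
    -- the source: density, finite differential entropy, finite second moment
    {Ω : Type*} [MeasurableSpace Ω] (P : Measure Ω) [IsProbabilityMeasure P]
    (X : Ω → MDC.E L) (hX : Measurable X)
    (f : MDC.E L → ℝ) (hf : Measurable f) (hf0 : ∀ x, 0 ≤ f x)
    (hXf : P.map X = (volume : Measure (MDC.E L)).withDensity fun x => ENNReal.ofReal (f x))
    (hent : Integrable (fun x => f x * Real.log (f x)))
    (hmom : Integrable (fun ω => ‖X ω‖ ^ 2) P)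
    -- a sequence of schemes
    (S : ℕ → MDC.LatticeSystem L μ)
    (Q : (k : ℕ) → MDC.E L → (S k).central) (hQ : ∀ k, (S k).IsQuantizer (Q k))
    (α : (k : ℕ) → (S k).Label) (hα : ∀ k, (S k).IsOptimal P X (Q k) γ (α k))
    -- the covering radii of the lattices are of the order of (cell volume) ^ (1 / L)
    (C : ℝ)
    (hCc : ∀ k, MDC.CoveringRadiusLE (S k).central
      (C * MDC.cellVol (S k).central ^ (1 / (L : ℝ))))
    (hCs : ∀ k i, MDC.CoveringRadiusLE ((S k).side i)
      (C * MDC.cellVol ((S k).side i) ^ (1 / (L : ℝ))))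
    -- the index values tend to infinity and the resolution becomes high
    (hN : ∀ i, Tendsto (fun k => (S k).index i) atTop atTop)
    (hν : ∀ i, Tendsto (fun k => MDC.cellVol ((S k).side i)) atTop (𝓝 0))
    (hνπ : Tendsto (fun k => MDC.cellVol (S k).central * ((S k).index 0 * (S k).index 1))
      atTop (𝓝 0))
    (ρ : ℕ → ℝ) (hρ : Tendsto ρ atTop (𝓝 0))
    (hCπ : ∀ k, MDC.CoveringRadiusLE (S k).prod (ρ k)) :
    (∀ i j : Fin 2, i ≠ j →
      ((fun k => (S k).sideDist P X (Q k) (α k) i) ~[atTop] fun k =>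
        γ j ^ 2 / (γ 0 + γ 1) ^ 2 * MDC.sphereG L
          * MDC.cellVol (S k).central ^ (2 / (L : ℝ))
          * ((S k).index 0 * (S k).index 1) ^ (2 / (L : ℝ))
          * (μ 0 * μ 1) ^ (2 / (L : ℝ))) ∧
      ((fun k => (S k).sideDist P X (Q k) (α k) i) ~[atTop] fun k =>
        γ j ^ 2 / (γ 0 + γ 1) ^ 2 * MDC.sphereG L
          * (2 : ℝ) ^ (2 / (L : ℝ) * MDC.diffEntropyBits f)
          * (2 : ℝ) ^ (2 * ((S k).centralRate P X (Q k)
              - ((S k).sideRate P X (Q k) (α k) 0 + (S k).sideRate P X (Q k) (α k) 1))))) ∧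
    (∀ Λ : Submodule ℤ (MDC.E L), MDC.IsLattice Λ →
      MDC.sphereG L ≤ MDC.latticeG Λ ∧ (2 ≤ L → MDC.sphereG L < MDC.latticeG Λ)) := by
  classical
  have hs : 0 < γ 0 + γ 1 := add_pos (hγ 0) (hγ 1)
  obtain ⟨τ, hS⟩ := MDC.LatticeSystem.exists_isFine hL hμ hCc hCs hN hρ hCπ
  have hr0 := fun k => (S k).diffRadius_pos hL hμ
  have hr := MDC.LatticeSystem.tendsto_diffRadius hL hνπ
  have hαl := fun k => (hα k).1
  obtain ⟨hW, hD, hV⟩ := hS.tendsto_of_isOptimal hL hμ hX hf hf0 hXf hQ hγ hα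
  have hL0 : (L : ℝ) ≠ 0 := by positivity
  have hrec : ∀ k i, ∃ B : ℝ, ∀ c : (S k).central,
      ‖(c : MDC.E L) - (S k).recon (α k) i c‖ ≤ B := fun k i =>
    MDC.LatticeSystem.exists_norm_sub_recon_le (hαl k) i
  have hdist : ∀ i j : Fin 2, i ≠ j →
      Tendsto (fun k => (∫ ω, ‖X ω - (S k).recon (α k) i (Q k (X ω))‖ ^ 2 ∂P)
        / (S k).diffRadius ^ 2) atTop
        (𝓝 (γ j ^ 2 / (γ 0 + γ 1) ^ 2 * ((L : ℝ) / ((L : ℝ) + 2)))) := by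
    intro i j hij
    rw [← div_pow]
    fin_cases i <;> fin_cases j <;> first
      | exact absurd rfl hij
      | skip
    -- Side 0 is `mid - θ • diff`.
    · refine hS.tendsto_integral_norm_sq hL hX hQ hαl hW hD (γ 1 / (γ 0 + γ 1))
        (fun k => (S k).recon (α k) 0) (fun k => hrec k 0) fun k c => ?_
      rw [MDC.LatticeSystem.mid]
      abel
    -- Side 1 is `mid + (1 - θ) • diff`; the sign disappears in the square.
    · have h := hS.tendsto_integral_norm_sq hL hX hQ hαl hW hD (-(γ 0 / (γ 0 + γ 1)))
        (fun k => (S k).recon (α k) 1) (fun k => hrec k 1) fun k c => ?_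
      · rwa [neg_sq] at h
      · have e : γ 1 / (γ 0 + γ 1) = 1 - γ 0 / (γ 0 + γ 1) := by field_simp; ring
        rw [MDC.LatticeSystem.mid, e, MDC.LatticeSystem.diff]
        module
  have hm : ∀ i, Tendsto (fun k => ∫ ω, ‖X ω - (S k).recon (α k) i (Q k (X ω))‖ ∂P)
      atTop (𝓝 0) := by
    intro i
    obtain ⟨j, hij⟩ : ∃ j, i ≠ j := (exists_ne i).imp fun _ h => h.symm
    exact MDC.LatticeSystem.tendsto_integral_norm
      (Y := fun k ω => X ω - (S k).recon (α k) i (Q k (X ω))) hr0 hr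
      (fun k => MDC.LatticeSystem.integrable_norm_sub (G := (S k).recon (α k) i) (hQ k) hX
        (hS.central k) (hrec k i))
      (fun k => MDC.LatticeSystem.integrable_norm_sq_sub_recon (G := (S k).recon (α k) i) (hQ k) hX
        (hS.central k) (hrec k i)) (hdist i j hij)
  have hfm : Integrable fun x => f x * ‖x‖ := by
    refine (MDC.integrable_comp_density hX hf hf0 hXf measurable_norm).1.1 ?_
    refine ((integrable_const 1).add hmom).mono' hX.norm.aestronglyMeasurable
      (ae_of_all _ fun ω => ?_)
    rw [norm_norm, Pi.add_apply]
    nlinarith [sq_nonneg (‖X ω‖ - 1)]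
  have hT := hS.tendsto_entropy hL hμ hr hX hf hf0 hXf hfm hent hQ hαl hm hV
  have hfirst : ∀ i j : Fin 2, i ≠ j →
      ((fun k => (S k).sideDist P X (Q k) (α k) i) ~[atTop] fun k =>
        γ j ^ 2 / (γ 0 + γ 1) ^ 2 * ((S k).diffRadius ^ 2 / ((L : ℝ) + 2))) := by
    intro i j hij
    have hγj := hγ j
    rw [isEquivalent_iff_tendsto_one (Eventually.of_forall fun k => by
      have := hr0 k
      positivity)]
    have h := (hdist i j hij).div_const (γ j ^ 2 / (γ 0 + γ 1) ^ 2 * ((L : ℝ) / ((L : ℝ) + 2)))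
    rw [div_self (by positivity)] at h
    refine h.congr fun k => ?_
    have := (hr0 k).ne'
    simp only [Pi.div_apply, MDC.LatticeSystem.sideDist, MDC.sqErr]
    rw [integral_div]
    field_simp
  refine ⟨fun i j hij => ⟨?_, ?_⟩, fun Λ hΛ =>
    ⟨(hΛ.sphereG_le_latticeG hL).1, fun h2 => hΛ.sphereG_lt_latticeG h2⟩⟩
  · refine (hfirst i j hij).congr_right (Eventually.of_forall fun k => ?_)
    simp only
    rw [← (S k).sphereG_mul_diffVol hL hμ]
    ring
  · refine (hfirst i j hij).trans ?_
    have hγj := hγ j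
    have hexp := (Real.continuous_exp.tendsto _).comp (hT.const_mul (2 / (L : ℝ)))
    rw [mul_zero, Real.exp_zero] at hexp
    -- The quotient of the rate expression and the volume expression is the exponential of `2 / L`
    -- times the null sequence in `hT`.
    have heq : (fun k => γ j ^ 2 / (γ 0 + γ 1) ^ 2 * MDC.sphereG L
          * (2 : ℝ) ^ (2 / (L : ℝ) * MDC.diffEntropyBits f)
          * (2 : ℝ) ^ (2 * ((S k).centralRate P X (Q k)
              - ((S k).sideRate P X (Q k) (α k) 0 + (S k).sideRate P X (Q k) (α k) 1))))
        ~[atTop] fun k => γ j ^ 2 / (γ 0 + γ 1) ^ 2 * ((S k).diffRadius ^ 2 / ((L : ℝ) + 2)) := by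
      rw [isEquivalent_iff_tendsto_one (Eventually.of_forall fun k => by
        have := hr0 k
        positivity)]
      refine hexp.congr fun k => ?_
      have hrk := hr0 k
      rw [Pi.div_apply, mul_assoc _ ((2 : ℝ) ^ _) _, MDC.LatticeSystem.two_rpow_entropy hL hμ,
        ← MDC.sphereG_mul_rpow hL hrk.le ((S k).diffVol_eq hL hμ)]
      have hG : MDC.sphereG L * (S k).diffVol ^ (2 / (L : ℝ)) ≠ 0 := by
        rw [MDC.sphereG_mul_rpow hL hrk.le ((S k).diffVol_eq hL hμ)]
        positivity
      rw [eq_div_iff (mul_ne_zero (by positivity) hG)]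
      simp only [Function.comp_apply]
      ring
    exact heq.symm
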